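/- Let $k$ be an algebraically closed field of characteristic zero, let $U$ and $V$ be $k$-vector spaces of dimensions $m$ and $n$ with $m \le n$, let $1 \le r \le m-1$, and put $W = U \otimes V$. Let $\mathbb{G} = \mathbb{G}(U,r)$ be the Grassmannian of $r$-dimensional quotients of $U$, with tautological sequence $0 \to \mathcal{U} \to U \otimes \mathcal{O}_{\mathbb{G}} \to \mathcal{Q} \to 0$, and let $\mathcal{X} = \mathbb{P}(V \otimes \mathcal{Q})$ and $\mathcal{Y} = \mathbb{P}(V^\vee \otimes \mathcal{U}^\vee)$ be the projective bundles of rank-one quotients, with the morphisms $\mathcal{X} \to \mathbb{P}W$ and $\mathcal{Y} \to \mathbb{P}W^\vee$ given by their tautological line bundles. For a subspace $L \subset W$ of dimension $c$, $1 \le c \le mn$, with orthogonal $L^\perp \subset W^\vee$, set $$X_L = \mathcal{X} \times_{\mathbb{P}W} \mathbb{P}(W/L), \qquad Y_L = \mathcal{Y} \times_{\mathbb{P}W^\vee} \mathbb{P}(W^\vee/L^\perp).$$ Assume that $L$ is admissible, i.e. that $X_L$ and $Y_L$ have the expected dimensions $$\dim X_L = r(n+m-r)-c-1, \qquad \dim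 Y_L = r(m-n-r)+c-1$$ (where a negative expected dimension means that the scheme is empty). Then $X_L$ is rational if $nr > c$, and $Y_L$ is rational if $c > nr$. Here a scheme over $k$ is called rational if it has a dense open subscheme that is isomorphic over $k$ to a dense open subscheme of an affine space $\mathbb{A}^d_k$. -/

import Mathlib

open CategoryTheory CategoryTheory.Limits AlgebraicGeometry

noncomputable section

namespace Determinantal

universe u

/-- Let `U` and `V` be the free modules with bases `u_1, ..., u_m` and `v_1, ..., v_n`. A pair
`(A, B)` over `S` encodes a map `A : U ⟶ S ^ r` (whose columns are the images of the `u_l`), to be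
thought of as a rank `r` quotient `Q` of `U` with a chosen frame, together with a linear form `B` on
`V ⊗ Q` (its value on `v_j ⊗ q_s` is `B j s`), to be thought of as a rank one quotient of `V ⊗ Q`
with a chosen generator. Forgetting the frame and the generator means to divide by the action
`(A, B) ↦ (g⁻¹ A, b⁻¹ B g)` of invertible matrices `g` and units `b`. -/
@[ext]
structure FactorPair (m n r : ℕ) (S : Type*) where
  A : Matrix (Fin r) (Fin m) S
  B : Matrix (Fin n) (Fin r) S

/-- Index of a standard affine chart of the projective bundle `ℙ(V ⊗ Q)` over the Grassmannian of
rank `r` quotients `U ⟶ Q`: an `r`-element subset `I` of the basis of `U` whose image is required to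
be a frame of `Q`, and a vector `v_j ⊗ q_s` of the resulting basis of `V ⊗ Q` (where `q_s` is the
image of the `s`-th member of `I`) whose image in the rank one quotient is required to generate. -/
structure ChartIndex (m n r : ℕ) where
  I : Fin r ↪o Fin m
  j : Fin n
  s : Fin r

namespace FactorPair

variable {m n r : ℕ} {S T : Type*} [CommRing S] [CommRing T]

/-- The linear form on `V ⊗ U` obtained by composition, `v_j ⊗ u_l ↦ (B A) j l`. -/
def product (P : FactorPair m n r S) : Matrix (Fin n) (Fin m) S := P.B * P.A

/-- Base change of a pair along a ring homomorphism. -/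
def map (φ : S →+* T) (P : FactorPair m n r S) : FactorPair m n r T :=
  ⟨P.A.map φ, P.B.map φ⟩

/-- The `r × r` block of `A` with columns in `I`. -/
def block (c : ChartIndex m n r) (P : FactorPair m n r S) : Matrix (Fin r) (Fin r) S :=
  P.A.submatrix id c.I

/-- The value of the linear form at `v_j ⊗ u_(I s)`. -/
def pivot (c : ChartIndex m n r) (P : FactorPair m n r S) : S :=
  (P.B * P.block c) c.j c.s

/-- The function on pairs whose non-vanishing defines the chart `c`. -/
def locus (c : ChartIndex m n r) (P : FactorPair m n r S) : S :=
  (P.block c).det * P.pivot c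

/-- The frame is the one given by `I`, and the generator is the one given by `(j, s)`. -/
structure IsNormalized (c : ChartIndex m n r) (P : FactorPair m n r S) : Prop where
  block_eq : P.block c = 1
  entry_eq : P.B c.j c.s = 1

/-- Change of frame and generator to those given by the chart `c`. -/
def normalize (c : ChartIndex m n r) (P : FactorPair m n r S) : FactorPair m n r S :=
  ⟨(P.block c)⁻¹ * P.A, Ring.inverse (P.pivot c) • (P.B * P.block c)⟩

variable {c d : ChartIndex m n r} {P : FactorPair m n r S}

lemma IsNormalized.pivot_eq (h : P.IsNormalized c) : P.pivot c = 1 := by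
  simp [pivot, h.block_eq, h.entry_eq]

lemma IsNormalized.locus_eq (h : P.IsNormalized c) : P.locus c = 1 := by
  simp [locus, h.pivot_eq, h.block_eq]

lemma block_normalize : (P.normalize c).block d = (P.block c)⁻¹ * P.block d := by
  ext a b
  simp [normalize, block, Matrix.mul_apply]

lemma normalize_isNormalized (h : IsUnit (P.locus c)) : (P.normalize c).IsNormalized c := by
  have h1 : IsUnit (P.block c).det := isUnit_of_mul_isUnit_left h
  have h2 : IsUnit (P.pivot c) := isUnit_of_mul_isUnit_right h
  refine ⟨?_, ?_⟩
  · rw [block_normalize, Matrix.nonsing_inv_mul _ h1]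
  · change Ring.inverse (P.pivot c) * P.pivot c = 1
    exact Ring.inverse_mul_cancel _ h2

lemma IsNormalized.normalize_eq (h : P.IsNormalized c) : P.normalize c = P := by
  ext a b
  · simp [normalize, h.block_eq]
  · simp [normalize, h.block_eq, h.pivot_eq]

lemma B_mul_block_normalize (h : IsUnit (P.locus c)) :
    (P.normalize c).B * (P.normalize c).block d =
      Ring.inverse (P.pivot c) • (P.B * P.block d) := by
  have h1 : IsUnit (P.block c).det := isUnit_of_mul_isUnit_left h
  rw [block_normalize]
  simp only [normalize, Matrix.smul_mul]
  rw [Matrix.mul_assoc, Matrix.mul_nonsing_inv_cancel_left _ _ h1]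

lemma pivot_normalize (h : IsUnit (P.locus c)) :
    (P.normalize c).pivot d = Ring.inverse (P.pivot c) * P.pivot d := by
  simp [pivot, B_mul_block_normalize h]

lemma det_block_normalize :
    ((P.normalize c).block d).det = Ring.inverse (P.block c).det * (P.block d).det := by
  rw [block_normalize, Matrix.det_mul, Matrix.det_nonsing_inv]

lemma isUnit_locus_normalize (h : IsUnit (P.locus c)) (hd : IsUnit (P.locus d)) :
    IsUnit ((P.normalize c).locus d) := by
  have h1 : IsUnit (P.block c).det := isUnit_of_mul_isUnit_left h
  have h2 : IsUnit (P.pivot c) := isUnit_of_mul_isUnit_right h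
  have h3 : IsUnit (P.block d).det := isUnit_of_mul_isUnit_left hd
  have h4 : IsUnit (P.pivot d) := isUnit_of_mul_isUnit_right hd
  rw [locus, pivot_normalize h, det_block_normalize]
  exact ((h1.ringInverse).mul h3).mul ((h2.ringInverse).mul h4)

lemma normalize_normalize (h : IsUnit (P.locus c)) (hd : IsUnit (P.locus d)) :
    (P.normalize c).normalize d = P.normalize d := by
  have h1 : IsUnit (P.block c).det := isUnit_of_mul_isUnit_left h
  have h2 : IsUnit (P.pivot c) := isUnit_of_mul_isUnit_right h
  have h3 : IsUnit (P.block d).det := isUnit_of_mul_isUnit_left hd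
  have h4 : IsUnit (P.pivot d) := isUnit_of_mul_isUnit_right hd
  have hA : ((P.normalize c).normalize d).A = (P.normalize d).A := by
    change ((P.normalize c).block d)⁻¹ * ((P.block c)⁻¹ * P.A) = (P.block d)⁻¹ * P.A
    rw [block_normalize, Matrix.mul_inv_rev, Matrix.nonsing_inv_nonsing_inv _ h1,
      Matrix.mul_assoc, Matrix.mul_nonsing_inv_cancel_left _ _ h1]
  have hB : ((P.normalize c).normalize d).B = (P.normalize d).B := by
    change Ring.inverse ((P.normalize c).pivot d) • ((P.normalize c).B * (P.normalize c).block d) =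
      Ring.inverse (P.pivot d) • (P.B * P.block d)
    rw [B_mul_block_normalize h, pivot_normalize h, smul_smul]
    congr 1
    obtain ⟨a, ha⟩ := h2
    obtain ⟨b, hb⟩ := h4
    rw [← ha, ← hb, Ring.inverse_unit, ← Units.val_mul, Ring.inverse_unit, Ring.inverse_unit,
      ← Units.val_mul]
    simp
  exact FactorPair.ext hA hB

lemma product_normalize (h : IsUnit (P.locus c)) :
    (P.normalize c).product = Ring.inverse (P.pivot c) • P.product := by
  have h1 : IsUnit (P.block c).det := isUnit_of_mul_isUnit_left h
  simp only [product, normalize, Matrix.smul_mul]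
  rw [Matrix.mul_assoc, Matrix.mul_nonsing_inv_cancel_left _ _ h1]

lemma pivot_eq_product : P.pivot c = P.product c.j (c.I c.s) := by
  simp [pivot, product, block, Matrix.mul_apply]

/-- The homogeneous coordinates of the image point in `ℙ(U ⊗ V)`. -/
def coords (P : FactorPair m n r S) : Fin n × Fin m → S := fun p => P.product p.1 p.2

lemma coords_pivot : P.coords (c.j, c.I c.s) = P.pivot c := pivot_eq_product.symm

lemma coords_normalize (h : IsUnit (P.locus c)) :
    (P.normalize c).coords = Ring.inverse (P.pivot c) • P.coords := by
  ext p; simp [coords, product_normalize h]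

lemma map_block (φ : S →+* T) : (P.map φ).block c = (P.block c).map φ := rfl

lemma map_product (φ : S →+* T) : (P.map φ).product = P.product.map φ := by
  simp [map, product, Matrix.map_mul]

lemma map_coords (φ : S →+* T) : (P.map φ).coords = φ ∘ P.coords := by
  ext p; simp [coords, map_product]

lemma map_pivot (φ : S →+* T) : (P.map φ).pivot c = φ (P.pivot c) := by
  simp [pivot_eq_product, map_product]

lemma map_locus (φ : S →+* T) : (P.map φ).locus c = φ (P.locus c) := by
  rw [locus, locus, map_pivot, map_block, map_mul, RingHom.map_det]; rfl

lemma map_map {R : Type*} [CommRing R] (φ : S →+* T) (ψ : T →+* R) :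
    (P.map φ).map ψ = P.map (ψ.comp φ) := rfl

lemma IsNormalized.map (h : P.IsNormalized c) (φ : S →+* T) : (P.map φ).IsNormalized c := by
  refine ⟨?_, ?_⟩
  · rw [map_block, h.block_eq]; simp
  · simp [FactorPair.map, h.entry_eq]

lemma map_normalize (φ : S →+* T) (h : IsUnit (P.locus c)) :
    (P.map φ).normalize c = (P.normalize c).map φ := by
  have h' : IsUnit ((P.map φ).locus c) := by rw [map_locus]; exact h.map φ
  have h1 : IsUnit ((P.map φ).block c).det := isUnit_of_mul_isUnit_left h'
  have h2 : IsUnit (P.pivot c) := isUnit_of_mul_isUnit_right h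
  have h3 : IsUnit (P.block c).det := isUnit_of_mul_isUnit_left h
  apply FactorPair.ext
  · change ((P.map φ).block c)⁻¹ * P.A.map φ = ((P.block c)⁻¹ * P.A).map φ
    rw [Matrix.map_mul]
    congr 1
    apply Matrix.inv_eq_left_inv
    rw [map_block, ← Matrix.map_mul, Matrix.nonsing_inv_mul _ h3]
    simp
  · change Ring.inverse ((P.map φ).pivot c) • (P.B.map φ * (P.block c).map φ) =
      (Ring.inverse (P.pivot c) • (P.B * P.block c)).map φ
    rw [map_pivot]
    obtain ⟨a, ha⟩ := h2
    rw [← ha, Ring.inverse_unit]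
    have : φ (a : S) = (Units.map (φ : S →* T) a : T) := rfl
    rw [this, Ring.inverse_unit, ← Matrix.map_mul]
    ext i j
    simp only [Matrix.smul_apply, Matrix.map_apply, smul_eq_mul, map_mul]
    rfl

end FactorPair

section Chart
variable {m n r : ℕ}

/-- The coordinates on the chart `c`: the entries of `A` outside the columns in `I`, and the
entries of `B` other than the one at `(j, s)`. -/
def ChartVar (c : ChartIndex m n r) : Type :=
  {p : Fin r × Fin m // p.2 ∉ Set.range c.I} ⊕ {q : Fin n × Fin r // q ≠ (c.j, c.s)}

variable (k : Type u) [CommRing k]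

/-- The coordinate ring of the chart `c`, which is an affine space. -/
abbrev ChartRing (c : ChartIndex m n r) : Type u := MvPolynomial (ChartVar c) k

open Classical in
/-- The universal normalized pair over the chart `c`: the block of `A` at `I` is the identity, the
entry of `B` at `(j, s)` is `1`, and all other entries are the coordinates. -/
def generic (c : ChartIndex m n r) : FactorPair m n r (ChartRing k c) where
  A := .of fun t l => if h : l ∈ Set.range c.I then (1 : Matrix (Fin r) (Fin r) (ChartRing k c)) t h.choose
    else MvPolynomial.X (Sum.inl ⟨(t, l), h⟩)
  B := .of fun j s => if h : (j, s) = (c.j, c.s) then 1 else MvPolynomial.X (Sum.inr ⟨(j, s), h⟩)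

lemma generic_isNormalized (c : ChartIndex m n r) : (generic k c).IsNormalized c := by
  refine ⟨?_, ?_⟩
  · ext1 a b
    have h : c.I b ∈ Set.range c.I := ⟨b, rfl⟩
    have : h.choose = b := c.I.injective h.choose_spec
    simp only [FactorPair.block, generic, Matrix.submatrix_apply, Matrix.of_apply, id, dif_pos h]
    rw [this]
  · simp [generic]

variable {k}

lemma chartHom_ext {S : Type*} [CommRing S] {c : ChartIndex m n r} {φ ψ : ChartRing k c →+* S}
    (hC : φ.comp MvPolynomial.C = ψ.comp MvPolynomial.C)
    (h : (generic k c).map φ = (generic k c).map ψ) : φ = ψ := by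
  apply MvPolynomial.ringHom_ext
  · exact fun a => congr($hC a)
  · rintro (⟨⟨t, l⟩, hl⟩ | ⟨⟨j, s⟩, hq⟩)
    · have := congr(FactorPair.A $h t l)
      simpa only [FactorPair.map, generic, Matrix.map_apply, Matrix.of_apply, dif_neg hl] using this
    · have := congr(FactorPair.B $h j s)
      simpa only [FactorPair.map, generic, Matrix.map_apply, Matrix.of_apply, dif_neg hq] using this

/-- The homomorphism on the chart ring that takes the universal pair to `P`. -/
def evalPair {S : Type*} [CommRing S] (c : ChartIndex m n r) (κ : k →+* S)
    (P : FactorPair m n r S) : ChartRing k c →+* S :=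
  MvPolynomial.eval₂Hom κ
    (Sum.elim (fun p => P.A p.1.1 p.1.2) (fun q => P.B q.1.1 q.1.2))

lemma evalPair_comp_C {S : Type*} [CommRing S] (c : ChartIndex m n r) (κ : k →+* S)
    (P : FactorPair m n r S) : (evalPair c κ P).comp MvPolynomial.C = κ := by
  ext a; exact MvPolynomial.eval₂Hom_C _ _ a

lemma map_evalPair {S : Type*} [CommRing S] {c : ChartIndex m n r} (κ : k →+* S)
    {P : FactorPair m n r S} (h : P.IsNormalized c) : (generic k c).map (evalPair c κ P) = P := by
  apply FactorPair.ext
  · ext1 t l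
    by_cases hl : l ∈ Set.range c.I
    · have h1 := congr($(h.block_eq) t hl.choose)
      have h2 := hl.choose_spec
      simp only [FactorPair.block, Matrix.submatrix_apply, id] at h1
      rw [h2] at h1
      rw [h1]
      simp [FactorPair.map, generic, hl, Matrix.one_apply, -Set.mem_range]
    · simp only [FactorPair.map, generic, Matrix.map_apply, Matrix.of_apply, dif_neg hl, evalPair]
      exact MvPolynomial.eval₂Hom_X' _ _ _
  · ext1 j s
    by_cases hq : (j, s) = (c.j, c.s)
    · obtain ⟨rfl, rfl⟩ := Prod.ext_iff.mp hq
      simp [FactorPair.map, generic, h.entry_eq]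
    · simp only [FactorPair.map, generic, Matrix.map_apply, Matrix.of_apply, dif_neg hq, evalPair]
      exact MvPolynomial.eval₂Hom_X' _ _ _

end Chart

section Glue
variable {m n r : ℕ} (k : Type u) [CommRing k]

/-- The ring of functions on the open subset of the chart `c` that also belongs to the chart `d`. -/
abbrev OverlapRing (c d : ChartIndex m n r) : Type u :=
  Localization.Away ((generic k c).locus d)

/-- The universal pair of the chart `c`, restricted to the overlap with the chart `d`. -/
def overlapPair (c d : ChartIndex m n r) : FactorPair m n r (OverlapRing k c d) :=
  (generic k c).map (algebraMap (ChartRing k c) (OverlapRing k c d))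

lemma overlapPair_isNormalized (c d : ChartIndex m n r) :
    (overlapPair k c d).IsNormalized c :=
  (generic_isNormalized k c).map _

lemma isUnit_locus_overlapPair (c d : ChartIndex m n r) :
    IsUnit ((overlapPair k c d).locus d) := by
  rw [overlapPair, FactorPair.map_locus]
  exact IsLocalization.Away.algebraMap_isUnit _

/-- The coordinates of the chart `d` as functions on the overlap, in terms of the chart `c`. -/
def changeChart (c d : ChartIndex m n r) : ChartRing k d →+* OverlapRing k c d :=
  evalPair d (algebraMap k (OverlapRing k c d)) ((overlapPair k c d).normalize d)

lemma map_changeChart (c d : ChartIndex m n r) :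
    (generic k d).map (changeChart k c d) = (overlapPair k c d).normalize d :=
  map_evalPair _ (FactorPair.normalize_isNormalized (isUnit_locus_overlapPair k c d))

lemma isUnit_changeChart_locus (c d : ChartIndex m n r) :
    IsUnit (changeChart k c d ((generic k d).locus c)) := by
  rw [← FactorPair.map_locus, map_changeChart]
  apply FactorPair.isUnit_locus_normalize (isUnit_locus_overlapPair k c d)
  rw [(overlapPair_isNormalized k c d).locus_eq]
  exact isUnit_one

/-- The transition isomorphism of the overlap, `(A, B) ↦ (g⁻¹ A, b⁻¹ B g)`. -/
def transition (c d : ChartIndex m n r) : OverlapRing k d c →+* OverlapRing k c d :=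
  IsLocalization.Away.lift ((generic k d).locus c) (isUnit_changeChart_locus k c d)

lemma transition_comp_algebraMap (c d : ChartIndex m n r) :
    (transition k c d).comp (algebraMap (ChartRing k d) (OverlapRing k d c)) =
      changeChart k c d :=
  IsLocalization.Away.lift_comp _ _

lemma changeChart_comp_C (c d : ChartIndex m n r) :
    (changeChart k c d).comp MvPolynomial.C = algebraMap k (OverlapRing k c d) :=
  evalPair_comp_C _ _ _

lemma algebraMap_comp_C (c d : ChartIndex m n r) :
    (algebraMap (ChartRing k c) (OverlapRing k c d)).comp MvPolynomial.C =
      algebraMap k (OverlapRing k c d) :=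
  (IsScalarTower.algebraMap_eq k (ChartRing k c) (OverlapRing k c d)).symm

variable {k}

/-- The chart `c`. -/
abbrev chartScheme (k : Type u) [CommRing k] (c : ChartIndex m n r) : Scheme.{u} :=
  Spec (CommRingCat.of (ChartRing k c))

/-- The overlap of the charts `c` and `d`, as an open subscheme of the chart `c`. -/
abbrev overlapScheme (k : Type u) [CommRing k] (c d : ChartIndex m n r) : Scheme.{u} :=
  Spec (CommRingCat.of (OverlapRing k c d))

/-- The inclusion of the overlap into the chart `c`. -/
abbrev overlapι (k : Type u) [CommRing k] (c d : ChartIndex m n r) :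
    overlapScheme k c d ⟶ chartScheme k c :=
  Spec.map (CommRingCat.ofHom (algebraMap (ChartRing k c) (OverlapRing k c d)))

/-- The transition map between the two copies of the overlap. -/
abbrev transitionMap (k : Type u) [CommRing k] (c d : ChartIndex m n r) :
    overlapScheme k c d ⟶ overlapScheme k d c :=
  Spec.map (CommRingCat.ofHom (transition k c d))

/-- The ring homomorphism that corresponds to a morphism to an affine scheme. -/
def ringHomOf {Z : Scheme.{u}} {R : Type u} [CommRing R] (x : Z ⟶ Spec (CommRingCat.of R)) :
    R →+* Γ(Z, ⊤) :=
  ((Scheme.ΓSpecIso (CommRingCat.of R)).inv ≫ x.appTop).hom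

lemma ringHomOf_comp {Z Z' : Scheme.{u}} {R : Type u} [CommRing R] (y : Z' ⟶ Z)
    (x : Z ⟶ Spec (CommRingCat.of R)) :
    ringHomOf (y ≫ x) = y.appTop.hom.comp (ringHomOf x) := by
  simp [ringHomOf]; rfl

lemma ringHomOf_comp_SpecMap {Z : Scheme.{u}} {R S : Type u} [CommRing R] [CommRing S]
    (x : Z ⟶ Spec (CommRingCat.of S)) (φ : R →+* S) :
    ringHomOf (x ≫ Spec.map (CommRingCat.ofHom φ)) = (ringHomOf x).comp φ := by
  have := Scheme.ΓSpecIso_inv_naturality (CommRingCat.ofHom φ)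
  simp only [ringHomOf, Scheme.Hom.comp_appTop]
  rw [← reassoc_of% this]
  rfl

lemma ringHomOf_injective {Z : Scheme.{u}} {R : Type u} [CommRing R]
    {x y : Z ⟶ Spec (CommRingCat.of R)} (h : ringHomOf x = ringHomOf y) : x = y := by
  exact ext_to_Spec (CommRingCat.hom_ext h)

/-- The morphism to an affine scheme that corresponds to a ring homomorphism. -/
def homOf {Z : Scheme.{u}} {R : Type u} [CommRing R] (φ : R →+* Γ(Z, ⊤)) :
    Z ⟶ Spec (CommRingCat.of R) :=
  Z.toSpecΓ ≫ Spec.map (CommRingCat.ofHom φ)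

lemma ringHomOf_homOf {Z : Scheme.{u}} {R : Type u} [CommRing R] (φ : R →+* Γ(Z, ⊤)) :
    ringHomOf (homOf φ) = φ := by
  have h := Scheme.ΓSpecIso_inv_naturality (CommRingCat.ofHom φ)
  simp only [ringHomOf, homOf, Scheme.Hom.comp_appTop]
  rw [← reassoc_of% h, Scheme.toSpecΓ_appTop]
  ext; simp

/-- The pair of matrices that corresponds to a morphism to a chart. -/
def pairOf {Z : Scheme.{u}} {c : ChartIndex m n r} (x : Z ⟶ chartScheme k c) :
    FactorPair m n r Γ(Z, ⊤) :=
  (generic k c).map (ringHomOf x)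

/-- The action of the scalars that corresponds to a morphism to a chart. -/
def scalarsOf {Z : Scheme.{u}} {c : ChartIndex m n r} (x : Z ⟶ chartScheme k c) :
    k →+* Γ(Z, ⊤) :=
  (ringHomOf x).comp MvPolynomial.C

lemma hom_chart_ext {Z : Scheme.{u}} {c : ChartIndex m n r} {x y : Z ⟶ chartScheme k c}
    (hs : scalarsOf x = scalarsOf y) (hp : pairOf x = pairOf y) : x = y :=
  ringHomOf_injective (chartHom_ext hs hp)

lemma isUnit_locus_pairOf {Z : Scheme.{u}} {c d : ChartIndex m n r}
    (y : Z ⟶ overlapScheme k c d) : IsUnit ((pairOf (y ≫ overlapι k c d)).locus d) := by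
  rw [pairOf, ringHomOf_comp_SpecMap, FactorPair.map_locus, RingHom.comp_apply]
  exact (IsLocalization.Away.algebraMap_isUnit ((generic k c).locus d)).map (ringHomOf y)

lemma pairOf_isNormalized {Z : Scheme.{u}} {c : ChartIndex m n r} (x : Z ⟶ chartScheme k c) :
    (pairOf x).IsNormalized c := (generic_isNormalized k c).map _

lemma pairOf_transition {Z : Scheme.{u}} {c d : ChartIndex m n r}
    (y : Z ⟶ overlapScheme k c d) :
    pairOf (y ≫ transitionMap k c d ≫ overlapι k d c) =
      (pairOf (y ≫ overlapι k c d)).normalize d := by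
  rw [← Spec.map_comp, ← CommRingCat.ofHom_comp, transition_comp_algebraMap, pairOf, pairOf,
    ringHomOf_comp_SpecMap, ringHomOf_comp_SpecMap, ← FactorPair.map_map, ← FactorPair.map_map,
    map_changeChart, ← FactorPair.map_normalize _ (isUnit_locus_overlapPair k c d)]
  rfl

lemma scalarsOf_transition {Z : Scheme.{u}} {c d : ChartIndex m n r}
    (y : Z ⟶ overlapScheme k c d) :
    scalarsOf (y ≫ transitionMap k c d ≫ overlapι k d c) = scalarsOf (y ≫ overlapι k c d) := by
  rw [← Spec.map_comp, ← CommRingCat.ofHom_comp, transition_comp_algebraMap, scalarsOf, scalarsOf,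
    ringHomOf_comp_SpecMap, ringHomOf_comp_SpecMap, RingHom.comp_assoc, RingHom.comp_assoc,
    changeChart_comp_C, algebraMap_comp_C]

/-- A morphism to the chart `c` that lands in the chart `d` factors through the overlap. -/
def liftOverlap {Z : Scheme.{u}} {c : ChartIndex m n r} (d : ChartIndex m n r)
    (x : Z ⟶ chartScheme k c) (h : IsUnit ((pairOf x).locus d)) : Z ⟶ overlapScheme k c d :=
  homOf (IsLocalization.Away.lift ((generic k c).locus d) (g := ringHomOf x)
    (by rwa [pairOf, FactorPair.map_locus] at h))

lemma liftOverlap_comp {Z : Scheme.{u}} {c : ChartIndex m n r} (d : ChartIndex m n r)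
    (x : Z ⟶ chartScheme k c) (h : IsUnit ((pairOf x).locus d)) :
    liftOverlap d x h ≫ overlapι k c d = x := by
  apply ringHomOf_injective
  rw [ringHomOf_comp_SpecMap, liftOverlap, ringHomOf_homOf, IsLocalization.Away.lift_comp]

instance (c d : ChartIndex m n r) : IsOpenImmersion (overlapι k c d) :=
  IsOpenImmersion.of_isLocalization ((generic k c).locus d)

lemma isIso_overlapι_self (c : ChartIndex m n r) : IsIso (overlapι k c c) := by
  have h : IsUnit ((generic k c).locus c) := by
    rw [(generic_isNormalized k c).locus_eq]; exact isUnit_one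
  have : Function.Bijective (algebraMap (ChartRing k c) (OverlapRing k c c)) :=
    (IsLocalization.atUnit (ChartRing k c) _ _ h).bijective
  have : IsIso (CommRingCat.ofHom (algebraMap (ChartRing k c) (OverlapRing k c c))) :=
    (ConcreteCategory.isIso_iff_bijective _).mpr this
  infer_instance

variable (k)

lemma isUnit_locus_triple (c d e : ChartIndex m n r) :
    IsUnit ((pairOf (pullback.fst (overlapι k c d) (overlapι k c e) ≫
      transitionMap k c d ≫ overlapι k d c)).locus e) := by
  rw [pairOf_transition]
  apply FactorPair.isUnit_locus_normalize (isUnit_locus_pairOf _)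
  rw [pullback.condition]
  exact isUnit_locus_pairOf _

/-- The transition map on triple overlaps. -/
def tripleTransition (c d e : ChartIndex m n r) :
    pullback (overlapι k c d) (overlapι k c e) ⟶ pullback (overlapι k d e) (overlapι k d c) :=
  pullback.lift
    (liftOverlap e (pullback.fst _ _ ≫ transitionMap k c d ≫ overlapι k d c)
      (isUnit_locus_triple k c d e))
    (pullback.fst _ _ ≫ transitionMap k c d)
    (by rw [liftOverlap_comp, Category.assoc])

lemma tripleTransition_fst (c d e : ChartIndex m n r) :
    tripleTransition k c d e ≫ pullback.fst _ _ ≫ overlapι k d e =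
      pullback.fst _ _ ≫ transitionMap k c d ≫ overlapι k d c := by
  rw [tripleTransition, pullback.lift_fst_assoc, liftOverlap_comp]

lemma tripleTransition_cocycle (c d e : ChartIndex m n r) :
    tripleTransition k c d e ≫ tripleTransition k d e c ≫ tripleTransition k e c d = 𝟙 _ := by
  rw [← cancel_mono (pullback.fst (overlapι k c d) (overlapι k c e)),
    ← cancel_mono (overlapι k c d)]
  have h1 := tripleTransition_fst k c d e
  have h2 := tripleTransition_fst k d e c
  have h3 := tripleTransition_fst k e c d
  simp only [Category.assoc, Category.id_comp] at h1 h2 h3 ⊢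
  rw [h3]
  have u1 := isUnit_locus_pairOf (pullback.fst (overlapι k c d) (overlapι k c e))
  have u2 : IsUnit ((pairOf (pullback.fst (overlapι k c d) (overlapι k c e) ≫
      overlapι k c d)).locus e) := by
    rw [pullback.condition]; exact isUnit_locus_pairOf _
  have n1 := pairOf_isNormalized (pullback.fst (overlapι k c d) (overlapι k c e) ≫
      overlapι k c d)
  have u3 : IsUnit ((pairOf (pullback.fst (overlapι k c d) (overlapι k c e) ≫
      overlapι k c d)).locus c) := by rw [n1.locus_eq]; exact isUnit_one
  have e1 := pairOf_transition (pullback.fst (overlapι k c d) (overlapι k c e))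
  have s1 := scalarsOf_transition (pullback.fst (overlapι k c d) (overlapι k c e))
  have e2 := pairOf_transition
    (tripleTransition k c d e ≫ pullback.fst (overlapι k d e) (overlapι k d c))
  have s2 := scalarsOf_transition
    (tripleTransition k c d e ≫ pullback.fst (overlapι k d e) (overlapι k d c))
  have e3 := pairOf_transition (tripleTransition k c d e ≫ tripleTransition k d e c ≫
    pullback.fst (overlapι k e c) (overlapι k e d))
  have s3 := scalarsOf_transition (tripleTransition k c d e ≫ tripleTransition k d e c ≫
    pullback.fst (overlapι k e c) (overlapι k e d))
  simp only [Category.assoc] at e1 e2 e3 s1 s2 s3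
  rw [h1] at e2 s2
  rw [h2] at e3 s3
  apply hom_chart_ext
  · rw [s3, s2, s1]
  · rw [e3, e2, e1, FactorPair.normalize_normalize u1 u2, FactorPair.normalize_normalize u2 u3,
      n1.normalize_eq]

/-- The gluing data of the standard charts of `ℙ(V ⊗ Q)`. -/
def springerGlueData (m n r : ℕ) : Scheme.GlueData.{u} where
  J := ULift.{u} (ChartIndex m n r)
  U c := chartScheme k c.down
  V p := overlapScheme k p.1.down p.2.down
  f c d := overlapι k c.down d.down
  f_id c := isIso_overlapι_self c.down
  f_open c d := inferInstance
  t c d := transitionMap k c.down d.down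
  t_id c := by
    rw [← cancel_mono (overlapι k c.down c.down)]
    have h := pairOf_transition (𝟙 (overlapScheme k c.down c.down))
    have h' := scalarsOf_transition (𝟙 (overlapScheme k c.down c.down))
    simp only [Category.id_comp] at h h' ⊢
    apply hom_chart_ext h'
    rw [h, (pairOf_isNormalized _).normalize_eq]
  t' c d e := tripleTransition k c.down d.down e.down
  t_fac c d e := pullback.lift_snd _ _ _
  cocycle c d e := tripleTransition_cocycle k _ _ _

end Glue

section Proj

open HomogeneousLocalization

variable {σ : Type} (k : Type u) [CommRing k]

/-- The grading of the polynomial ring by degree. -/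
abbrev grading (σ : Type) (k : Type u) [CommRing k] : ℕ → Submodule k (MvPolynomial σ k) :=
  MvPolynomial.homogeneousSubmodule σ k

instance : GradedAlgebra (grading σ k) := MvPolynomial.gradedAlgebra

/-- The projective space with homogeneous coordinates indexed by `σ`. -/
abbrev projSpace (σ : Type) (k : Type u) [CommRing k] : Scheme.{u} := Proj (grading σ k)

variable {k} {T : Type u} [CommRing T]

lemma X_mem_grading (p : σ) : (MvPolynomial.X p : MvPolynomial σ k) ∈ grading σ k 1 :=
  MvPolynomial.isHomogeneous_X k p

lemma X_mul_X_mem_grading (p q : σ) :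
    (MvPolynomial.X p * MvPolynomial.X q : MvPolynomial σ k) ∈ grading σ k 2 :=
  (MvPolynomial.isHomogeneous_X k p).mul (MvPolynomial.isHomogeneous_X k q)

/-- Evaluation of homogeneous fractions of degree zero. -/
def awayEval (φ : MvPolynomial σ k →+* T) (f : MvPolynomial σ k) (h : IsUnit (φ f)) :
    Away (grading σ k) f →+* T :=
  (Localization.awayLift φ f h).comp
    (algebraMap (Away (grading σ k) f) (Localization.Away f))

lemma awayEval_mk (φ : MvPolynomial σ k →+* T) {f : MvPolynomial σ k} (h : IsUnit (φ f))
    {d : ℕ} (hf : f ∈ grading σ k d) (N : ℕ) (x : MvPolynomial σ k)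
    (hx : x ∈ grading σ k (N • d)) :
    awayEval φ f h (Away.mk (grading σ k) hf N x hx) * φ f ^ N = φ x := by
  simp only [awayEval, RingHom.comp_apply, HomogeneousLocalization.algebraMap_apply, Away.val_mk]
  obtain ⟨v, hv⟩ := isUnit_iff_exists_inv.mp h
  rw [Localization.awayLift_mk (hv := hv), mul_assoc, ← mul_pow, mul_comm v, hv, one_pow, mul_one]

lemma awayEval_mul (φ : MvPolynomial σ k →+* T) {f g : MvPolynomial σ k}
    (hf : IsUnit (φ f)) (hfg : IsUnit (φ (f * g))) {e : ℕ} (hg : g ∈ grading σ k e) :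
    (awayEval φ (f * g) hfg).comp (awayMap (grading σ k) hg rfl) = awayEval φ f hf := by
  ext a
  simp only [awayEval, RingHom.comp_apply, HomogeneousLocalization.algebraMap_apply, val_awayMap]
  rw [← RingHom.comp_apply]
  congr 1
  apply IsLocalization.ringHom_ext (Submonoid.powers f)
  ext a <;> simp [Localization.awayLift]

/-- Evaluation of polynomials at a vector. -/
def evalVec (κ : k →+* T) (v : σ → T) : MvPolynomial σ k →+* T := MvPolynomial.eval₂Hom κ v

lemma evalVec_X (κ : k →+* T) (v : σ → T) (p : σ) : evalVec κ v (MvPolynomial.X p) = v p :=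
  MvPolynomial.eval₂Hom_X' _ _ _

lemma evalVec_smul (κ : k →+* T) (v : σ → T) (b : T) {d : ℕ} {x : MvPolynomial σ k}
    (hx : x ∈ grading σ k d) : evalVec κ (b • v) x = b ^ d * evalVec κ v x := by
  have hx' : x.IsHomogeneous d := hx
  simp only [evalVec, MvPolynomial.coe_eval₂Hom, MvPolynomial.eval₂_eq, Finset.mul_sum]
  refine Finset.sum_congr rfl fun e he => ?_
  have hd : e.degree = d := by
    have := hx' (MvPolynomial.mem_support_iff.mp he)
    rwa [Finsupp.degree_eq_weight_one]
  simp only [Pi.smul_apply, smul_eq_mul, mul_pow, Finset.prod_mul_distrib,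
    Finset.prod_pow_eq_pow_sum]
  rw [← hd, Finsupp.degree_apply]
  ring

lemma awayEval_smul (κ : k →+* T) (v : σ → T) {b : T} (hb : IsUnit b) {d : ℕ}
    {f : MvPolynomial σ k} (hf : f ∈ grading σ k d) (h : IsUnit (evalVec κ v f))
    (h' : IsUnit (evalVec κ (b • v) f)) :
    awayEval (evalVec κ (b • v)) f h' = awayEval (evalVec κ v) f h := by
  ext a
  obtain ⟨N, x, hx, rfl⟩ := a.mk_surjective _ hf
  have e1 := awayEval_mk (evalVec κ v) h hf N x hx
  have e2 := awayEval_mk (evalVec κ (b • v)) h' hf N x hx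
  rw [evalVec_smul κ v b hf, evalVec_smul κ v b hx, ← e1] at e2
  have hu : IsUnit (b ^ (N • d) * evalVec κ v f ^ N) := (hb.pow _).mul (h.pow _)
  apply hu.mul_right_cancel
  have : (b ^ d * evalVec κ v f) ^ N = b ^ (N • d) * evalVec κ v f ^ N := by
    rw [mul_pow, ← pow_mul, smul_eq_mul, mul_comm N d]
  rw [← this, e2, this]
  ring

/-- The morphism to projective space with homogeneous coordinates `v`, one of which is a unit. -/
def pointMap (κ : k →+* T) (v : σ → T) (p : σ) (h : IsUnit (v p)) :
    Spec (CommRingCat.of T) ⟶ projSpace σ k :=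
  Spec.map (CommRingCat.ofHom (awayEval (evalVec κ v) (MvPolynomial.X p)
    (by rwa [evalVec_X]))) ≫
    Proj.awayι (grading σ k) (MvPolynomial.X p) (X_mem_grading p) one_pos

lemma pointMap_aux (φ : MvPolynomial σ k →+* T) {p q : σ} {f : MvPolynomial σ k}
    (hf : f = MvPolynomial.X p * MvPolynomial.X q) (hf2 : f ∈ grading σ k 2)
    (hp : IsUnit (φ (MvPolynomial.X p))) (hpq : IsUnit (φ f)) :
    Spec.map (CommRingCat.ofHom (awayEval φ (MvPolynomial.X p) hp)) ≫
      Proj.awayι (grading σ k) (MvPolynomial.X p) (X_mem_grading p) one_pos =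
    Spec.map (CommRingCat.ofHom (awayEval φ f hpq)) ≫
      Proj.awayι (grading σ k) f hf2 two_pos := by
  subst hf
  rw [← awayEval_mul φ hp hpq (X_mem_grading q), CommRingCat.ofHom_comp,
    Spec.map_comp, Category.assoc,
    Proj.SpecMap_awayMap_awayι (grading σ k) (X_mem_grading p) one_pos (X_mem_grading q) rfl]

lemma pointMap_eq_of_isUnit (κ : k →+* T) (v : σ → T) {p q : σ} (hp : IsUnit (v p))
    (hq : IsUnit (v q)) : pointMap κ v p hp = pointMap κ v q hq := by
  have hp' : IsUnit (evalVec κ v (MvPolynomial.X p)) := by rwa [evalVec_X]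
  have hq' : IsUnit (evalVec κ v (MvPolynomial.X q)) := by rwa [evalVec_X]
  have hpq : IsUnit (evalVec κ v (MvPolynomial.X p * MvPolynomial.X q)) := by
    rw [map_mul]; exact hp'.mul hq'
  rw [pointMap, pointMap, pointMap_aux _ rfl (X_mul_X_mem_grading p q) hp' hpq,
    pointMap_aux _ (mul_comm _ _) (X_mul_X_mem_grading p q) hq' hpq]

lemma pointMap_smul (κ : k →+* T) (v : σ → T) {b : T} (hb : IsUnit b) {p : σ} (hp : IsUnit (v p))
    (hp' : IsUnit ((b • v) p)) : pointMap κ (b • v) p hp' = pointMap κ v p hp := by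
  rw [pointMap, pointMap, awayEval_smul κ v hb (X_mem_grading p)]

lemma SpecMap_pointMap {T' : Type u} [CommRing T'] (ψ : T →+* T') (κ : k →+* T) (v : σ → T)
    {p : σ} (hp : IsUnit (v p)) :
    Spec.map (CommRingCat.ofHom ψ) ≫ pointMap κ v p hp =
      pointMap (ψ.comp κ) (ψ ∘ v) p (hp.map ψ) := by
  have hp' : IsUnit (evalVec κ v (MvPolynomial.X p)) := by rwa [evalVec_X]
  have hp'' : IsUnit (evalVec (ψ.comp κ) (ψ ∘ v) (MvPolynomial.X p)) := by
    rw [evalVec_X]; exact hp.map ψ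
  rw [pointMap, pointMap, ← Category.assoc, ← Spec.map_comp, ← CommRingCat.ofHom_comp]
  congr 3
  ext a
  obtain ⟨N, x, hx, rfl⟩ := a.mk_surjective _ (X_mem_grading p)
  have hc : ∀ y, evalVec (ψ.comp κ) (ψ ∘ v) y = ψ (evalVec κ v y) := fun y =>
    (MvPolynomial.eval₂_comp_left ψ κ v y).symm
  have e1 := congrArg ψ (awayEval_mk (evalVec κ v) hp' (X_mem_grading p) N x hx)
  have e2 := awayEval_mk (evalVec (ψ.comp κ) (ψ ∘ v)) hp'' (X_mem_grading p) N x hx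
  rw [hc x, ← e1, hc, map_mul, map_pow] at e2
  rw [hc] at hp''
  exact ((hp''.pow N).mul_right_cancel e2).symm

end Proj

section Springer
variable (k : Type u) [CommRing k] (m n r : ℕ)

/-- The projective bundle `ℙ(V ⊗ Q)` of rank one quotients of `V ⊗ Q` over the Grassmannian of
rank `r` quotients of `U`, where `Q` is the universal quotient, `dim U = m` and `dim V = n`. For
`r < m ≤ n` it is the Springer resolution of the variety of `n × m` matrices of rank at most `r`. -/
def springer : Scheme.{u} := (springerGlueData k m n r).glued

variable {k m n r} in
/-- Morphisms from the glued scheme, given on charts. -/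
def springerDesc {Y : Scheme.{u}} (g : ∀ c : ChartIndex m n r, chartScheme k c ⟶ Y)
    (h : ∀ c d, overlapι k c d ≫ g c = transitionMap k c d ≫ overlapι k d c ≫ g d) :
    springer k m n r ⟶ Y :=
  Multicoequalizer.desc _ _ (fun c : ULift.{u} (ChartIndex m n r) => g c.down)
    (fun p => (h p.1.down p.2.down).trans (Category.assoc _ _ _).symm)

/-- The structure morphism of `ℙ(V ⊗ Q)` over the base. -/
def springerStructure : springer k m n r ⟶ Spec (CommRingCat.of k) :=
  springerDesc (fun c => Spec.map (CommRingCat.ofHom (MvPolynomial.C : k →+* ChartRing k c)))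
    (fun c d => by
      rw [← Spec.map_comp, ← CommRingCat.ofHom_comp, algebraMap_comp_C, ← Category.assoc,
        ← Spec.map_comp, ← CommRingCat.ofHom_comp, transition_comp_algebraMap,
        ← Spec.map_comp, ← CommRingCat.ofHom_comp, changeChart_comp_C])

variable {m n r} in
/-- On each chart, the morphism `ℙ(V ⊗ Q) ⟶ ℙ(U ⊗ V)` takes `(A, B)` to `B A`. -/
def chartToProj (c : ChartIndex m n r) : chartScheme k c ⟶ projSpace (Fin n × Fin m) k :=
  pointMap MvPolynomial.C (generic k c).coords (c.j, c.I c.s) (by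
    rw [FactorPair.coords_pivot, (generic_isNormalized k c).pivot_eq]; exact isUnit_one)

/-- The morphism `ℙ(V ⊗ Q) ⟶ ℙ(U ⊗ V)` given by the tautological line bundle, which composes
a rank one quotient of `V ⊗ Q` with `V ⊗ U ⟶ V ⊗ Q`. The coordinate `(j, l)` of `ℙ(U ⊗ V)` belongs to
the basis vector `u_l ⊗ v_j` of `W = U ⊗ V`. -/
def springerToProj : springer k m n r ⟶ projSpace (Fin n × Fin m) k :=
  springerDesc (chartToProj k) (fun c d => by
    have hd := isUnit_locus_overlapPair k c d
    have hpiv : IsUnit ((overlapPair k c d).pivot d) := isUnit_of_mul_isUnit_right hd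
    have u1 : IsUnit ((overlapPair k c d).coords (c.j, c.I c.s)) := by
      rw [FactorPair.coords_pivot, (overlapPair_isNormalized k c d).pivot_eq]
      exact isUnit_one
    have u2 : IsUnit ((overlapPair k c d).coords (d.j, d.I d.s)) := by
      rw [FactorPair.coords_pivot]; exact hpiv
    rw [← Category.assoc, ← Spec.map_comp, ← CommRingCat.ofHom_comp, transition_comp_algebraMap]
    unfold chartToProj
    rw [SpecMap_pointMap, SpecMap_pointMap]
    simp only [← FactorPair.map_coords, map_changeChart, algebraMap_comp_C, changeChart_comp_C,
      FactorPair.coords_normalize hd]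
    rw [pointMap_smul _ _ hpiv.ringInverse u2]
    exact pointMap_eq_of_isUnit _ _ u1 u2)

end Springer

section LinearSections

variable {k : Type u} [Field k] {σ : Type} [Finite σ]

/-- The dimension of `W / L`. -/
abbrev quotientRank (L : Submodule k (σ → k)) : ℕ := Module.finrank k ((σ → k) ⧸ L)

open Classical in
/-- The class in `W / L` of a basis vector of `W`, as a linear combination of a basis of `W / L`,
which serves as the set of variables of `Sym (W / L)`. -/
def quotientForm (L : Submodule k (σ → k)) (p : σ) : MvPolynomial (Fin (quotientRank L)) k :=
  ∑ t, (Module.finBasis k ((σ → k) ⧸ L)).repr (L.mkQ (Pi.single p 1)) t • MvPolynomial.X t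

lemma quotientForm_isHomogeneous (L : Submodule k (σ → k)) (p : σ) :
    (quotientForm L p).IsHomogeneous 1 := by
  refine MvPolynomial.IsHomogeneous.sum _ _ _ fun t _ => ?_
  exact Submodule.smul_mem (MvPolynomial.homogeneousSubmodule _ k 1) _
    (MvPolynomial.isHomogeneous_X k t)

/-- The graded homomorphism `Sym W ⟶ Sym (W / L)`. -/
def symQuotient (L : Submodule k (σ → k)) :
    grading σ k →+*ᵍ grading (Fin (quotientRank L)) k where
  __ := (MvPolynomial.aeval (quotientForm L)).toRingHom
  map_mem {i x} hx := by
    have hx' : x.IsHomogeneous i := hx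
    have := hx'.aeval (quotientForm L) (quotientForm_isHomogeneous L)
    rwa [one_mul] at this

lemma symQuotient_X (L : Submodule k (σ → k)) (p : σ) :
    symQuotient L (MvPolynomial.X p) = quotientForm L p := MvPolynomial.aeval_X _ _

lemma X_mem_range_symQuotient (L : Submodule k (σ → k)) (t : Fin (quotientRank L)) :
    ∃ x ∈ grading σ k 1, symQuotient L x = MvPolynomial.X t := by
  classical
  have := Fintype.ofFinite σ
  obtain ⟨w, hw⟩ := L.mkQ_surjective (Module.finBasis k ((σ → k) ⧸ L) t)
  refine ⟨∑ p, w p • MvPolynomial.X p, Submodule.sum_mem _ fun p _ =>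
    Submodule.smul_mem _ _ (X_mem_grading p), ?_⟩
  have hsm : ∀ (a : k) (y : MvPolynomial σ k), symQuotient L (a • y) = a • symQuotient L y :=
    fun a y => map_smul (MvPolynomial.aeval (quotientForm L)) a y
  simp only [map_sum, hsm, symQuotient_X, quotientForm, Finset.smul_sum]
  rw [Finset.sum_comm]
  have key : ∀ t', ∑ p, w p • (Module.finBasis k ((σ → k) ⧸ L)).repr (L.mkQ (Pi.single p 1)) t' =
      if t = t' then 1 else 0 := by
    intro t'
    have h1 : w = ∑ p, w p • (Pi.single p 1 : σ → k) := by
      ext q; simp [Finset.sum_apply, Pi.single_apply]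
    have h2 : (Module.finBasis k ((σ → k) ⧸ L)).repr (L.mkQ w) t' = if t = t' then 1 else 0 := by
      rw [hw, Module.Basis.repr_self, Finsupp.single_apply]
    rw [← h2]
    conv_rhs => rw [h1]
    simp only [map_sum, map_smul, Finsupp.coe_finsetSum, Finset.sum_apply, Finsupp.smul_apply]
  simp only [smul_smul, ← Finset.sum_smul]
  simp only [smul_eq_mul] at key
  simp only [key]
  simp

lemma irrelevant_le_map_symQuotient (L : Submodule k (σ → k)) :
    HomogeneousIdeal.irrelevant (grading (Fin (quotientRank L)) k) ≤
      (HomogeneousIdeal.irrelevant (grading σ k)).map (symQuotient L) := by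
  rw [HomogeneousIdeal.irrelevant_le]
  intro i hi x hx
  have hx' : x.IsHomogeneous i := hx
  have h1 : x ∈ Ideal.span (MvPolynomial.X '' (Set.univ : Set (Fin (quotientRank L))) :
      Set (MvPolynomial (Fin (quotientRank L)) k)) := by
    rw [MvPolynomial.mem_ideal_span_X_image]
    intro e he
    by_contra! hcon
    have h0 : e = 0 := by ext t; exact hcon t trivial
    have := hx' (MvPolynomial.mem_support_iff.mp he)
    rw [h0, map_zero] at this
    omega
  refine (Ideal.span_le.mpr ?_) h1
  rintro _ ⟨t, -, rfl⟩
  obtain ⟨y, hy, hyt⟩ := X_mem_range_symQuotient L t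
  rw [← hyt]
  exact Ideal.mem_map_of_mem _ (HomogeneousIdeal.mem_irrelevant_of_mem _ one_pos hy)

/-- The projective space `ℙ(W / L) = Proj (Sym (W / L))`. -/
def linearSubspace (L : Submodule k (σ → k)) : Scheme.{u} :=
  projSpace (Fin (quotientRank L)) k

/-- The embedding of `ℙ(W / L)` into `ℙ(W)` as the linear subspace defined by the equations in `L`. -/
def linearSubspaceι (L : Submodule k (σ → k)) : linearSubspace L ⟶ projSpace σ k :=
  Proj.map (symQuotient L) (irrelevant_le_map_symQuotient L)

/-- The orthogonal subspace of `L` in `W^∨`, in terms of the dual basis. -/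
def orthogonal [Fintype σ] (L : Submodule k (σ → k)) : Submodule k (σ → k) where
  carrier := {w | ∀ l ∈ L, w ⬝ᵥ l = 0}
  add_mem' hv hw l hl := by rw [add_dotProduct, hv l hl, hw l hl, add_zero]
  zero_mem' l _ := zero_dotProduct l
  smul_mem' a w hw l hl := by rw [smul_dotProduct, hw l hl, smul_zero]

variable {m n : ℕ}

/-- The linear section `X_L = ℙ(V ⊗ Q) ×_{ℙ W} ℙ(W / L)`, where `W = U ⊗ V`, with a subspace `L`
of `W` given by the coordinates of its members in the basis `u_l ⊗ v_j`. -/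
def sectionX (r : ℕ) (L : Submodule k (Fin n × Fin m → k)) : Scheme.{u} :=
  pullback (springerToProj k m n r) (linearSubspaceι L)

/-- The structure morphism of `X_L` over the base field. -/
def sectionXStructure (r : ℕ) (L : Submodule k (Fin n × Fin m → k)) :
    sectionX r L ⟶ Spec (CommRingCat.of k) :=
  pullback.fst _ _ ≫ springerStructure k m n r

/-- The linear section `Y_L` of the projective bundle `ℙ(V^∨ ⊗ K^∨)` over the Grassmannian of
rank `r` quotients of `U` with universal subbundle `K = ker (U ⟶ Q)` by the linear subspace
`ℙ(W^∨ / L^⊥)` of `ℙ(W^∨)`. That Grassmannian is also the one of rank `m - r` quotients of `U^∨`, with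
universal quotient `K^∨`. So `Y_L` is the section of `ℙ(V^∨ ⊗ K^∨)` over the Grassmannian of rank
`m - r` quotients of `U^∨` that is defined by `L^⊥` in the same way in which `X_L` is defined
by `L`. -/
def sectionY (r : ℕ) (L : Submodule k (Fin n × Fin m → k)) : Scheme.{u} :=
  sectionX (m - r) (orthogonal L)

/-- The structure morphism of `Y_L` over the base field. -/
def sectionYStructure (r : ℕ) (L : Submodule k (Fin n × Fin m → k)) :
    sectionY r L ⟶ Spec (CommRingCat.of k) :=
  sectionXStructure (m - r) (orthogonal L)

/-- `X` has dimension `e`, where a negative `e` means that `X` is empty. -/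
def HasExpectedDim (X : Scheme.{u}) (e : ℤ) : Prop :=
  (0 ≤ e → topologicalKrullDim X = (e.toNat : WithBot ℕ∞)) ∧ (e < 0 → IsEmpty X)

/-- `X_L` and `Y_L` have the expected dimensions, `dim ℙ(V ⊗ Q) - c` and
`dim ℙ(V^∨ ⊗ K^∨) - (m n - c)`, where `c = dim L`. -/
def IsAdmissible (r : ℕ) (L : Submodule k (Fin n × Fin m → k)) : Prop :=
  HasExpectedDim (sectionX r L) ((r : ℤ) * (n + m - r) - Module.finrank k L - 1) ∧
  HasExpectedDim (sectionY r L) ((r : ℤ) * (m - n - r) + Module.finrank k L - 1)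

/-- A scheme over `k` is rational if it is birational over `k` to some `d`-dimensional affine
space: a dense open subscheme is isomorphic over `k` to a dense open subscheme of that space. -/
def IsRational {X : Scheme.{u}} (f : X ⟶ Spec (CommRingCat.of k)) : Prop :=
  ∃ d : ℕ, Scheme.BirationalOver f
    (𝔸(ULift.{u} (Fin d); Spec (CommRingCat.of k)) ↘ Spec (CommRingCat.of k))

end LinearSections

end Determinantal
end

/-! On a chart with coordinates `(A, B)`, let `M(A)` be the matrix of `L → V ⊗ Q` (`formMatrix`),
with `c = dim L` rows and `nr` columns. The section `X_L` is given by `M(A) B = 0`, a linear system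
in `B` for fixed `A`. Where a maximal minor of `M(A)` with columns `τ`, not among them that of the
normalized entry of `B`, is invertible, the entries of `B` at `τ` can be eliminated, and the section
becomes a principal open subset of an affine space (`sectionAwayEquiv`). Any two such pieces with
non-zero minors meet, since both contain a point over the function field of all `r × m` matrices
(`exists_common_pair`). If moreover every component of `X_L` meets such a piece (`HasMinors`), then
each piece is dense and `X_L` is rational (`isRational_of_hasMinors`).

What remains is to exclude components on which `M(A)` drops rank, and here the dual section enters.
A linear relation among the rows of `M(A)` is an element of `L` with zero image in `V ⊗ Q`. It lies
in `V ⊗ 𝒰` and is orthogonal to `L^⊥`, so up to scalars it is a point of `Y_L` over the same point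
of the Grassmannian.

Let `K` be the function field of a component of `X_L` on a chart, `F` the subfield generated by the
entries of `A`, and `e` the dimension over `F` of the space of row relations. Krull's height theorem
gives `trdeg K ≥ r(m-r) + nr - 1 - c`. The entries of `B` span over `F` a space of dimension at most
`nr - c + e` that contains `1`, so `trdeg_F K ≤ nr - c + e - 1`. If `e > 0`, the relations form a
projective space of dimension `e - 1` over `F`, which yields `dim Y_L ≥ trdeg F + e - 1`
(`exists_prime_of_relations`). Together `dim Y_L ≥ r(m-r) - 1`, whereas `nr > c` makes the expected
dimension of `Y_L` at most `r(m-r) - 2`. Hence `e = 0` (`exists_formMinor_ne_zero`,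
`hasMinors_of_ringKrullDim_le`).

The construction is symmetric: `Y_L` is the section for the rank `m - r` and `L^⊥`, and `L^⊥⊥ = L`.
So the case `c > nr` is the same argument with `X_L` and `Y_L` exchanged. -/

open CategoryTheory CategoryTheory.Limits AlgebraicGeometry

noncomputable section

namespace Determinantal

universe u


/-! ### Heights, transcendence degrees and Krull dimensions of affine varieties. -/

section Dimension

variable {k : Type u} [Field k]

/-- The transcendence degree as an extended natural number. -/
abbrev etrdeg (k A : Type u) [CommRing k] [CommRing A] [Algebra k A] : ℕ∞ :=
  Cardinal.toENat (Algebra.trdeg k A)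

lemma etrdeg_le_of_injective {A B : Type u} [CommRing A] [CommRing B] [Algebra k A] [Algebra k B]
    (f : A →ₐ[k] B) (hf : Function.Injective f) : etrdeg k A ≤ etrdeg k B :=
  OrderHomClass.mono Cardinal.toENat (trdeg_le_of_injective f hf)

lemma etrdeg_add (R S A : Type u) [CommRing R] [CommRing S] [CommRing A] [Algebra R S]
    [Algebra S A] [Algebra R A] [IsScalarTower R S A] [Nontrivial R] [NoZeroDivisors A]
    [FaithfulSMul R S] [FaithfulSMul S A] : etrdeg R S + etrdeg S A = etrdeg R A := by
  rw [etrdeg, etrdeg, etrdeg, ← map_add, trdeg_add_eq R S]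

lemma etrdeg_quotient_comap_le {A B : Type u} [CommRing A] [CommRing B] [Algebra k A] [Algebra k B]
    (f : A →ₐ[k] B) (P : Ideal B) : etrdeg k (A ⧸ P.comap f) ≤ etrdeg k (B ⧸ P) := by
  refine etrdeg_le_of_injective (Ideal.quotientMapₐ P f le_rfl) ?_
  rw [injective_iff_map_eq_zero]
  intro x hx
  obtain ⟨a, rfl⟩ := Ideal.Quotient.mk_surjective x
  have h : Ideal.Quotient.mk P (f a) = 0 := hx
  have h' : f a ∈ P := Ideal.Quotient.eq_zero_iff_mem.mp h
  exact Ideal.Quotient.eq_zero_iff_mem.mpr h'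

/-- `N` is at most the height of any prime plus the transcendence degree of its quotient. -/
def HeightBound (k A : Type u) [Field k] [CommRing A] [Algebra k A] (N : ℕ) : Prop :=
  ∀ P : Ideal A, P.IsPrime → (N : ℕ∞) ≤ P.height + etrdeg k (A ⧸ P)

lemma HeightBound.of_algEquiv {A B : Type u} [CommRing A] [CommRing B] [Algebra k A] [Algebra k B]
    (e : A ≃ₐ[k] B) {N : ℕ} (h : HeightBound k A N) : HeightBound k B N := by
  intro P hP
  have hP' : (P.comap (e : A ≃+* B)).IsPrime := Ideal.comap_isPrime _ _
  have h1 := h _ hP'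
  rw [RingEquiv.height_comap] at h1
  exact h1.trans (add_le_add le_rfl (etrdeg_quotient_comap_le (e : A →ₐ[k] B) P))

/-- Let `p` be the contraction of `P`. If `P = p A[X]`, the quotient is a polynomial ring over `A/p`
and the transcendence degree grows by one. Otherwise `P` lies strictly above the prime `p A[X]`, and
the height grows by one. Going down shows that extending `p` does not lower its height. -/
lemma HeightBound.polynomial {A : Type u} [CommRing A] [IsNoetherianRing A] [Algebra k A] {N : ℕ}
    (h : HeightBound k A N) : HeightBound k (Polynomial A) (N + 1) := by
  intro P hP
  let p := P.comap (algebraMap A (Polynomial A))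
  have hp : p.IsPrime := Ideal.comap_isPrime _ _
  have : P.LiesOver p := ⟨rfl⟩
  have h1 := h p hp
  have hle : p.map (algebraMap A (Polynomial A)) ≤ P := Ideal.map_comap_le
  have hpP : (p.map (algebraMap A (Polynomial A))).IsPrime :=
    Ideal.isPrime_map_C_of_isPrime
  have ht : p.height ≤ (p.map (algebraMap A (Polynomial A))).height := by
    have : (p.map (algebraMap A (Polynomial A))).LiesOver p := by
      refine ⟨le_antisymm Ideal.le_comap_map (Ideal.comap_mono hle)⟩
    rw [Ideal.height_eq_height_add_of_liesOver_of_hasGoingDown p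
      (p.map (algebraMap A (Polynomial A)))]
    exact le_self_add
  push_cast
  rcases hle.eq_or_lt with heq | hlt
  · have e : Polynomial (A ⧸ p) ≃+* Polynomial A ⧸ P :=
      (Ideal.polynomialQuotientEquivQuotientPolynomial p).trans (Ideal.quotEquivOfEq heq)
    have h2 : etrdeg k (A ⧸ p) + 1 ≤ etrdeg k (Polynomial A ⧸ P) := by
      have h3 : etrdeg k (A ⧸ p) + 1 = etrdeg k (Polynomial (A ⧸ p)) := by
        rw [← etrdeg_add k (A ⧸ p) (Polynomial (A ⧸ p))]
        simp [etrdeg, Polynomial.trdeg_of_isDomain]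
      rw [h3]
      let f : Polynomial (A ⧸ p) →ₐ[k] Polynomial A ⧸ P :=
        { ((Ideal.quotEquivOfEq heq).toRingHom.comp
            (Ideal.polynomialQuotientEquivQuotientPolynomial p).toRingHom) with
          commutes' := fun a => by
            have : algebraMap k (Polynomial (A ⧸ p)) a =
                (Polynomial.C (algebraMap k A a)).map (Ideal.Quotient.mk p) := by
              rw [Polynomial.map_C]; rfl
            simp only [RingEquiv.toRingHom_eq_coe, RingHom.toMonoidHom_eq_coe,
              OneHom.toFun_eq_coe, MonoidHom.toOneHom_coe, MonoidHom.coe_coe, RingHom.coe_comp,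
              RingHom.coe_coe, Function.comp_apply]
            rw [this]
            erw [Ideal.polynomialQuotientEquivQuotientPolynomial_map_mk]
            rfl }
      exact etrdeg_le_of_injective f
        (((Ideal.polynomialQuotientEquivQuotientPolynomial p).trans
          (Ideal.quotEquivOfEq heq)).injective)
    calc (N : ℕ∞) + 1 ≤ p.height + etrdeg k (A ⧸ p) + 1 := by gcongr
      _ = p.height + (etrdeg k (A ⧸ p) + 1) := add_assoc _ _ _
      _ ≤ _ := add_le_add (ht.trans (Ideal.height_mono hle)) h2
  · have h2 : etrdeg k (A ⧸ p) ≤ etrdeg k (Polynomial A ⧸ P) :=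
      etrdeg_quotient_comap_le (IsScalarTower.toAlgHom k A (Polynomial A)) P
    calc (N : ℕ∞) + 1 ≤ p.height + etrdeg k (A ⧸ p) + 1 := by gcongr
      _ = (p.height + 1) + etrdeg k (A ⧸ p) := add_right_comm _ _ _
      _ ≤ _ := add_le_add ((add_le_add ht le_rfl).trans
        (Ideal.height_add_one_le_of_lt_of_isPrime hlt)) h2

lemma heightBound_mvPolynomial_fin (k : Type u) [Field k] (N : ℕ) :
    HeightBound k (MvPolynomial (Fin N) k) N := by
  induction N with
  | zero =>
    intro P hP
    simp
  | succ N ih =>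
    exact ih.polynomial.of_algEquiv (MvPolynomial.finSuccEquiv k N).symm

lemma heightBound_mvPolynomial (k : Type u) [Field k] (σ : Type) [Finite σ] :
    HeightBound k (MvPolynomial σ k) (Nat.card σ) :=
  (heightBound_mvPolynomial_fin k _).of_algEquiv
    (MvPolynomial.renameEquiv k (Finite.equivFin σ)).symm

/-- Every component of an affine variety in `N`-space that is defined by `c` equations has dimension
at least `N - c`. -/
lemma card_le_add_etrdeg_of_mem_minimalPrimes {σ ι : Type} [Finite σ] [Finite ι]
    (f : ι → MvPolynomial σ k) {P : Ideal (MvPolynomial σ k)}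
    (hP : P ∈ (Ideal.span (Set.range f)).minimalPrimes) :
    (Nat.card σ : ℕ∞) ≤ Nat.card ι + etrdeg k (MvPolynomial σ k ⧸ P) := by
  refine (heightBound_mvPolynomial k σ P hP.1.1).trans (add_le_add ?_ le_rfl)
  refine (Ideal.height_le_card_of_mem_minimalPrimes_span (Set.finite_range f) hP).trans ?_
  rw [← Set.image_univ, ← Set.ncard_univ]
  exact_mod_cast Set.ncard_image_le Set.finite_univ

/-- By Noether normalization `R` is integral over a polynomial ring in `trdeg R` variables, and
going up lifts chains of primes from there. -/
lemma etrdeg_le_ringKrullDim (R : Type u) [CommRing R] [IsDomain R] [Algebra k R]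
    [Algebra.FiniteType k R] : ((etrdeg k R : ℕ∞) : WithBot ℕ∞) ≤ ringKrullDim R := by
  obtain ⟨s, g, hg, hint⟩ := exists_integral_inj_algHom_of_fg k R
  algebraize [g.toRingHom]
  have hinj : Function.Injective (algebraMap (MvPolynomial (Fin s) k) R) := hg
  have : FaithfulSMul (MvPolynomial (Fin s) k) R :=
    (faithfulSMul_iff_algebraMap_injective _ _).mpr hinj
  have : IsScalarTower k (MvPolynomial (Fin s) k) R := .of_algebraMap_eq fun a => (g.commutes a).symm
  have : Algebra.IsIntegral (MvPolynomial (Fin s) k) R := ⟨hint⟩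
  have h1 : etrdeg k R = s := by
    rw [← etrdeg_add k (MvPolynomial (Fin s) k) R]
    have : Algebra.trdeg (MvPolynomial (Fin s) k) R = 0 := trdeg_eq_zero
    simp [etrdeg, this, MvPolynomial.trdeg_of_isDomain]
  have h2 : ringKrullDim (MvPolynomial (Fin s) k) = s := by
    rw [MvPolynomial.ringKrullDim_of_isNoetherianRing, ringKrullDim_eq_zero_of_field]; simp
  rw [h1]
  refine h2.symm.le.trans ?_
  refine iSup_le fun l => ?_
  obtain ⟨Q, -, hQ, hQl⟩ := Ideal.exists_ideal_over_prime_of_isIntegral l.head.asIdeal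
    (⊥ : Ideal R) (by
      rw [← RingHom.ker_eq_comap_bot, (RingHom.injective_iff_ker_eq_bot _).mp hinj]; exact bot_le)
  have : Q.LiesOver l.head.asIdeal := ⟨hQl.symm⟩
  obtain ⟨l', hl', -⟩ := Ideal.exists_ltSeries_of_hasGoingUp l Q
  rw [← hl']
  exact Order.LTSeries.length_le_krullDim l'

/-- A `K`-point of `Spec R` whose coordinates generate `K` up to algebraic extensions has a closure
of dimension at least `trdeg K`. This bounds `dim Y_L` from below. -/
lemma etrdeg_le_ringKrullDim_quotient_ker {R K : Type u} [CommRing R] [Field K] [Algebra k R]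
    [Algebra k K] [Algebra.FiniteType k R] (f : R →ₐ[k] K) (hf : Algebra.IsAlgebraic f.range K) :
    ((etrdeg k K : ℕ∞) : WithBot ℕ∞) ≤ ringKrullDim (R ⧸ RingHom.ker f) := by
  have : (RingHom.ker f).IsPrime := RingHom.ker_isPrime f
  have h1 : etrdeg k K = etrdeg k f.range := by
    rw [← etrdeg_add k f.range K]
    have : Algebra.trdeg f.range K = 0 := trdeg_eq_zero
    simp [etrdeg, this]
  rw [h1]
  refine le_trans ?_ (etrdeg_le_ringKrullDim (k := k) (R ⧸ RingHom.ker f))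
  exact_mod_cast etrdeg_le_of_injective (Ideal.quotientKerEquivRange f).symm.toAlgHom
    (Ideal.quotientKerEquivRange f).symm.injective

end Dimension

/-! ### Equations of the linear section on a chart, and their universal property. -/

section Equations

variable {m n r : ℕ} {k : Type u} [Field k]

/-- The value at `l` of the linear form on `V ⊗ U` given by a pair. -/
def FactorPair.pairing {S : Type*} [CommRing S] (κ : k →+* S) (P : FactorPair m n r S)
    (l : Fin n × Fin m → k) : S := ∑ p, κ (l p) * P.coords p

/-- The linear form given by the pair vanishes on `L`. -/
def FactorPair.Satisfies {S : Type*} [CommRing S] (κ : k →+* S) (P : FactorPair m n r S)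
    (L : Submodule k (Fin n × Fin m → k)) : Prop := ∀ l ∈ L, P.pairing κ l = 0

lemma FactorPair.map_pairing {S T : Type*} [CommRing S] [CommRing T] (κ : k →+* S) (φ : S →+* T)
    (P : FactorPair m n r S) (l : Fin n × Fin m → k) :
    (P.map φ).pairing (φ.comp κ) l = φ (P.pairing κ l) := by
  simp [FactorPair.pairing, FactorPair.map_coords]

lemma FactorPair.Satisfies.map {S T : Type*} [CommRing S] [CommRing T] {κ : k →+* S}
    {P : FactorPair m n r S} {L : Submodule k (Fin n × Fin m → k)} (h : P.Satisfies κ L)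
    (φ : S →+* T) : (P.map φ).Satisfies (φ.comp κ) L := fun l hl => by
  rw [FactorPair.map_pairing, h l hl, map_zero]

lemma FactorPair.Satisfies.normalize {S : Type*} [CommRing S] {κ : k →+* S}
    {P : FactorPair m n r S} {L : Submodule k (Fin n × Fin m → k)} (h : P.Satisfies κ L)
    {c : ChartIndex m n r} (hc : IsUnit (P.locus c)) : (P.normalize c).Satisfies κ L := fun l hl => by
  have := h l hl
  simp only [FactorPair.pairing, FactorPair.coords_normalize hc, Pi.smul_apply, smul_eq_mul] at this ⊢
  simp only [mul_left_comm, ← Finset.mul_sum, this, mul_zero]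

variable (c : ChartIndex m n r) (L : Submodule k (Fin n × Fin m → k))

/-- The ideal of the linear section on the chart `c`. -/
def chartIdeal : Ideal (ChartRing k c) :=
  Ideal.span (Set.range fun l : L => (generic k c).pairing MvPolynomial.C l.1)

/-- The coordinate ring of the linear section on the chart `c`. -/
abbrev SectionRing : Type u := ChartRing k c ⧸ chartIdeal c L

/-- The quotient map onto the coordinate ring of the linear section. -/
abbrev toSectionRing : ChartRing k c →+* SectionRing c L := Ideal.Quotient.mk _

/-- The universal pair on the linear section over the chart `c`. -/
def sectionPair : FactorPair m n r (SectionRing c L) := (generic k c).map (toSectionRing c L)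

lemma sectionPair_isNormalized : (sectionPair c L).IsNormalized c :=
  (generic_isNormalized k c).map _

variable {c L} in
lemma chartIdeal_le_ker_iff {S : Type*} [CommRing S] (φ : ChartRing k c →+* S) :
    chartIdeal c L ≤ RingHom.ker φ ↔
      ((generic k c).map φ).Satisfies (φ.comp MvPolynomial.C) L := by
  rw [chartIdeal, Ideal.span_le, Set.range_subset_iff]
  simp only [FactorPair.Satisfies, FactorPair.map_pairing, Subtype.forall]
  rfl

lemma sectionPair_satisfies : (sectionPair c L).Satisfies (algebraMap k (SectionRing c L)) L := by
  have := (chartIdeal_le_ker_iff (L := L) (toSectionRing c L)).mp (by rw [Ideal.mk_ker])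
  exact this

/-- The homomorphism on the coordinate ring of the linear section that takes the universal pair
to `P`. -/
def sectionEval {S : Type*} [CommRing S] (κ : k →+* S) (P : FactorPair m n r S)
    (hP : P.IsNormalized c) (hL : P.Satisfies κ L) : SectionRing c L →+* S :=
  Ideal.Quotient.lift _ (evalPair c κ P) fun a ha =>
    (chartIdeal_le_ker_iff (evalPair c κ P)).mpr
      (by rwa [map_evalPair κ hP, evalPair_comp_C]) ha

lemma sectionEval_comp {S : Type*} [CommRing S] (κ : k →+* S) (P : FactorPair m n r S)
    (hP : P.IsNormalized c) (hL : P.Satisfies κ L) :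
    (sectionEval c L κ P hP hL).comp (toSectionRing c L) = evalPair c κ P :=
  Ideal.Quotient.lift_comp_mk _ _ _

lemma sectionEval_comp_algebraMap {S : Type*} [CommRing S] (κ : k →+* S) (P : FactorPair m n r S)
    (hP : P.IsNormalized c) (hL : P.Satisfies κ L) :
    (sectionEval c L κ P hP hL).comp (algebraMap k _) = κ := by
  have h : algebraMap k (SectionRing c L) = (toSectionRing c L).comp MvPolynomial.C := rfl
  rw [h, ← RingHom.comp_assoc, sectionEval_comp, evalPair_comp_C]

lemma map_sectionEval {S : Type*} [CommRing S] (κ : k →+* S) (P : FactorPair m n r S)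
    (hP : P.IsNormalized c) (hL : P.Satisfies κ L) :
    (sectionPair c L).map (sectionEval c L κ P hP hL) = P := by
  rw [sectionPair, FactorPair.map_map, sectionEval_comp, map_evalPair κ hP]

variable {c L} in
lemma sectionHom_ext {S : Type*} [CommRing S] {φ ψ : SectionRing c L →+* S}
    (hC : φ.comp (algebraMap k _) = ψ.comp (algebraMap k _))
    (h : (sectionPair c L).map φ = (sectionPair c L).map ψ) : φ = ψ := by
  apply Ideal.Quotient.ringHom_ext
  exact chartHom_ext hC h

end Equations

/-! ### The fibre product with `ℙ(W / L)` over one chart. -/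

section SectionCharts

variable {m n r : ℕ} {k : Type u} [Field k]
  (c : ChartIndex m n r) (L : Submodule k (Fin n × Fin m → k))

lemma sectionRing_smul_def (a : k) (x : SectionRing c L) :
    a • x = algebraMap k (SectionRing c L) a * x := by
  obtain ⟨y, rfl⟩ := Ideal.Quotient.mk_surjective x
  change Ideal.Quotient.mk _ (a • y) = Ideal.Quotient.mk _ (MvPolynomial.C a * y)
  rw [MvPolynomial.smul_eq_C_mul]

/-- The linear form given by the universal pair, on `W / L`. -/
def sectionForm : ((Fin n × Fin m → k) ⧸ L) →ₗ[k] SectionRing c L :=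
  L.liftQ
    { toFun := fun l => (sectionPair c L).pairing (algebraMap k _) l
      map_add' := fun x y => by simp [FactorPair.pairing, add_mul, Finset.sum_add_distrib]
      map_smul' := fun a x => by
        rw [sectionRing_smul_def]
        simp [FactorPair.pairing, Finset.mul_sum, mul_assoc] }
    fun l hl => sectionPair_satisfies c L l hl

lemma sectionForm_mkQ_single (p : Fin n × Fin m) :
    sectionForm c L (L.mkQ (Pi.single p 1)) = (sectionPair c L).coords p := by
  classical
  change (sectionPair c L).pairing (algebraMap k _) _ = _
  rw [FactorPair.pairing, Finset.sum_eq_single p]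
  · simp
  · intro q _ hq; simp [Pi.single_eq_of_ne hq]
  · simp

/-- The homogeneous coordinates of the image point in `ℙ(W / L)`. -/
def sectionCoords (t : Fin (quotientRank L)) : SectionRing c L :=
  sectionForm c L (Module.finBasis k _ t)

/-- The universal linear form on the section kills `L`, so its homogeneous coordinates factor
through `Sym (W / L)`. -/
lemma evalVec_symQuotient :
    (evalVec (algebraMap k _) (sectionCoords c L)).comp (symQuotient L : _ →+* _) =
      evalVec (algebraMap k (SectionRing c L)) (sectionPair c L).coords := by
  apply MvPolynomial.ringHom_ext
  · intro a
    have : (symQuotient L : MvPolynomial (Fin n × Fin m) k →+* MvPolynomial (Fin (quotientRank L)) k)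
        (MvPolynomial.C a) = MvPolynomial.C a :=
      (MvPolynomial.aeval (quotientForm L)).commutes a
    rw [RingHom.comp_apply, this]
    simp [evalVec]
  · intro p
    have h1 : (symQuotient L : MvPolynomial _ k →+* _) (MvPolynomial.X p) = quotientForm L p :=
      symQuotient_X L p
    rw [RingHom.comp_apply, h1, evalVec_X, ← sectionForm_mkQ_single,
      ← (Module.finBasis k ((Fin n × Fin m → k) ⧸ L)).sum_repr (L.mkQ (Pi.single p 1)), map_sum,
      quotientForm, map_sum]
    refine Finset.sum_congr rfl fun t _ => ?_
    rw [MvPolynomial.smul_eq_C_mul, map_mul, evalVec_X, map_smul, sectionRing_smul_def]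
    congr 1
    simp only [evalVec, MvPolynomial.coe_eval₂Hom, MvPolynomial.eval₂_C]
    congr!

/-- The coordinate on `ℙ(W)` that is `1` on the chart `c`. -/
abbrev pivotVar : MvPolynomial (Fin n × Fin m) k := MvPolynomial.X (c.j, c.I c.s)

lemma coords_sectionPair_pivot : (sectionPair c L).coords (c.j, c.I c.s) = 1 := by
  rw [FactorPair.coords_pivot, (sectionPair_isNormalized c L).pivot_eq]

lemma isUnit_evalVec_sectionCoords :
    IsUnit (evalVec (algebraMap k _) (sectionCoords c L) (symQuotient L (pivotVar c))) := by
  have := congr($(evalVec_symQuotient c L) (pivotVar c))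
  rw [evalVec_X, coords_sectionPair_pivot] at this
  exact this ▸ isUnit_one

lemma isUnit_evalVec_generic :
    IsUnit (evalVec MvPolynomial.C (generic k c).coords (pivotVar c)) := by
  rw [evalVec_X, FactorPair.coords_pivot, (generic_isNormalized k c).pivot_eq]
  exact isUnit_one

/-- The functions on the affine chart of `ℙ(W / L)`, as functions on the section. -/
abbrev sectionAwayEval :
    HomogeneousLocalization.Away (grading (Fin (quotientRank L)) k) (symQuotient L (pivotVar c)) →+*
      SectionRing c L :=
  awayEval (evalVec (algebraMap k _) (sectionCoords c L)) _ (isUnit_evalVec_sectionCoords c L)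

/-- The functions on the affine chart of `ℙ(W)`, as functions on the chart `c`. -/
abbrev chartAwayEval :
    HomogeneousLocalization.Away (grading (Fin n × Fin m) k) (pivotVar (k := k) c) →+*
      ChartRing k c :=
  awayEval (evalVec MvPolynomial.C (generic k c).coords) _ (isUnit_evalVec_generic c)

lemma sectionAwayEval_comp :
    (sectionAwayEval c L).comp (HomogeneousLocalization.Away.map (symQuotient L) (pivotVar c)) =
      (toSectionRing c L).comp (chartAwayEval c) := by
  ext a
  obtain ⟨N, x, hx, rfl⟩ := a.mk_surjective _ (X_mem_grading _)
  have e1 := awayEval_mk _ (isUnit_evalVec_sectionCoords c L)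
    ((symQuotient L).map_mem (X_mem_grading _)) N (symQuotient L x) ((symQuotient L).map_mem hx)
  have e2 := congr(toSectionRing c L
    $(awayEval_mk _ (isUnit_evalVec_generic (k := k) c) (X_mem_grading _) N x hx))
  have h (y) : evalVec (algebraMap k _) (sectionCoords c L) (symQuotient L y) =
      toSectionRing c L (evalVec MvPolynomial.C (generic k c).coords y) := by
    refine congr($(evalVec_symQuotient c L) y).trans ?_
    rw [sectionPair, FactorPair.map_coords]
    exact (MvPolynomial.eval₂_comp_left (toSectionRing c L) _ _ y).symm
  rw [map_mul, map_pow] at e2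
  rw [h, h, ← e2] at e1
  have hu : IsUnit (toSectionRing c L (evalVec MvPolynomial.C (generic k c).coords (pivotVar c))) :=
    (isUnit_evalVec_generic c).map _
  rw [RingHom.comp_apply, RingHom.comp_apply, HomogeneousLocalization.Away.map_mk]
  exact (hu.pow N).mul_right_cancel e1

lemma symQuotient_surjective_homogeneous (N : ℕ) (x : MvPolynomial (Fin (quotientRank L)) k)
    (hx : x ∈ grading (Fin (quotientRank L)) k N) :
    ∃ y ∈ grading (Fin n × Fin m) k N, symQuotient L y = x := by
  choose g hg hgx using X_mem_range_symQuotient L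
  refine ⟨MvPolynomial.aeval g x, ?_, ?_⟩
  · have hx' : x.IsHomogeneous N := hx
    have := hx'.aeval g hg
    rwa [one_mul] at this
  · have : (MvPolynomial.aeval (quotientForm L)).comp (MvPolynomial.aeval g) =
        AlgHom.id k (MvPolynomial (Fin (quotientRank L)) k) := by
      ext1 t
      simpa using! hgx t
    exact congr($this x)

lemma awayMap_symQuotient_surjective :
    Function.Surjective
      (HomogeneousLocalization.Away.map (symQuotient L) (pivotVar (k := k) c)) := by
  intro a
  obtain ⟨N, x, hx, rfl⟩ := a.mk_surjective _ ((symQuotient L).map_mem (X_mem_grading _))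
  obtain ⟨y, hy, rfl⟩ := symQuotient_surjective_homogeneous L _ x hx
  exact ⟨.mk _ (X_mem_grading _) N y hy, HomogeneousLocalization.Away.map_mk ..⟩

/-- The pivot coordinate is `1` on the chart, so dehomogenizing the linear form `l` gives the
equation of the section that belongs to `l`. -/
lemma chartAwayEval_mk (l : Fin n × Fin m → k)
    (hl : (∑ p, l p • MvPolynomial.X p : MvPolynomial (Fin n × Fin m) k) ∈
      grading (Fin n × Fin m) k (1 • 1)) :
    chartAwayEval c (.mk _ (X_mem_grading _) 1 (∑ p, l p • MvPolynomial.X p) hl) =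
      (generic k c).pairing MvPolynomial.C l := by
  have := awayEval_mk _ (isUnit_evalVec_generic (k := k) c) (X_mem_grading _) 1 _ hl
  rw [evalVec_X, FactorPair.coords_pivot, (generic_isNormalized k c).pivot_eq, one_pow,
    mul_one] at this
  rw [this, map_sum]
  refine Finset.sum_congr rfl fun p _ => ?_
  rw [MvPolynomial.smul_eq_C_mul, map_mul, evalVec_X]
  congr 1
  simp [evalVec]

lemma symQuotient_of_mem {l : Fin n × Fin m → k} (hl : l ∈ L) :
    symQuotient L (∑ p, l p • MvPolynomial.X p) = 0 := by
  classical
  have hsm : ∀ (a : k) (y : MvPolynomial (Fin n × Fin m) k),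
      symQuotient L (a • y) = a • symQuotient L y :=
    fun a y => map_smul (MvPolynomial.aeval (quotientForm L)) a y
  simp only [map_sum, hsm, symQuotient_X, quotientForm, Finset.smul_sum]
  rw [Finset.sum_comm]
  refine Finset.sum_eq_zero fun t _ => ?_
  simp only [smul_smul, ← Finset.sum_smul]
  have h1 : l = ∑ p, l p • (Pi.single p 1 : Fin n × Fin m → k) := by
    ext q; simp [Finset.sum_apply, Pi.single_apply]
  have h2 : (Module.finBasis k (_ ⧸ L)).repr (L.mkQ l) t = 0 := by
    rw [(by simpa using hl : L.mkQ l = 0)]; simp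
  conv_lhs at h2 => rw [h1]
  simp only [map_sum, map_smul, Finsupp.coe_finsetSum, Finset.sum_apply, Finsupp.smul_apply,
    smul_eq_mul] at h2
  have h3 := congrArg
    (· • (MvPolynomial.X t : MvPolynomial (Fin (Module.finrank k ((Fin n × Fin m → k) ⧸ L))) k)) h2
  convert h3.trans (zero_smul k _)

/-- The map of affine charts of `ℙ(W)` and `ℙ(W / L)` is surjective on functions, so a cocone is
determined by its leg on `ChartRing k c`. That leg kills `chartIdeal c L`, because the equations
come from the fractions `l / pivot` with `l ∈ L`, which vanish on `ℙ(W / L)`. -/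
lemma isPushout_section :
    IsPushout (CommRingCat.ofHom
        (HomogeneousLocalization.Away.map (symQuotient L) (pivotVar (k := k) c)))
      (CommRingCat.ofHom (chartAwayEval (k := k) c))
      (CommRingCat.ofHom (sectionAwayEval c L)) (CommRingCat.ofHom (toSectionRing c L)) := by
  have hw : CommRingCat.ofHom
        (HomogeneousLocalization.Away.map (symQuotient L) (pivotVar (k := k) c)) ≫
      CommRingCat.ofHom (sectionAwayEval c L) =
      CommRingCat.ofHom (chartAwayEval (k := k) c) ≫ CommRingCat.ofHom (toSectionRing c L) := by
    rw [← CommRingCat.ofHom_comp, ← CommRingCat.ofHom_comp, sectionAwayEval_comp]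
  refine ⟨⟨hw⟩, ⟨PushoutCocone.IsColimit.mk _ (fun s => CommRingCat.ofHom
    (Ideal.Quotient.lift _ s.inr.hom ?_)) ?_ ?_ ?_⟩⟩
  · intro a ha
    suffices h : chartIdeal c L ≤ RingHom.ker s.inr.hom from h ha
    rw [chartIdeal, Ideal.span_le]
    rintro _ ⟨⟨l, hl⟩, rfl⟩
    have hmem : (∑ p, l p • MvPolynomial.X p : MvPolynomial (Fin n × Fin m) k) ∈
        grading (Fin n × Fin m) k (1 • 1) :=
      Submodule.sum_mem _ fun p _ => Submodule.smul_mem _ _ (X_mem_grading p)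
    have h := congr(($s.condition).hom (.mk _ (X_mem_grading _) 1 (∑ p, l p • MvPolynomial.X p) hmem))
    simp only [CommRingCat.hom_comp, CommRingCat.hom_ofHom, RingHom.comp_apply] at h
    rw [chartAwayEval_mk, HomogeneousLocalization.Away.map_mk] at h
    change s.inr.hom _ = 0
    rw [← h]
    convert map_zero s.inl.hom
    ext
    rw [HomogeneousLocalization.Away.val_mk, HomogeneousLocalization.val_zero]
    simp only [symQuotient_of_mem L hl, Localization.mk_zero]
  · intro s
    ext a
    obtain ⟨b, rfl⟩ := awayMap_symQuotient_surjective c L a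
    have h := congr(($s.condition).hom b)
    have h' := congr(($hw).hom b)
    simp only [CommRingCat.hom_comp, CommRingCat.hom_ofHom, RingHom.comp_apply] at h h' ⊢
    rw [h', h]
    rfl
  · intro s
    apply CommRingCat.hom_ext
    exact Ideal.Quotient.lift_comp_mk _ _ _
  · intro s q h1 h2
    apply CommRingCat.hom_ext
    apply Ideal.Quotient.ringHom_ext
    exact congr(($h2).hom).trans (Ideal.Quotient.lift_comp_mk _ _ _).symm

/-- The affine chart of `ℙ(W / L)` where the coordinate of the chart `c` is invertible. -/
def linearAway : Spec (CommRingCat.of (HomogeneousLocalization.Away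
    (grading (Fin (quotientRank L)) k) (symQuotient L (pivotVar c)))) ⟶ linearSubspace L :=
  Proj.awayι (grading (Fin (quotientRank L)) k) (symQuotient L (pivotVar c))
      ((symQuotient L).map_mem (X_mem_grading _)) one_pos

instance : IsOpenImmersion (linearAway c L) :=
  inferInstanceAs (IsOpenImmersion (Proj.awayι _ _ _ _))

/-- The morphism from the linear section over the chart `c` to `ℙ(W / L)`. -/
def sectionToLinear : Spec (CommRingCat.of (SectionRing c L)) ⟶ linearSubspace L :=
  Spec.map (CommRingCat.ofHom (sectionAwayEval c L)) ≫
    linearAway c L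

lemma isPullback_chartToProj :
    IsPullback (sectionToLinear c L) (Spec.map (CommRingCat.ofHom (toSectionRing c L)))
      (linearSubspaceι L) (chartToProj k c) := by
  refine IsPullback.paste_horiz (h₁₁ := Spec.map (CommRingCat.ofHom (sectionAwayEval c L)))
    (h₂₁ := Spec.map (CommRingCat.ofHom (chartAwayEval c)))
    (v₁₂ := Spec.map (CommRingCat.ofHom
        (HomogeneousLocalization.Away.map (symQuotient L) (pivotVar (k := k) c))))
    (isPullback_SpecMap_of_isPushout _ _ _ _ (isPushout_section c L)) ?_
  -- The preimage of a standard open subset of `ℙ(W)` in `ℙ(W / L)` is the standard open subset of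
  -- the image of the pivot coordinate, which gives the second square.
  refine (IsOpenImmersion.isPullback _ _ _ _ ?_ ?_).flip
  · exact Proj.awayι_comp_map _ _ one_pos _ (X_mem_grading _)
  · have h1 := Proj.opensRange_awayι (grading (Fin n × Fin m) k) (pivotVar c) (X_mem_grading _) one_pos
    have h2 : (linearAway c L).opensRange =
        Proj.basicOpen (grading (Fin (quotientRank L)) k) (symQuotient L (pivotVar c)) :=
      Proj.opensRange_awayι _ _ _ _
    rw [h1, h2]
    rfl

end SectionCharts

/-! ### The open cover of `X_L` by its charts. -/

section SectionCover

variable {m n r : ℕ} {k : Type u} [Field k]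

/-- The standard chart of `ℙ(V ⊗ Q)` with index `c`. -/
def springerChart (c : ChartIndex m n r) : chartScheme k c ⟶ springer k m n r :=
  (springerGlueData k m n r).ι (ULift.up c)

instance (c : ChartIndex m n r) : IsOpenImmersion (springerChart (k := k) c) :=
  Scheme.GlueData.ι_isOpenImmersion (springerGlueData k m n r) (ULift.up c)

lemma springerChart_jointly_surjective (x : springer k m n r) :
    ∃ (c : ChartIndex m n r) (y : chartScheme k c), springerChart c y = x := by
  obtain ⟨c, y, h⟩ := (springerGlueData k m n r).ι_jointly_surjective x
  exact ⟨c.down, y, h⟩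

lemma springerChart_desc {Y : Scheme.{u}} (g : ∀ c : ChartIndex m n r, chartScheme k c ⟶ Y)
    (h : ∀ c d, overlapι k c d ≫ g c = transitionMap k c d ≫ overlapι k d c ≫ g d)
    (c : ChartIndex m n r) : springerChart c ≫ springerDesc g h = g c :=
  Multicoequalizer.π_desc _ _ _ _ _

lemma springerChart_toProj (c : ChartIndex m n r) :
    springerChart c ≫ springerToProj k m n r = chartToProj k c :=
  springerChart_desc _ _ c

lemma springerChart_structure (c : ChartIndex m n r) :
    springerChart c ≫ springerStructure k m n r =
      Spec.map (CommRingCat.ofHom (MvPolynomial.C : k →+* ChartRing k c)) :=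
  springerChart_desc _ _ c

lemma springerChart_glue (c d : ChartIndex m n r) :
    transitionMap k c d ≫ overlapι k d c ≫ springerChart d = overlapι k c d ≫ springerChart c :=
  (springerGlueData k m n r).glue_condition (ULift.up c) (ULift.up d)

/-- A pair that belongs to two charts defines the same point in both. -/
lemma springerChart_normalize {T : Type u} [CommRing T] (κ : k →+* T) (P : FactorPair m n r T)
    (c d : ChartIndex m n r) (hc : IsUnit (P.locus c)) (hd : IsUnit (P.locus d)) :
    Spec.map (CommRingCat.ofHom (evalPair c κ (P.normalize c))) ≫ springerChart c =
      Spec.map (CommRingCat.ofHom (evalPair d κ (P.normalize d))) ≫ springerChart d := by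
  have hu : IsUnit (evalPair c κ (P.normalize c) ((generic k c).locus d)) := by
    rw [← FactorPair.map_locus, map_evalPair κ (FactorPair.normalize_isNormalized hc)]
    exact FactorPair.isUnit_locus_normalize hc hd
  let φ : OverlapRing k c d →+* T := IsLocalization.Away.lift ((generic k c).locus d) hu
  have h1 : φ.comp (algebraMap (ChartRing k c) (OverlapRing k c d)) =
      evalPair c κ (P.normalize c) := IsLocalization.Away.lift_comp _ _
  have h2 : φ.comp (changeChart k c d) = evalPair d κ (P.normalize d) := by
    apply chartHom_ext
    · rw [RingHom.comp_assoc, changeChart_comp_C, ← algebraMap_comp_C, ← RingHom.comp_assoc, h1,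
        evalPair_comp_C, evalPair_comp_C]
    · rw [← FactorPair.map_map, map_changeChart, ← FactorPair.map_normalize _
        (isUnit_locus_overlapPair k c d), overlapPair, FactorPair.map_map, h1,
        map_evalPair κ (FactorPair.normalize_isNormalized hc),
        map_evalPair κ (FactorPair.normalize_isNormalized hd),
        FactorPair.normalize_normalize hc hd]
  have h3 := congr(Spec.map (CommRingCat.ofHom φ) ≫ $(springerChart_glue (k := k) c d))
  rw [← h1, ← h2, CommRingCat.ofHom_comp, Spec.map_comp, Category.assoc, ← h3,
    ← transition_comp_algebraMap, CommRingCat.ofHom_comp, CommRingCat.ofHom_comp,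
    Spec.map_comp, Spec.map_comp]
  simp only [Category.assoc]

variable (c : ChartIndex m n r) (L : Submodule k (Fin n × Fin m → k))

/-- The projection of `X_L` to `ℙ(V ⊗ Q)`. -/
def sectionXToSpringer : sectionX r L ⟶ springer k m n r :=
  pullback.fst (springerToProj k m n r) (linearSubspaceι L)

/-- The part of `X_L` over the chart `c`. -/
def sectionChart : Spec (CommRingCat.of (SectionRing c L)) ⟶ sectionX r L :=
  pullback.lift (Spec.map (CommRingCat.ofHom (toSectionRing c L)) ≫ springerChart c)
    (sectionToLinear c L) (by
      rw [Category.assoc, springerChart_toProj]; exact (isPullback_chartToProj c L).w.symm)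

lemma sectionChart_fst : sectionChart c L ≫ sectionXToSpringer L =
    Spec.map (CommRingCat.ofHom (toSectionRing c L)) ≫ springerChart c :=
  pullback.lift_fst _ _ _

lemma isPullback_sectionChart :
    IsPullback (sectionChart c L) (Spec.map (CommRingCat.ofHom (toSectionRing c L)))
      (sectionXToSpringer L) (springerChart c) := by
  refine IsPullback.of_right (h₁₂ := pullback.snd _ _) (h₂₂ := springerToProj k m n r)
    (v₁₃ := linearSubspaceι L) ?_ (sectionChart_fst c L)
    (IsPullback.of_hasPullback (springerToProj k m n r) (linearSubspaceι L)).flip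
  rw [springerChart_toProj]
  convert isPullback_chartToProj c L
  exact pullback.lift_snd _ _ _

instance : IsOpenImmersion (sectionChart c L) :=
  MorphismProperty.of_isPullback (isPullback_sectionChart c L).flip
    (inferInstanceAs (IsOpenImmersion (springerChart c)))

lemma range_sectionChart : Set.range (sectionChart c L) =
    (sectionXToSpringer L) ⁻¹' Set.range (springerChart (k := k) c) := by
  have h := IsOpenImmersion.image_preimage_eq_preimage_image_of_isPullback
    (isPullback_sectionChart c L).flip ⊤
  simpa using congr(($h : Set (sectionX r L)))

lemma sectionChart_jointly_surjective (x : sectionX r L) :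
    ∃ (c : ChartIndex m n r) (y : Spec (CommRingCat.of (SectionRing c L))),
      sectionChart c L y = x := by
  obtain ⟨c, y, hy⟩ := springerChart_jointly_surjective
    (sectionXToSpringer L x)
  have : x ∈ Set.range (sectionChart c L) := by
    rw [range_sectionChart]; exact ⟨y, hy⟩
  exact ⟨c, this⟩

lemma sectionChart_structure : sectionChart c L ≫ sectionXStructure r L =
    Spec.map (CommRingCat.ofHom (algebraMap k (SectionRing c L))) := by
  change sectionChart c L ≫ sectionXToSpringer L ≫ springerStructure k m n r = _
  rw [← Category.assoc, sectionChart_fst, Category.assoc,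
    springerChart_structure, ← Spec.map_comp, ← CommRingCat.ofHom_comp]
  rfl

variable {c} in
/-- A point that is given by a pair over a field and belongs to two charts is the same in both. -/
lemma sectionChart_normalize {K : Type u} [Field K] (κ : k →+* K) (P : FactorPair m n r K)
    (d : ChartIndex m n r) (hc : IsUnit (P.locus c)) (hd : IsUnit (P.locus d))
    (hP : P.Satisfies κ L) (x : Spec (CommRingCat.of K)) :
    sectionChart c L (Spec.map (CommRingCat.ofHom (sectionEval c L κ (P.normalize c)
      (FactorPair.normalize_isNormalized hc) (hP.normalize hc))) x) =
    sectionChart d L (Spec.map (CommRingCat.ofHom (sectionEval d L κ (P.normalize d)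
      (FactorPair.normalize_isNormalized hd) (hP.normalize hd))) x) := by
  -- Over each chart the projection to `springer` is the spectrum of a quotient map, hence injective
  -- on points. So it suffices to compare the two points in `springer`.
  have key : ∀ (e : ChartIndex m n r) (he : IsUnit (P.locus e)),
      sectionXToSpringer L
        (sectionChart e L (Spec.map (CommRingCat.ofHom (sectionEval e L κ (P.normalize e)
          (FactorPair.normalize_isNormalized he) (hP.normalize he))) x)) =
      springerChart e (Spec.map (CommRingCat.ofHom (evalPair e κ (P.normalize e))) x) := by
    intro e he
    rw [← Scheme.Hom.comp_apply, ← Scheme.Hom.comp_apply, ← Scheme.Hom.comp_apply,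
      sectionChart_fst, ← Category.assoc, ← Spec.map_comp,
      ← CommRingCat.ofHom_comp, sectionEval_comp]
  have hcd : springerChart c (Spec.map (CommRingCat.ofHom (evalPair c κ (P.normalize c))) x) =
      springerChart d (Spec.map (CommRingCat.ofHom (evalPair d κ (P.normalize d))) x) := by
    rw [← Scheme.Hom.comp_apply, springerChart_normalize κ P c d hc hd, Scheme.Hom.comp_apply]
  rw [← key c hc, ← key d hd] at hcd
  set z := sectionChart c L (Spec.map (CommRingCat.ofHom (sectionEval c L κ (P.normalize c)
      (FactorPair.normalize_isNormalized hc) (hP.normalize hc))) x)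
  have hz : z ∈ Set.range (sectionChart d L) := by
    rw [range_sectionChart]
    exact ⟨_, (hcd.trans (key d hd)).symm⟩
  obtain ⟨b, hb⟩ := hz
  rw [← hb] at hcd ⊢
  congr 1
  rw [← Scheme.Hom.comp_apply, ← Scheme.Hom.comp_apply, sectionChart_fst, Scheme.Hom.comp_apply,
    Scheme.Hom.comp_apply] at hcd
  have h1 := (springerChart (k := k) d).isOpenEmbedding.injective hcd
  exact PrimeSpectrum.comap_injective_of_surjective (toSectionRing d L)
    Ideal.Quotient.mk_surjective h1

end SectionCover

/-! ### The equations as a linear system in `B` with coefficients depending on `A`. -/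

section FormMatrix

variable {m n r : ℕ} {k : Type u} [Field k] (L : Submodule k (Fin n × Fin m → k))
  {S T : Type*} [CommRing S] [CommRing T]

/-- The matrix of the map `L ⟶ V ⊗ Q` induced by `A : U ⟶ Q`. -/
def formMatrix (κ : k →+* S) (A : Matrix (Fin r) (Fin m) S) :
    Matrix (Fin (Module.finrank k L)) (Fin n × Fin r) S :=
  .of fun i q => ∑ u, κ ((Module.finBasis k L i : Fin n × Fin m → k) (q.1, u)) * A q.2 u

/-- The linear form on `V ⊗ Q` of a pair, as a vector. -/
def FactorPair.vec (P : FactorPair m n r S) : Fin n × Fin r → S := fun q => P.B q.1 q.2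

lemma FactorPair.map_A_apply (φ : S →+* T) (P : FactorPair m n r S) (t : Fin r) (l : Fin m) :
    (P.map φ).A t l = φ (P.A t l) := rfl

lemma FactorPair.map_B_apply (φ : S →+* T) (P : FactorPair m n r S) (j : Fin n) (s : Fin r) :
    (P.map φ).B j s = φ (P.B j s) := rfl

lemma formMatrix_mulVec (κ : k →+* S) (P : FactorPair m n r S) (i : Fin (Module.finrank k L)) :
    (formMatrix L κ P.A).mulVec P.vec i = P.pairing κ (Module.finBasis k L i).1 := by
  simp only [Matrix.mulVec, dotProduct, formMatrix, Matrix.of_apply, FactorPair.vec,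
    FactorPair.pairing, FactorPair.coords, FactorPair.product, Matrix.mul_apply,
    Fintype.sum_prod_type, Finset.sum_mul, Finset.mul_sum]
  refine Finset.sum_congr rfl fun j _ => ?_
  rw [Finset.sum_comm]
  exact Finset.sum_congr rfl fun _ _ => Finset.sum_congr rfl fun _ _ => by ring

variable {L} in
-- The pairing is linear in `l`, so a basis of `L` suffices, and `dim L` equations cut out the
-- section.
lemma satisfies_iff (κ : k →+* S) (P : FactorPair m n r S) :
    P.Satisfies κ L ↔ (formMatrix L κ P.A).mulVec P.vec = 0 := by
  refine ⟨fun h => ?_, fun h l hl => ?_⟩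
  · ext i
    rw [formMatrix_mulVec]
    exact h _ (Module.finBasis k L i).2
  · have h1 := congr(Subtype.val $((Module.finBasis k L).sum_repr ⟨l, hl⟩))
    have h2 : ∀ i, P.pairing κ (Module.finBasis k L i).1 = 0 := fun i => by
      rw [← formMatrix_mulVec, h]; rfl
    simp only [Submodule.coe_sum, Submodule.coe_smul] at h1
    rw [← h1]
    simp only [FactorPair.pairing, Finset.sum_apply, Pi.smul_apply, smul_eq_mul, map_sum, map_mul,
      Finset.sum_mul] at h2 ⊢
    rw [Finset.sum_comm]
    refine Finset.sum_eq_zero fun i _ => ?_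
    simp only [mul_assoc, ← Finset.mul_sum, h2, mul_zero]

lemma formMatrix_map (κ : k →+* S) (φ : S →+* T) (A : Matrix (Fin r) (Fin m) S) :
    (formMatrix L κ A).map φ = formMatrix L (φ.comp κ) (A.map φ) := by
  ext i q; simp [formMatrix]

lemma formMatrix_smul (κ : k →+* S) (a : S) (A : Matrix (Fin r) (Fin m) S) :
    formMatrix L κ (a • A) = a • formMatrix L κ A := by
  ext i q
  simp only [formMatrix, Matrix.of_apply, Matrix.smul_apply, smul_eq_mul, Finset.mul_sum]
  exact Finset.sum_congr rfl fun _ _ => by ring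

/-- The maximal minor of the form matrix with columns `τ`. -/
def formMinor (τ : Fin (Module.finrank k L) → Fin n × Fin r) (κ : k →+* S)
    (A : Matrix (Fin r) (Fin m) S) : S :=
  ((formMatrix L κ A).submatrix id τ).det

lemma map_formMinor (τ : Fin (Module.finrank k L) → Fin n × Fin r) (κ : k →+* S) (φ : S →+* T)
    (A : Matrix (Fin r) (Fin m) S) :
    φ (formMinor L τ κ A) = formMinor L τ (φ.comp κ) (A.map φ) := by
  rw [formMinor, formMinor, RingHom.map_det, ← formMatrix_map]
  rfl

lemma formMinor_smul (τ : Fin (Module.finrank k L) → Fin n × Fin r) (κ : k →+* S) (a : S)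
    (A : Matrix (Fin r) (Fin m) S) :
    formMinor L τ κ (a • A) = a ^ Module.finrank k L * formMinor L τ κ A := by
  rw [formMinor, formMatrix_smul, Matrix.submatrix_smul]
  simp [formMinor]

end FormMatrix

/-! ### Solving a linear system with an invertible maximal minor. -/

section LinearSystem

variable {ι κ : Type*} [Fintype ι] [DecidableEq κ] {S : Type*} [CommRing S]

/-- The vector with entries `x` at the places `τ`, and zero elsewhere. -/
def extendVec (τ : ι ↪ κ) (x : ι → S) : κ → S := fun q => ∑ i, if τ i = q then x i else 0

lemma extendVec_apply [DecidableEq ι] (τ : ι ↪ κ) (x : ι → S) (i : ι) : extendVec τ x (τ i) = x i := by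
  simp [extendVec]

lemma extendVec_of_notMem (τ : ι ↪ κ) (x : ι → S) {q : κ} (hq : ∀ i, τ i ≠ q) :
    extendVec τ x q = 0 := by simp [extendVec, hq]

lemma mulVec_extendVec [Fintype κ] (M : Matrix ι κ S) (τ : ι ↪ κ) (x : ι → S) :
    M.mulVec (extendVec τ x) = (M.submatrix id τ).mulVec x := by
  ext i
  simp only [Matrix.mulVec, dotProduct, extendVec, Finset.mul_sum, Matrix.submatrix_apply, id]
  rw [Finset.sum_comm]
  simp

variable [Fintype κ] [DecidableEq ι]

/-- The solution of the system of equations `M` with the entries of `b` outside `τ`. -/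
def solveVec (M : Matrix ι κ S) (τ : ι ↪ κ) (b : κ → S) : κ → S :=
  b - extendVec τ ((M.submatrix id τ)⁻¹.mulVec (M.mulVec b))

lemma mulVec_solveVec (M : Matrix ι κ S) (τ : ι ↪ κ) (b : κ → S)
    (h : IsUnit (M.submatrix id τ).det) : M.mulVec (solveVec M τ b) = 0 := by
  rw [solveVec, Matrix.mulVec_sub, mulVec_extendVec, Matrix.mulVec_mulVec,
    Matrix.mul_nonsing_inv _ h, Matrix.one_mulVec, sub_self]

lemma solveVec_of_notMem (M : Matrix ι κ S) (τ : ι ↪ κ) (b : κ → S) {q : κ} (hq : ∀ i, τ i ≠ q) :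
    solveVec M τ b q = b q := by
  rw [solveVec, Pi.sub_apply, extendVec_of_notMem τ _ hq, sub_zero]

/-- The difference of two such solutions is supported on `τ`, where the system is invertible. -/
lemma eq_of_mulVec_eq_zero {M : Matrix ι κ S} {τ : ι ↪ κ} (h : IsUnit (M.submatrix id τ).det)
    {b b' : κ → S} (hb : M.mulVec b = 0) (hb' : M.mulVec b' = 0)
    (hq : ∀ q, (∀ i, τ i ≠ q) → b q = b' q) : b = b' := by
  have h1 : b - b' = extendVec τ fun i => b (τ i) - b' (τ i) := by
    ext q
    by_cases hq' : ∀ i, τ i ≠ q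
    · rw [extendVec_of_notMem _ _ hq', Pi.sub_apply, hq q hq', sub_self]
    · push Not at hq'
      obtain ⟨i, rfl⟩ := hq'
      rw [extendVec_apply, Pi.sub_apply]
  have h2 : M.mulVec (b - b') = 0 := by rw [Matrix.mulVec_sub, hb, hb', sub_zero]
  rw [h1, mulVec_extendVec] at h2
  have h3 : (fun i => b (τ i) - b' (τ i)) = 0 := by
    rw [← Matrix.one_mulVec (fun i => b (τ i) - b' (τ i)), ← Matrix.nonsing_inv_mul _ h,
      ← Matrix.mulVec_mulVec, h2, Matrix.mulVec_zero]
  rw [h3] at h1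
  have h4 : extendVec τ (0 : ι → S) = 0 := by ext q; simp [extendVec]
  rw [h4] at h1
  exact sub_eq_zero.mp h1

end LinearSystem

/-! ### Elimination: the section is open in affine space where a minor is invertible. -/

section RationalChart

variable {m n r : ℕ} {k : Type u} [Field k]
  (c : ChartIndex m n r) (L : Submodule k (Fin n × Fin m → k))
  (τ : Fin (Module.finrank k L) ↪ Fin n × Fin r)

/-- The coordinate of a chart that is an entry of `A`. -/
def chartVarA (t : Fin r) (l : Fin m) (hl : l ∉ Set.range c.I) : ChartVar c := Sum.inl ⟨(t, l), hl⟩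

/-- The coordinate of a chart that is an entry of `B`. -/
def chartVarB (q : Fin n × Fin r) (hq : q ≠ (c.j, c.s)) : ChartVar c := Sum.inr ⟨q, hq⟩

lemma chartVar_cases (v : ChartVar c) :
    (∃ t l hl, v = chartVarA c t l hl) ∨ ∃ q hq, v = chartVarB c q hq := by
  rcases v with ⟨⟨t, l⟩, hl⟩ | ⟨q, hq⟩
  · exact Or.inl ⟨t, l, hl, rfl⟩
  · exact Or.inr ⟨q, hq, rfl⟩

lemma generic_A_of_notMem {t : Fin r} {l : Fin m} (hl : l ∉ Set.range c.I) :
    (generic k c).A t l = MvPolynomial.X (chartVarA c t l hl) := by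
  simp only [generic, Matrix.of_apply, dif_neg hl]; rfl

lemma generic_A_of_mem (t s : Fin r) :
    (generic k c).A t (c.I s) = (1 : Matrix (Fin r) (Fin r) (ChartRing k c)) t s :=
  congr($((generic_isNormalized k c).block_eq) t s)

lemma generic_B_of_ne {q : Fin n × Fin r} (hq : q ≠ (c.j, c.s)) :
    (generic k c).B q.1 q.2 = MvPolynomial.X (chartVarB c q hq) := by
  simp only [generic, Matrix.of_apply, dif_neg hq]; rfl

/-- The coordinate `v` is not an entry of `B` at one of the places `τ`. -/
def IsFreeVar (v : ChartVar c) : Prop := ∀ i h, v ≠ chartVarB c (τ i) h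

lemma isFreeVar_chartVarA {t : Fin r} {l : Fin m} (hl : l ∉ Set.range c.I) :
    IsFreeVar c L τ (chartVarA c t l hl) := fun _ _ h => Sum.inl_ne_inr h

lemma isFreeVar_chartVarB_iff {q : Fin n × Fin r} (hq : q ≠ (c.j, c.s)) :
    IsFreeVar c L τ (chartVarB c q hq) ↔ ∀ i, τ i ≠ q := by
  refine ⟨?_, fun h i hi he => h i ?_⟩
  · rintro h i rfl
    exact h i hq rfl
  · exact congrArg Subtype.val (Sum.inr_injective he).symm

/-- The coordinates on the chart `c` other than the entries of `B` at the places `τ`. -/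
abbrev FreeVar : Type := {v : ChartVar c // IsFreeVar c L τ v}

/-- The ring of polynomials in the free coordinates. -/
abbrev FreeRing : Type u := MvPolynomial (FreeVar c L τ) k

/-- The inclusion of the polynomials in the free coordinates. -/
def freeInclusion : FreeRing c L τ →+* ChartRing k c :=
  (MvPolynomial.rename Subtype.val : FreeRing c L τ →ₐ[k] ChartRing k c).toRingHom

open Classical in
/-- The retraction onto the polynomials in the free coordinates that maps the other coordinates
to zero. -/
def freeRetraction : ChartRing k c →+* FreeRing c L τ :=
  MvPolynomial.eval₂Hom MvPolynomial.C
    fun v => if h : IsFreeVar c L τ v then MvPolynomial.X ⟨v, h⟩ else 0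

lemma freeInclusion_comp_C :
    (freeInclusion c L τ).comp MvPolynomial.C = MvPolynomial.C := by
  ext a
  simp [freeInclusion]

lemma freeRetraction_X {v : ChartVar c} (h : IsFreeVar c L τ v) :
    freeRetraction c L τ (MvPolynomial.X v) = MvPolynomial.X ⟨v, h⟩ := by
  refine (MvPolynomial.eval₂Hom_X' _ _ _).trans ?_
  rw [dif_pos h]

lemma freeInclusion_X (v : FreeVar c L τ) :
    freeInclusion c L τ (MvPolynomial.X v) = MvPolynomial.X v.1 := MvPolynomial.rename_X _ _

/-- The universal pair with zeros at the places `τ`. -/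
def freePair : FactorPair m n r (FreeRing c L τ) := (generic k c).map (freeRetraction c L τ)

lemma freePair_A {t : Fin r} {l : Fin m} (hl : l ∉ Set.range c.I) :
    (freePair c L τ).A t l =
      MvPolynomial.X ⟨chartVarA c t l hl, isFreeVar_chartVarA c L τ hl⟩ := by
  rw [freePair, FactorPair.map_A_apply, generic_A_of_notMem c hl, freeRetraction_X]

lemma freePair_B {q : Fin n × Fin r} (hq : q ≠ (c.j, c.s))
    (h : IsFreeVar c L τ (chartVarB c q hq)) :
    (freePair c L τ).B q.1 q.2 = MvPolynomial.X ⟨chartVarB c q hq, h⟩ := by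
  rw [freePair, FactorPair.map_B_apply, generic_B_of_ne c hq, freeRetraction_X]

lemma freePair_isNormalized : (freePair c L τ).IsNormalized c := (generic_isNormalized k c).map _

lemma freePair_A_map : (freePair c L τ).A.map (freeInclusion c L τ) = (generic k c).A := by
  ext1 t l
  by_cases hl : l ∈ Set.range c.I
  · obtain ⟨s, rfl⟩ := hl
    have h := congr($((freePair_isNormalized c L τ).block_eq) t s)
    simp only [FactorPair.block, Matrix.submatrix_apply, id] at h
    rw [Matrix.map_apply, h, generic_A_of_mem]
    simp [Matrix.one_apply, apply_ite]
  · rw [Matrix.map_apply, freePair_A c L τ hl, freeInclusion_X, generic_A_of_notMem c hl]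

lemma freePair_B_map {q : Fin n × Fin r} (h : ∀ i, τ i ≠ q) :
    freeInclusion c L τ ((freePair c L τ).B q.1 q.2) = (generic k c).B q.1 q.2 := by
  by_cases hq : q = (c.j, c.s)
  · rw [hq, (freePair_isNormalized c L τ).entry_eq, (generic_isNormalized k c).entry_eq, map_one]
  · rw [freePair_B c L τ hq ((isFreeVar_chartVarB_iff c L τ hq).mpr h), freeInclusion_X,
      generic_B_of_ne c hq]

/-- The minor `τ` of the form matrix, as a function on the chart `c`. -/
def chartMinor : ChartRing k c := formMinor L τ MvPolynomial.C (generic k c).A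

/-- The minor `τ` of the form matrix, as a polynomial in the free coordinates. -/
def freeMinor : FreeRing c L τ := formMinor L τ MvPolynomial.C (freePair c L τ).A

/-- The minor involves only the entries of `A`, none of which is eliminated. -/
lemma freeInclusion_freeMinor : freeInclusion c L τ (freeMinor c L τ) = chartMinor c L τ := by
  rw [freeMinor, map_formMinor, freeInclusion_comp_C, freePair_A_map]; rfl

lemma freeMinor_ne_zero (h : chartMinor c L τ ≠ 0) : freeMinor c L τ ≠ 0 := fun h0 => h <| by
  rw [← freeInclusion_freeMinor, h0, map_zero]

/-- The open subset of affine space where the minor `τ` is invertible. -/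
abbrev FreeAway : Type u := Localization.Away (freeMinor c L τ)

/-- The open subset of the section where the minor `τ` is invertible. -/
abbrev SectionAway : Type u := Localization.Away (toSectionRing c L (chartMinor c L τ))

/-- The pair over the open subset of affine space whose missing entries are determined by the
equations. -/
def solvedPair : FactorPair m n r (FreeAway c L τ) where
  A := (freePair c L τ).A.map (algebraMap _ _)
  B := .of fun j s => solveVec (formMatrix L (algebraMap k (FreeAway c L τ))
    ((freePair c L τ).A.map (algebraMap _ _))) τ
      ((freePair c L τ).map (algebraMap (FreeRing c L τ) (FreeAway c L τ))).vec (j, s)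

lemma algebraMap_freeAway_comp_C : (algebraMap (FreeRing c L τ) (FreeAway c L τ)).comp
    MvPolynomial.C = algebraMap k (FreeAway c L τ) :=
  (IsScalarTower.algebraMap_eq k (FreeRing c L τ) (FreeAway c L τ)).symm

lemma isUnit_formMinor_solvedPair :
    IsUnit (formMinor L τ (algebraMap k (FreeAway c L τ)) (solvedPair c L τ).A) := by
  have : formMinor L τ (algebraMap k (FreeAway c L τ)) (solvedPair c L τ).A =
      algebraMap (FreeRing c L τ) (FreeAway c L τ) (freeMinor c L τ) := by
    refine Eq.trans ?_ (map_formMinor L τ MvPolynomial.C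
      (algebraMap (FreeRing c L τ) (FreeAway c L τ)) _).symm
    rw [algebraMap_freeAway_comp_C]; rfl
  rw [this]
  exact IsLocalization.Away.algebraMap_isUnit _

lemma solvedPair_satisfies : (solvedPair c L τ).Satisfies (algebraMap k _) L := by
  rw [satisfies_iff]
  exact mulVec_solveVec _ _ _ (isUnit_formMinor_solvedPair c L τ)

lemma solvedPair_B {q : Fin n × Fin r} (h : ∀ i, τ i ≠ q) :
    (solvedPair c L τ).B q.1 q.2 =
      algebraMap (FreeRing c L τ) (FreeAway c L τ) ((freePair c L τ).B q.1 q.2) :=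
  solveVec_of_notMem _ _ _ h

/-- The column of the normalized entry has to stay outside `τ`: that entry is fixed to be `1`, so it
is not an unknown of the system. -/
lemma solvedPair_isNormalized (hτ : ∀ i, τ i ≠ (c.j, c.s)) : (solvedPair c L τ).IsNormalized c := by
  have h := freePair_isNormalized c L τ
  refine ⟨(h.map (algebraMap (FreeRing c L τ) (FreeAway c L τ))).block_eq, ?_⟩
  have h2 := solvedPair_B c L τ hτ
  rwa [h.entry_eq, map_one] at h2

/-- The homomorphism from the coordinate ring of the section that eliminates the variables in `τ`. -/
def solveHom (hτ : ∀ i, τ i ≠ (c.j, c.s)) : SectionRing c L →+* FreeAway c L τ :=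
  sectionEval c L _ (solvedPair c L τ) (solvedPair_isNormalized c L τ hτ)
    (solvedPair_satisfies c L τ)

lemma solveHom_comp_freeInclusion (hτ : ∀ i, τ i ≠ (c.j, c.s)) :
    ((solveHom c L τ hτ).comp (toSectionRing c L)).comp (freeInclusion c L τ) =
      algebraMap (FreeRing c L τ) (FreeAway c L τ) := by
  have hC : ((solveHom c L τ hτ).comp (toSectionRing c L)).comp MvPolynomial.C =
      algebraMap k (FreeAway c L τ) :=
    sectionEval_comp_algebraMap c L _ _ (solvedPair_isNormalized c L τ hτ) (solvedPair_satisfies c L τ)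
  have hP : (generic k c).map ((solveHom c L τ hτ).comp (toSectionRing c L)) =
      solvedPair c L τ :=
    map_sectionEval c L _ _ (solvedPair_isNormalized c L τ hτ) (solvedPair_satisfies c L τ)
  apply MvPolynomial.ringHom_ext
  · intro a
    have := congr($hC a)
    rw [← freeInclusion_comp_C c L τ, ← algebraMap_freeAway_comp_C] at this
    exact this
  · rintro ⟨v, hv⟩
    rw [RingHom.comp_apply, freeInclusion_X]
    obtain ⟨t, l, hl, rfl⟩ | ⟨q, hq, rfl⟩ := chartVar_cases c v
    · have h1 := congr(FactorPair.A $hP t l)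
      rw [FactorPair.map_A_apply, generic_A_of_notMem c hl] at h1
      refine h1.trans ?_
      change algebraMap (FreeRing c L τ) (FreeAway c L τ) ((freePair c L τ).A t l) = _
      rw [freePair_A c L τ hl]
    · have h1 := congr(FactorPair.B $hP q.1 q.2)
      rw [solvedPair_B c L τ ((isFreeVar_chartVarB_iff c L τ hq).mp hv), freePair_B c L τ hq hv,
        FactorPair.map_B_apply, generic_B_of_ne c hq] at h1
      exact h1

lemma solveHom_chartMinor (hτ : ∀ i, τ i ≠ (c.j, c.s)) :
    IsUnit (solveHom c L τ hτ (toSectionRing c L (chartMinor c L τ))) := by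
  rw [← freeInclusion_freeMinor]
  have := congr($(solveHom_comp_freeInclusion c L τ hτ) (freeMinor c L τ))
  refine this ▸ IsLocalization.Away.algebraMap_isUnit _

/-- The inverse homomorphism. -/
def unsolveHom : FreeAway c L τ →+* SectionAway c L τ :=
  IsLocalization.Away.lift (freeMinor c L τ)
    (g := (algebraMap (SectionRing c L) (SectionAway c L τ)).comp
      ((toSectionRing c L).comp (freeInclusion c L τ))) (by
    rw [RingHom.comp_apply, RingHom.comp_apply, freeInclusion_freeMinor]
    exact IsLocalization.Away.algebraMap_isUnit _)

lemma unsolveHom_comp_algebraMap : (unsolveHom c L τ).comp (algebraMap (FreeRing c L τ) _) =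
    (algebraMap (SectionRing c L) (SectionAway c L τ)).comp
      ((toSectionRing c L).comp (freeInclusion c L τ)) :=
  IsLocalization.Away.lift_comp _ _

lemma unsolveHom_comp_algebraMap_base : (unsolveHom c L τ).comp (algebraMap k _) =
    (algebraMap (SectionRing c L) (SectionAway c L τ)).comp (algebraMap k _) := by
  rw [← algebraMap_freeAway_comp_C, ← RingHom.comp_assoc, unsolveHom_comp_algebraMap,
    RingHom.comp_assoc, RingHom.comp_assoc, freeInclusion_comp_C]
  rfl

/-- The solved pair and the universal pair of the section become equal: they have the same `A`, both
satisfy the linear system, and they agree outside `τ`, so uniqueness of the solution applies. -/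
lemma unsolveHom_comp_solveHom (hτ : ∀ i, τ i ≠ (c.j, c.s)) :
    (unsolveHom c L τ).comp (solveHom c L τ hτ) =
    algebraMap (SectionRing c L) (SectionAway c L τ) := by
  have hA : ((solvedPair c L τ).map (unsolveHom c L τ)).A =
      ((sectionPair c L).map (algebraMap (SectionRing c L) (SectionAway c L τ))).A := by
    have : ((solvedPair c L τ).map (unsolveHom c L τ)).A =
      (freePair c L τ).A.map ((unsolveHom c L τ).comp (algebraMap (FreeRing c L τ) _)) := rfl
    rw [this, unsolveHom_comp_algebraMap, ← RingHom.comp_assoc]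
    have h2 := freePair_A_map c L τ
    change ((freePair c L τ).A.map (freeInclusion c L τ)).map
      ((algebraMap (SectionRing c L) (SectionAway c L τ)).comp (toSectionRing c L)) = _
    rw [h2]
    rfl
  have hs1 := (solvedPair_satisfies c L τ).map (unsolveHom c L τ)
  have hs2 := (sectionPair_satisfies c L).map (algebraMap (SectionRing c L) (SectionAway c L τ))
  rw [unsolveHom_comp_algebraMap_base] at hs1
  rw [satisfies_iff] at hs1 hs2
  rw [hA] at hs1
  have hu : IsUnit (formMinor L τ ((algebraMap (SectionRing c L) (SectionAway c L τ)).comp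
      (algebraMap k _)) ((sectionPair c L).map
        (algebraMap (SectionRing c L) (SectionAway c L τ))).A) := by
    have h := (isUnit_formMinor_solvedPair c L τ).map (unsolveHom c L τ)
    rw [map_formMinor, unsolveHom_comp_algebraMap_base] at h
    rw [← hA]
    exact h
  have hB := eq_of_mulVec_eq_zero hu hs1 hs2 fun q hq => by
    have h1 : ((solvedPair c L τ).map (unsolveHom c L τ)).vec q =
        unsolveHom c L τ ((solvedPair c L τ).B q.1 q.2) := rfl
    rw [h1, solvedPair_B c L τ hq, ← RingHom.comp_apply, unsolveHom_comp_algebraMap,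
      RingHom.comp_apply, RingHom.comp_apply, freePair_B_map c L τ hq]
    rfl
  apply sectionHom_ext
  · rw [RingHom.comp_assoc, solveHom, sectionEval_comp_algebraMap, unsolveHom_comp_algebraMap_base]
  · rw [← FactorPair.map_map, solveHom, map_sectionEval]
    refine FactorPair.ext hA ?_
    ext j s
    exact congr($hB (j, s))

/-- Where the minor `τ` is invertible, the section is an open subset of affine space. -/
def sectionAwayEquiv (hτ : ∀ i, τ i ≠ (c.j, c.s)) : FreeAway c L τ ≃+* SectionAway c L τ :=
  RingEquiv.ofRingHom (unsolveHom c L τ)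
    (IsLocalization.Away.lift _ (solveHom_chartMinor c L τ hτ))
    (by
      apply IsLocalization.ringHom_ext (Submonoid.powers (toSectionRing c L (chartMinor c L τ)))
      rw [RingHom.comp_assoc, IsLocalization.Away.lift_comp, unsolveHom_comp_solveHom,
        RingHom.id_comp])
    (by
      apply IsLocalization.ringHom_ext (Submonoid.powers (freeMinor c L τ))
      rw [RingHom.comp_assoc, unsolveHom_comp_algebraMap, ← RingHom.comp_assoc,
        IsLocalization.Away.lift_comp, ← RingHom.comp_assoc, solveHom_comp_freeInclusion,
        RingHom.id_comp])

end RationalChart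

/-! ### A point over the generic matrix that is common to two pieces. -/

section CommonPoint

variable {m n r : ℕ} {k : Type u} [Field k] (L : Submodule k (Fin n × Fin m → k))

/-- The ring of polynomials in the entries of an `r × m` matrix. -/
abbrev EntryRing (k : Type u) [CommRing k] (m r : ℕ) : Type u := MvPolynomial (Fin r × Fin m) k

/-- The field of rational functions in the entries of an `r × m` matrix. -/
abbrev EntryField (k : Type u) [Field k] (m r : ℕ) : Type u := FractionRing (EntryRing k m r)

/-- The `r × m` matrix of variables. -/
def entryMatrix (k : Type u) [Field k] (m r : ℕ) : Matrix (Fin r) (Fin m) (EntryRing k m r) :=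
  .of fun s l => MvPolynomial.X (s, l)

/-- The `r × m` matrix of variables, over the field of rational functions. -/
def fieldMatrix (k : Type u) [Field k] (m r : ℕ) : Matrix (Fin r) (Fin m) (EntryField k m r) :=
  (entryMatrix k m r).map (algebraMap (EntryRing k m r) (EntryField k m r))

/-- The scalars of the field of rational functions. -/
abbrev fieldScalars (k : Type u) [Field k] (m r : ℕ) : k →+* EntryField k m r :=
  (algebraMap (EntryRing k m r) (EntryField k m r)).comp MvPolynomial.C

/-- Specialization of the matrix of variables to the one of a chart. -/
def specialize (c : ChartIndex m n r) : EntryRing k m r →+* ChartRing k c :=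
  MvPolynomial.eval₂Hom MvPolynomial.C fun p => (generic k c).A p.1 p.2

lemma specialize_comp_C (c : ChartIndex m n r) :
    (specialize (k := k) c).comp MvPolynomial.C = MvPolynomial.C := by
  ext1 a
  exact MvPolynomial.eval₂Hom_C _ _ _

lemma entryMatrix_map (c : ChartIndex m n r) :
    (entryMatrix k m r).map (specialize c) = (generic k c).A := by
  ext1 s l
  exact MvPolynomial.eval₂Hom_X' _ _ _

lemma entryMatrix_submatrix_map (c : ChartIndex m n r) :
    ((entryMatrix k m r).submatrix id c.I).map (specialize c) = 1 := by
  have : ((entryMatrix k m r).submatrix id c.I).map (specialize c) =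
    ((entryMatrix k m r).map (specialize c)).submatrix id c.I := rfl
  rw [this, entryMatrix_map]
  exact (generic_isNormalized k c).block_eq

lemma isUnit_det_fieldMatrix_submatrix (c : ChartIndex m n r) :
    IsUnit ((fieldMatrix k m r).submatrix id c.I).det := by
  have h : ((entryMatrix k m r).submatrix id c.I).det ≠ 0 := by
    intro h0
    have := congrArg (specialize (k := k) c) h0
    rw [RingHom.map_det, map_zero] at this
    have h1 := entryMatrix_submatrix_map (k := k) c
    rw [RingHom.mapMatrix_apply, h1, Matrix.det_one] at this
    exact one_ne_zero this
  have h2 : ((fieldMatrix k m r).submatrix id c.I).det =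
      algebraMap _ _ ((entryMatrix k m r).submatrix id c.I).det := by
    rw [RingHom.map_det]; rfl
  rw [h2, isUnit_iff_ne_zero, Ne, FaithfulSMul.algebraMap_eq_zero_iff]
  exact h

/-- The matrix of variables, brought to the normal form of `c`, specializes to the universal matrix
of that chart. So a non-zero minor on the chart forces a non-zero minor here. -/
lemma formMinor_fieldMatrix_ne_zero (c : ChartIndex m n r)
    (τ : Fin (Module.finrank k L) ↪ Fin n × Fin r) (h : chartMinor c L τ ≠ 0) :
    formMinor L τ (fieldScalars k m r)
      (((fieldMatrix k m r).submatrix id c.I)⁻¹ * fieldMatrix k m r) ≠ 0 := by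
  set B := (entryMatrix k m r).submatrix id c.I with hB
  -- Specialization is defined on polynomials only, so the inverse of the block is replaced by its
  -- adjugate. This rescales the minor by a power of the determinant, which is a unit in the field.
  have h1 : formMinor L τ MvPolynomial.C (B.adjugate * entryMatrix k m r) ≠ 0 := by
    intro h0
    have h2 := congrArg (specialize (k := k) c) h0
    rw [map_formMinor, map_zero, specialize_comp_C, Matrix.map_mul, entryMatrix_map] at h2
    have h3 : B.adjugate.map (specialize (k := k) c) = 1 := by
      rw [← RingHom.mapMatrix_apply, RingHom.map_adjugate, RingHom.mapMatrix_apply,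
        entryMatrix_submatrix_map, Matrix.adjugate_one]
    rw [h3, Matrix.one_mul] at h2
    exact h h2
  have h4 : algebraMap (EntryRing k m r) (EntryField k m r)
      (formMinor L τ MvPolynomial.C (B.adjugate * entryMatrix k m r)) ≠ 0 := by
    rwa [Ne, FaithfulSMul.algebraMap_eq_zero_iff]
  rw [map_formMinor, Matrix.map_mul] at h4
  have h5 : B.adjugate.map (algebraMap (EntryRing k m r) (EntryField k m r)) =
      ((fieldMatrix k m r).submatrix id c.I).det • ((fieldMatrix k m r).submatrix id c.I)⁻¹ := by
    rw [← RingHom.mapMatrix_apply, RingHom.map_adjugate, Matrix.inv_def, smul_smul,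
      Ring.mul_inverse_cancel _ (isUnit_det_fieldMatrix_submatrix c), one_smul]
    rfl
  have h6 : (entryMatrix k m r).map (algebraMap (EntryRing k m r) (EntryField k m r)) =
    fieldMatrix k m r := rfl
  rw [h5, h6, Matrix.smul_mul, formMinor_smul] at h4
  exact right_ne_zero_of_mul h4

lemma pairing_add {S : Type*} [CommRing S] (κ : k →+* S) (A : Matrix (Fin r) (Fin m) S)
    (B B' : Matrix (Fin n) (Fin r) S) (l : Fin n × Fin m → k) :
    FactorPair.pairing κ ⟨A, B + B'⟩ l =
      FactorPair.pairing κ ⟨A, B⟩ l + FactorPair.pairing κ ⟨A, B'⟩ l := by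
  simp [FactorPair.pairing, FactorPair.coords, FactorPair.product, Matrix.add_mul, mul_add,
    Finset.sum_add_distrib]

/-- In the frame of the chart `c` the system is solved with the entry at `(c.j, c.s)` equal to `1`
and the other free entries `0`. Undoing the change of frame returns to the matrix of variables, with
that entry as pivot. -/
lemma exists_pivot_ne_zero (c : ChartIndex m n r) (τ : Fin (Module.finrank k L) ↪ Fin n × Fin r)
    (hτ : ∀ i, τ i ≠ (c.j, c.s)) (h : chartMinor c L τ ≠ 0) :
    ∃ B : Matrix (Fin n) (Fin r) (EntryField k m r),
      FactorPair.Satisfies (fieldScalars k m r) ⟨fieldMatrix k m r, B⟩ L ∧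
      FactorPair.pivot c ⟨fieldMatrix k m r, B⟩ ≠ 0 := by
  classical
  set A := fieldMatrix k m r
  set G := A.submatrix id c.I
  have hG : IsUnit G.det := isUnit_det_fieldMatrix_submatrix c
  have hu := (formMinor_fieldMatrix_ne_zero L c τ h).isUnit
  let b := solveVec (formMatrix L (fieldScalars k m r) (G⁻¹ * A)) τ (Pi.single (c.j, c.s) 1)
  let P' : FactorPair m n r (EntryField k m r) := ⟨G⁻¹ * A, .of fun j s => b (j, s)⟩
  have hP' : P'.Satisfies (fieldScalars k m r) L := by
    rw [satisfies_iff]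
    exact mulVec_solveVec _ _ _ hu
  have hb : b (c.j, c.s) = 1 := by
    exact (solveVec_of_notMem _ _ _ hτ).trans (Pi.single_eq_same _ _)
  refine ⟨P'.B * G⁻¹, fun l hl => ?_, ?_⟩
  · rw [← hP' l hl]
    simp only [FactorPair.pairing, FactorPair.coords, FactorPair.product, P', Matrix.mul_assoc]
  · have h1 : FactorPair.pivot c ⟨A, P'.B * G⁻¹⟩ = P'.B c.j c.s := by
      change ((P'.B * G⁻¹) * G) c.j c.s = _
      rw [Matrix.mul_assoc, Matrix.nonsing_inv_mul _ hG, Matrix.mul_one]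
    rw [h1]
    change b (c.j, c.s) ≠ 0
    rw [hb]
    exact one_ne_zero

/-- For the fixed matrix of variables the solutions `B` form a vector space, which is not the union
of the two proper subspaces where a pivot vanishes: one of `B`, `B'`, `B + B'` works. -/
lemma exists_common_pair (c d : ChartIndex m n r) (τ σ : Fin (Module.finrank k L) ↪ Fin n × Fin r)
    (hτ : ∀ i, τ i ≠ (c.j, c.s)) (hσ : ∀ i, σ i ≠ (d.j, d.s)) (hc : chartMinor c L τ ≠ 0)
    (hd : chartMinor d L σ ≠ 0) :
    ∃ P : FactorPair m n r (EntryField k m r), P.A = fieldMatrix k m r ∧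
      P.Satisfies (fieldScalars k m r) L ∧ IsUnit (P.locus c) ∧ IsUnit (P.locus d) := by
  obtain ⟨B, hB, hBc⟩ := exists_pivot_ne_zero L c τ hτ hc
  obtain ⟨B', hB', hBd⟩ := exists_pivot_ne_zero L d σ hσ hd
  have key : ∀ B'' : Matrix (Fin n) (Fin r) (EntryField k m r),
      FactorPair.Satisfies (fieldScalars k m r) ⟨fieldMatrix k m r, B''⟩ L →
      FactorPair.pivot c ⟨fieldMatrix k m r, B''⟩ ≠ 0 →
      FactorPair.pivot d ⟨fieldMatrix k m r, B''⟩ ≠ 0 →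
      ∃ P : FactorPair m n r (EntryField k m r), P.A = fieldMatrix k m r ∧
        P.Satisfies (fieldScalars k m r) L ∧ IsUnit (P.locus c) ∧ IsUnit (P.locus d) :=
    fun B'' h1 h2 h3 => ⟨_, rfl, h1, (isUnit_det_fieldMatrix_submatrix c).mul h2.isUnit,
      (isUnit_det_fieldMatrix_submatrix d).mul h3.isUnit⟩
  by_cases h1 : FactorPair.pivot d ⟨fieldMatrix k m r, B⟩ = 0
  · by_cases h2 : FactorPair.pivot c ⟨fieldMatrix k m r, B'⟩ = 0
    · have hadd : ∀ e : ChartIndex m n r, FactorPair.pivot e ⟨fieldMatrix k m r, B + B'⟩ =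
          FactorPair.pivot e ⟨fieldMatrix k m r, B⟩ + FactorPair.pivot e ⟨fieldMatrix k m r, B'⟩ :=
        fun e => by simp [FactorPair.pivot, FactorPair.block, Matrix.add_mul]
      refine key (B + B') (fun l hl => ?_) ?_ ?_
      · rw [pairing_add, hB l hl, hB' l hl, add_zero]
      · rwa [hadd, h2, add_zero]
      · rwa [hadd, h1, zero_add]
    · exact key B' hB' h2 hBd
  · exact key B hB hBc h1

end CommonPoint

/-! ### Density of the pieces, and rationality. -/

section Rationality

variable {m n r : ℕ} {k : Type u} [Field k] (L : Submodule k (Fin n × Fin m → k))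

/-- The open subscheme of `X_L` over the chart `c` where the minor `τ` is invertible. -/
def sectionAwayι (c : ChartIndex m n r) (τ : Fin (Module.finrank k L) ↪ Fin n × Fin r) :
    Spec (CommRingCat.of (SectionAway c L τ)) ⟶ sectionX r L :=
  Spec.map (CommRingCat.ofHom (algebraMap (SectionRing c L) (SectionAway c L τ))) ≫
    sectionChart c L

instance (c : ChartIndex m n r) (τ : Fin (Module.finrank k L) ↪ Fin n × Fin r) :
    IsOpenImmersion (sectionAwayι L c τ) :=
  have : IsOpenImmersion
      (Spec.map (CommRingCat.ofHom (algebraMap (SectionRing c L) (SectionAway c L τ)))) :=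
    IsOpenImmersion.of_isLocalization (toSectionRing c L (chartMinor c L τ))
  inferInstanceAs (IsOpenImmersion (_ ≫ _))

lemma sectionChart_mem_range (c : ChartIndex m n r)
    (τ : Fin (Module.finrank k L) ↪ Fin n × Fin r) (y : PrimeSpectrum (SectionRing c L))
    (hy : toSectionRing c L (chartMinor c L τ) ∉ y.asIdeal) :
    sectionChart c L y ∈ Set.range (sectionAwayι L c τ) := by
  have h : y ∈ Set.range (PrimeSpectrum.comap
      (algebraMap (SectionRing c L) (SectionAway c L τ))) := by
    rw [PrimeSpectrum.localization_away_comap_range _ (toSectionRing c L (chartMinor c L τ))]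
    exact hy
  obtain ⟨z, rfl⟩ := h
  exact ⟨z, rfl⟩

/-- The common pair defines the same point through either chart, and its minor is non-zero in both
normal forms. -/
lemma range_sectionAwayι_inter_nonempty (c d : ChartIndex m n r)
    (τ σ : Fin (Module.finrank k L) ↪ Fin n × Fin r)
    (hτ : ∀ i, τ i ≠ (c.j, c.s)) (hσ : ∀ i, σ i ≠ (d.j, d.s)) (hc : chartMinor c L τ ≠ 0)
    (hd : chartMinor d L σ ≠ 0) :
    (Set.range (sectionAwayι L c τ) ∩ Set.range (sectionAwayι L d σ)).Nonempty := by
  obtain ⟨P, hA, hP, hPc, hPd⟩ := exists_common_pair L c d τ σ hτ hσ hc hd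
  let x : Spec (CommRingCat.of (EntryField k m r)) := (⊥ : PrimeSpectrum (EntryField k m r))
  have key : ∀ (e : ChartIndex m n r) (ρ : Fin (Module.finrank k L) ↪ Fin n × Fin r)
      (he : chartMinor e L ρ ≠ 0) (hPe : IsUnit (P.locus e)),
      sectionChart e L (Spec.map (CommRingCat.ofHom (sectionEval e L (fieldScalars k m r)
        (P.normalize e) (FactorPair.normalize_isNormalized hPe) (hP.normalize hPe))) x) ∈
      Set.range (sectionAwayι L e ρ) := by
    intro e ρ he hPe
    apply sectionChart_mem_range
    change sectionEval e L (fieldScalars k m r) (P.normalize e)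
      (FactorPair.normalize_isNormalized hPe) (hP.normalize hPe) _ ∉ (⊥ : Ideal (EntryField k m r))
    rw [Ideal.mem_bot, ← RingHom.comp_apply, sectionEval_comp, chartMinor, map_formMinor,
      evalPair_comp_C]
    have h1 := congrArg FactorPair.A
      (map_evalPair (fieldScalars k m r) (FactorPair.normalize_isNormalized hPe))
    have h2 : (generic k e).A.map (evalPair e (fieldScalars k m r) (P.normalize e)) =
      (P.normalize e).A := h1
    rw [h2]
    have h3 := formMinor_fieldMatrix_ne_zero L e ρ he
    rw [← hA] at h3
    exact h3
  refine ⟨_, key c τ hc hPc, ?_⟩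
  rw [sectionChart_normalize L (fieldScalars k m r) P d hPc hPd hP x]
  exact key d σ hd hPd

lemma isDomain_freeAway (c : ChartIndex m n r) (τ : Fin (Module.finrank k L) ↪ Fin n × Fin r)
    (h : chartMinor c L τ ≠ 0) : IsDomain (FreeAway c L τ) :=
  IsLocalization.isDomain_localization
    (powers_le_nonZeroDivisors_of_noZeroDivisors (freeMinor_ne_zero c L τ h))

lemma isDomain_sectionAway (c : ChartIndex m n r) (τ : Fin (Module.finrank k L) ↪ Fin n × Fin r)
    (hτ : ∀ i, τ i ≠ (c.j, c.s)) (h : chartMinor c L τ ≠ 0) : IsDomain (SectionAway c L τ) :=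
  have := isDomain_freeAway L c τ h
  (sectionAwayEquiv c L τ hτ).symm.toMulEquiv.isDomain _

/-- Every component of `X_L` contains a point where a maximal minor is invertible. -/
def HasMinors (r : ℕ) (L : Submodule k (Fin n × Fin m → k)) : Prop :=
  ∀ (c : ChartIndex m n r), ∀ P ∈ (chartIdeal c L).minimalPrimes,
    ∃ τ : Fin (Module.finrank k L) ↪ Fin n × Fin r,
      (∀ i, τ i ≠ (c.j, c.s)) ∧ chartMinor c L τ ∉ P

variable {L} in
-- The point `y` is the generic point of a component through `x` of the section over a chart: it
-- comes from a minimal prime over the chart ideal that is contained in the prime of `x`.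
lemma exists_specializes_mem_range (H : HasMinors r L) (x : sectionX r L) :
    ∃ (y : sectionX r L) (c : ChartIndex m n r) (τ : Fin (Module.finrank k L) ↪ Fin n × Fin r),
      y ⤳ x ∧ (∀ i, τ i ≠ (c.j, c.s)) ∧ chartMinor c L τ ≠ 0 ∧
        y ∈ Set.range (sectionAwayι L c τ) := by
  obtain ⟨c, q, rfl⟩ := sectionChart_jointly_surjective L x
  let q' : PrimeSpectrum (SectionRing c L) := q
  have hq : chartIdeal c L ≤ q'.asIdeal.comap (toSectionRing c L) := by
    intro a ha
    rw [Ideal.mem_comap, Ideal.Quotient.eq_zero_iff_mem.mpr ha]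
    exact zero_mem _
  obtain ⟨P, hP, hPq⟩ := Ideal.exists_minimalPrimes_le hq
  obtain ⟨τ, hτ, hτP⟩ := H c P hP
  have hPp : P.IsPrime := hP.1.1
  have hker : RingHom.ker (toSectionRing c L) ≤ P := by rw [Ideal.mk_ker]; exact hP.1.2
  have hcomap : (P.map (toSectionRing c L)).comap (toSectionRing c L) = P := by
    rw [Ideal.comap_map_of_surjective' _ Ideal.Quotient.mk_surjective]
    exact sup_eq_left.mpr hker
  let y : PrimeSpectrum (SectionRing c L) := ⟨P.map (toSectionRing c L),
    Ideal.map_isPrime_of_surjective Ideal.Quotient.mk_surjective hker⟩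
  refine ⟨sectionChart c L y, c, τ, ?_, hτ, ?_, ?_⟩
  · have hyq : y ⤳ q' := by
      rw [← PrimeSpectrum.le_iff_specializes]
      change P.map (toSectionRing c L) ≤ q'.asIdeal
      rw [Ideal.map_le_iff_le_comap]
      exact hPq
    exact hyq.map (sectionChart c L).continuous
  · rintro h0
    exact hτP (h0 ▸ zero_mem P)
  · apply sectionChart_mem_range
    rwa [← Ideal.mem_comap, hcomap]

/-- Each point is a specialization of a point `y` of some piece. That piece is irreducible and meets
the given open piece, which is therefore dense in it, so `y` and all its specializations lie in the
closure. -/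
lemma dense_range_sectionAwayι (H : HasMinors r L) (d : ChartIndex m n r)
    (σ : Fin (Module.finrank k L) ↪ Fin n × Fin r) (hσ : ∀ i, σ i ≠ (d.j, d.s))
    (hd : chartMinor d L σ ≠ 0) : DenseRange (sectionAwayι L d σ) := by
  intro x
  obtain ⟨y, c, τ, hyx, hτ, hc, hy⟩ := exists_specializes_mem_range H x
  refine hyx.mem_closed isClosed_closure ?_
  have := isDomain_sectionAway L c τ hτ hc
  have hirr : IsPreirreducible (Set.range (sectionAwayι L c τ)) := by
    rw [← Set.image_univ]
    refine IsPreirreducible.image ?_ _ (sectionAwayι L c τ).continuous.continuousOn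
    exact (PreirreducibleSpace.isPreirreducible_univ (X := PrimeSpectrum (SectionAway c L τ)))
  rw [mem_closure_iff]
  intro O hO hyO
  obtain ⟨z, -, hz1, hz2⟩ := hirr O _ hO (sectionAwayι L d σ).isOpenEmbedding.isOpen_range
    ⟨y, hy, hyO⟩ (range_sectionAwayι_inter_nonempty L c d τ σ hτ hσ hc hd)
  exact ⟨z, hz1, hz2⟩

lemma unsolveHom_eq (c : ChartIndex m n r) (τ : Fin (Module.finrank k L) ↪ Fin n × Fin r)
    (hτ : ∀ i, τ i ≠ (c.j, c.s)) :
    ((sectionAwayEquiv c L τ hτ : FreeAway c L τ →+* SectionAway c L τ)).comp (algebraMap k _) =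
      (algebraMap (SectionRing c L) (SectionAway c L τ)).comp (algebraMap k _) :=
  unsolveHom_comp_algebraMap_base c L τ

theorem isRational_of_hasMinors (H : HasMinors r L) (hne : Nonempty (sectionX r L)) :
    IsRational (sectionXStructure r L) := by
  obtain ⟨x⟩ := hne
  obtain ⟨-, c, τ, -, hτ, hc, -⟩ := exists_specializes_mem_range H x
  have hdom : IsDominant (sectionAwayι L c τ) := ⟨dense_range_sectionAwayι L H c τ hτ hc⟩
  have : Finite (ChartVar c) := inferInstanceAs (Finite (_ ⊕ _))
  let e : ULift.{u} (Fin (Nat.card (FreeVar c L τ))) ≃ FreeVar c L τ :=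
    Equiv.ulift.trans (Finite.equivFin _).symm
  refine ⟨Nat.card (FreeVar c L τ), ?_⟩
  have h1 := (sectionAwayι L c τ).birationalOver (sectionXStructure r L) _ rfl
  refine h1.symm.trans ?_
  have hiso : IsIso (CommRingCat.ofHom
      (sectionAwayEquiv c L τ hτ : FreeAway c L τ →+* SectionAway c L τ)) :=
    (ConcreteCategory.isIso_iff_bijective _).mpr (sectionAwayEquiv c L τ hτ).bijective
  have hiso' : IsIso (CommRingCat.ofHom
      (MvPolynomial.renameEquiv k e : MvPolynomial (ULift.{u} (Fin (Nat.card (FreeVar c L τ)))) k →+*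
        FreeRing c L τ)) :=
    (ConcreteCategory.isIso_iff_bijective _).mpr (MvPolynomial.renameEquiv k e).bijective
  have hopen : IsOpenImmersion
      (Spec.map (CommRingCat.ofHom (algebraMap (FreeRing c L τ) (FreeAway c L τ)))) :=
    IsOpenImmersion.of_isLocalization (freeMinor c L τ)
  let g : Spec (CommRingCat.of (SectionAway c L τ)) ⟶
      𝔸(ULift.{u} (Fin (Nat.card (FreeVar c L τ))); Spec (CommRingCat.of k)) :=
    Spec.map (CommRingCat.ofHom
      (sectionAwayEquiv c L τ hτ : FreeAway c L τ →+* SectionAway c L τ)) ≫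
    Spec.map (CommRingCat.ofHom (algebraMap (FreeRing c L τ) (FreeAway c L τ))) ≫
    Spec.map (CommRingCat.ofHom
      (MvPolynomial.renameEquiv k e : MvPolynomial (ULift.{u} (Fin (Nat.card (FreeVar c L τ)))) k →+*
        FreeRing c L τ)) ≫
    (AffineSpace.SpecIso _ (CommRingCat.of k)).inv
  have hg : IsOpenImmersion g := inferInstanceAs (IsOpenImmersion (_ ≫ _ ≫ _ ≫ _))
  have := isDomain_sectionAway L c τ hτ hc
  have hgd : IsDominant g := by
    -- Affine space is irreducible, so a non-empty open subset is dense.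
    refine ⟨IsOpen.dense hg.base_open.isOpen_range ?_⟩
    exact ⟨_, (⊥ : PrimeSpectrum (SectionAway c L τ)), rfl⟩
  refine g.birationalOver _ _ ?_
  have hover := AffineSpace.SpecIso_inv_over
    (n := ULift.{u} (Fin (Nat.card (FreeVar c L τ)))) (CommRingCat.of k)
  simp only [g, Category.assoc]
  rw [hover]
  rw [sectionAwayι, Category.assoc, sectionChart_structure, ← Spec.map_comp, ← Spec.map_comp,
    ← Spec.map_comp, ← Spec.map_comp]
  congr 1
  apply CommRingCat.hom_ext
  simp only [← CommRingCat.ofHom_comp, CommRingCat.hom_ofHom]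
  rw [← unsolveHom_eq L c τ hτ]
  ext a
  have h5 : algebraMap k (FreeAway c L τ) a = algebraMap (FreeRing c L τ) _ (MvPolynomial.C a) :=
    IsScalarTower.algebraMap_apply k (FreeRing c L τ) (FreeAway c L τ) a
  simp [h5]

end Rationality

/-! ### Maximal minors and row relations of a matrix over a field. -/

section LinearAlgebra

variable {F : Type*} [Field F] {ι : Type*} [Fintype ι] {c : ℕ}

/-- If the rows of `M` are independent and a solution of `M b = 0` does not vanish at `p`, then `M`
has a non-zero maximal minor that avoids the column `p`. -/
lemma exists_minor_ne_zero (M : Matrix (Fin c) ι F) (b : ι → F) (p : ι) (hp : b p = 1)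
    (hb : M.mulVec b = 0) (h : ∀ y, Matrix.vecMul y M = 0 → y = 0) :
    ∃ τ : Fin c ↪ ι, (∀ i, τ i ≠ p) ∧ (M.submatrix id τ).det ≠ 0 := by
  classical
  let v : {q // q ≠ p} → Fin c → F := fun q => M.col q.1
  -- The equation `M b = 0` with `b p = 1` expresses the column `p` through the others. So a
  -- functional that kills the other columns kills all columns, and is zero by independence of the
  -- rows.
  have hspan : Submodule.span F (Set.range v) = ⊤ := by
    by_contra hne
    obtain ⟨f, hf, hf0⟩ := Submodule.exists_dual_map_eq_bot_of_lt_top (lt_top_iff_ne_top.mpr hne)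
      inferInstance
    let y : Fin c → F := fun i => f (Pi.single i 1)
    have hfy : ∀ x : Fin c → F, f x = y ⬝ᵥ x := fun x => by
      conv_lhs => rw [← Finset.univ_sum_single x]
      simp only [map_sum, dotProduct, y]
      refine Finset.sum_congr rfl fun i _ => ?_
      have : (Pi.single i (x i) : Fin c → F) = x i • Pi.single i 1 := by
        rw [← Pi.single_smul]; simp
      rw [this, map_smul, smul_eq_mul, mul_comm]
    have h1 : ∀ q, q ≠ p → Matrix.vecMul y M q = 0 := fun q hq => by
      have : f (v ⟨q, hq⟩) ∈ (Submodule.span F (Set.range v)).map f :=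
        Submodule.mem_map_of_mem (Submodule.subset_span ⟨_, rfl⟩)
      rw [hf0, Submodule.mem_bot, hfy] at this
      exact this
    have h2 : Matrix.vecMul y M p = 0 := by
      have h3 : Matrix.vecMul y M ⬝ᵥ b = 0 := by
        rw [← Matrix.dotProduct_mulVec, hb, dotProduct_zero]
      rw [dotProduct, Finset.sum_eq_single p (fun q _ hq => by rw [h1 q hq, zero_mul])
        (fun h => absurd (Finset.mem_univ p) h), hp, mul_one] at h3
      exact h3
    have h4 : y = 0 := h y (funext fun q => by
      by_cases hq : q = p
      · rw [hq]; exact h2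
      · exact h1 q hq)
    exact hf (LinearMap.ext fun x => by rw [hfy, h4, zero_dotProduct]; rfl)
  obtain ⟨κ, a, ha, hsp, hli⟩ := exists_linearIndependent' F v
  let B := Module.Basis.mk hli (by rw [hsp, hspan])
  have : Finite κ := Module.Finite.finite_basis B
  let e : Fin c ≃ κ := (Finite.equivFinOfCardEq (by
    rw [← Module.finrank_eq_nat_card_basis B, Module.finrank_fin_fun])).symm
  refine ⟨e.toEmbedding.trans (⟨a, ha⟩ : κ ↪ _) |>.trans (Function.Embedding.subtype _),
    fun i => (a (e i)).2, ?_⟩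
  have h1 : LinearIndependent F (M.submatrix id fun i => (a (e i)).1).col :=
    hli.comp e e.injective
  exact ((Matrix.isUnit_iff_isUnit_det _).mp
    (Matrix.linearIndependent_cols_iff_isUnit.mp h1)).ne_zero

/-- The solution `b` of `M b = 0` may lie over an extension `K` of `F`. -/
lemma exists_minor_ne_zero_of_extension {K : Type*} [Field K] [Algebra F K]
    (M : Matrix (Fin c) ι F) (b : ι → K) (p : ι) (hp : b p = 1)
    (hb : (M.map (algebraMap F K)).mulVec b = 0) (h : ∀ y, Matrix.vecMul y M = 0 → y = 0) :
    ∃ τ : Fin c ↪ ι, (∀ i, τ i ≠ p) ∧ (M.submatrix id τ).det ≠ 0 := by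
  -- An `F`-linear functional on `K` with `f 1 ≠ 0` maps the solution over `K` to one over `F`;
  -- division by `f 1` restores the entry `1` at `p`.
  obtain ⟨f, hf⟩ := Module.Projective.exists_dual_ne_zero F (one_ne_zero (α := K))
  refine exists_minor_ne_zero M (fun q => (f 1)⁻¹ * f (b q)) p (by
    rw [hp, inv_mul_cancel₀ hf]) ?_ h
  ext i
  have h1 := congr(f ($hb i))
  simp only [Matrix.mulVec, dotProduct, Matrix.map_apply, ← Algebra.smul_def, map_sum, map_smul,
    smul_eq_mul, Pi.zero_apply, map_zero] at h1 ⊢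
  calc _ = (f 1)⁻¹ * ∑ q, M i q * f (b q) := by
        rw [Finset.mul_sum]; exact Finset.sum_congr rfl fun _ _ => by ring
    _ = 0 := by rw [h1, mul_zero]

/-- Every vector in the row space of `M` is a linear relation among the `b q`, and the row space has
dimension `c` minus that of the space of row relations. -/
lemma finrank_span_add_le {K : Type*} [AddCommGroup K] [Module F K] (M : Matrix (Fin c) ι F)
    (b : ι → K) (hb : ∀ i, ∑ q, M i q • b q = 0) :
    Module.finrank F (Submodule.span F (Set.range b)) + c ≤
      Nat.card ι + Module.finrank F (LinearMap.ker M.vecMulLinear) := by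
  let Ψ : (ι → F) →ₗ[F] K := Fintype.linearCombination F b
  have h1 : Submodule.span F (Set.range b) = LinearMap.range Ψ :=
    (Fintype.range_linearCombination F b).symm
  have h2 := LinearMap.finrank_range_add_finrank_ker Ψ
  have h3 := LinearMap.finrank_range_add_finrank_ker M.vecMulLinear
  have h4 : LinearMap.range M.vecMulLinear ≤ LinearMap.ker Ψ := by
    rintro _ ⟨y, rfl⟩
    simp only [LinearMap.mem_ker, Ψ, Fintype.linearCombination_apply, Matrix.vecMulLinear_apply,
      Matrix.vecMul, dotProduct, Finset.sum_smul]
    rw [Finset.sum_comm]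
    refine Finset.sum_eq_zero fun i _ => ?_
    simp only [mul_smul, ← Finset.smul_sum, hb, smul_zero]
  have h5 := Submodule.finrank_mono h4
  rw [Module.finrank_fintype_fun_eq_card] at h2
  rw [Module.finrank_fin_fun] at h3
  rw [h1, Nat.card_eq_fintype_card]
  omega

end LinearAlgebra

/-! ### Algebraic elements and transcendence degrees of generated fields. -/

section Fields

variable {k K : Type*} [Field k] [Field K] [Algebra k K]

/-- The elements that are algebraic over a subalgebra. -/
def algebraicElements (E : Subalgebra k K) : IntermediateField k K where
  __ := (Subalgebra.algebraicClosure E K).restrictScalars k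
  inv_mem' _ h := IsAlgebraic.inv h

lemma mem_algebraicElements {E : Subalgebra k K} {x : K} :
    x ∈ algebraicElements E ↔ IsAlgebraic E x := Iff.rfl

lemma le_algebraicElements {E : Subalgebra k K} {x : K} (hx : x ∈ E) : x ∈ algebraicElements E :=
  isAlgebraic_algebraMap (⟨x, hx⟩ : E)

lemma isAlgebraic_of_isFractionRing {E : Subalgebra k K} (R : Type*) [CommRing R] [Algebra R K]
    [IsFractionRing R K] (h : ∀ x : R, algebraMap R K x ∈ algebraicElements E) :
    Algebra.IsAlgebraic E K := ⟨fun x => by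
  obtain ⟨a, b, -, rfl⟩ := IsFractionRing.div_surjective (A := R) x
  exact mem_algebraicElements.mp (div_mem (h a) (h b))⟩

end Fields

section Trdeg
variable {k K : Type u} [Field k] [Field K] [Algebra k K]

/-- A field generated by the span of finitely many elements, one of them `1`. -/
lemma etrdeg_add_one_le {ι : Type*} [Finite ι] (b : ι → K) (p : ι) (hp : b p = 1)
    (h : Algebra.IsAlgebraic (Algebra.adjoin k (Set.range b)) K) :
    etrdeg k K + 1 ≤ (Module.finrank k (Submodule.span k (Set.range b)) : ℕ∞) := by
  have hfin : FiniteDimensional k (Submodule.span k (Set.range b)) :=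
    FiniteDimensional.span_of_finite k (Set.finite_range b)
  have h1 : LinearIndepOn k id {(1 : K)} := by simp
  have h2 : {(1 : K)} ⊆ Set.range b := by rintro _ rfl; exact ⟨p, hp⟩
  -- A basis of the span that contains `1`. The element `1` is superfluous as an algebra generator,
  -- which saves one in the transcendence degree.
  obtain ⟨s, hs1, hs2, hs3, hs4⟩ := exists_linearIndepOn_id_extension h1 h2
  have hsf : s.Finite := (Set.finite_range b).subset hs1
  have h1s : (1 : K) ∈ s := hs2 rfl
  have hspan : Submodule.span k s = Submodule.span k (Set.range b) :=
    le_antisymm (Submodule.span_mono hs1) (Submodule.span_le.mpr hs3)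
  have hcard : Module.finrank k (Submodule.span k (Set.range b)) = (s \ {1}).ncard + 1 := by
    have := hsf.fintype
    rw [← hspan, finrank_span_set_eq_card hs4, Set.ncard_sdiff_singleton_add_one h1s hsf,
      Set.ncard_eq_toFinset_card']
  have hadj : Algebra.adjoin k (s \ {1}) = Algebra.adjoin k (Set.range b) := by
    refine le_antisymm (Algebra.adjoin_mono (Set.sdiff_subset.trans hs1)) (Algebra.adjoin_le ?_)
    intro x hx
    refine (Submodule.span_le (p := Subalgebra.toSubmodule (Algebra.adjoin k (s \ {1})))).mpr ?_
      (hs3 hx)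
    intro y hy
    by_cases hy1 : y = 1
    · rw [hy1]; exact one_mem (Algebra.adjoin k (s \ {1}))
    · exact Algebra.subset_adjoin ⟨hy, hy1⟩
  rw [← hadj] at h
  rw [hcard]
  push_cast
  refine add_le_add ?_ le_rfl
  have h5 := OrderHomClass.mono Cardinal.toENat
    (Algebra.IsAlgebraic.trdeg_le_cardinalMk k (s \ {1}))
  refine h5.trans (le_of_eq ?_)
  rw [← Set.cast_ncard (hsf.subset Set.sdiff_subset)]
  simp

end Trdeg

/-! ### The dual of the kernel of a quotient map, in coordinates. -/

section Complement

variable {m r : ℕ}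

/-- The complement of an `r`-element subset of the basis. -/
def complEmbedding (I : Fin r ↪o Fin m) : Fin (m - r) ↪o Fin m :=
  (Finset.univ.map I.toEmbedding)ᶜ.orderEmbOfFin (by simp [Finset.card_compl])

lemma mem_range_complEmbedding (I : Fin r ↪o Fin m) (u : Fin m) :
    u ∈ Set.range (complEmbedding I) ↔ u ∉ Set.range I := by
  rw [complEmbedding, Finset.range_orderEmbOfFin]
  simp

/-- The basis as the union of a subset and its complement. -/
def complEquiv (I : Fin r ↪o Fin m) : Fin r ⊕ Fin (m - r) ≃ Fin m :=
  Equiv.ofBijective (Sum.elim I (complEmbedding I)) <| by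
    refine ⟨I.injective.sumElim (complEmbedding I).injective fun s t h => ?_, fun u => ?_⟩
    · exact (mem_range_complEmbedding I _).mp ⟨t, rfl⟩ ⟨s, h⟩
    · by_cases h : u ∈ Set.range I
      · obtain ⟨s, rfl⟩ := h
        exact ⟨Sum.inl s, rfl⟩
      · obtain ⟨t, rfl⟩ := (mem_range_complEmbedding I u).mpr h
        exact ⟨Sum.inr t, rfl⟩

lemma complEquiv_inl (I : Fin r ↪o Fin m) (s : Fin r) : complEquiv I (Sum.inl s) = I s := rfl

lemma complEquiv_inr (I : Fin r ↪o Fin m) (t : Fin (m - r)) :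
    complEquiv I (Sum.inr t) = complEmbedding I t := rfl

variable {S T : Type*} [CommRing S] [CommRing T]

/-- The dual of the kernel of a quotient map `A` that is the identity on the columns in `I`. -/
def complMatrix (I : Fin r ↪o Fin m) (A : Matrix (Fin r) (Fin m) S) :
    Matrix (Fin (m - r)) (Fin m) S :=
  .of fun t u => Sum.elim (fun s => -A s (complEmbedding I t))
    (fun t' => (1 : Matrix (Fin (m - r)) (Fin (m - r)) S) t t') ((complEquiv I).symm u)

lemma complMatrix_apply (I : Fin r ↪o Fin m) (A : Matrix (Fin r) (Fin m) S) (s : Fin r)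
    (t : Fin (m - r)) : complMatrix I A t (I s) = -A s (complEmbedding I t) := by
  rw [← complEquiv_inl, complMatrix, Matrix.of_apply, Equiv.symm_apply_apply]; rfl

lemma complMatrix_apply_compl (I : Fin r ↪o Fin m) (A : Matrix (Fin r) (Fin m) S)
    (t t' : Fin (m - r)) : complMatrix I A t (complEmbedding I t') =
      (1 : Matrix (Fin (m - r)) (Fin (m - r)) S) t t' := by
  rw [← complEquiv_inr, complMatrix, Matrix.of_apply, Equiv.symm_apply_apply]; rfl

variable {n : ℕ}

/-- The pair for the dual of the kernel whose linear form has the coordinates `w`. -/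
def complPair (I : Fin r ↪o Fin m) (A : Matrix (Fin r) (Fin m) S) (w : Fin n × Fin m → S) :
    FactorPair m n (m - r) S :=
  ⟨complMatrix I A, .of fun j t => w (j, complEmbedding I t)⟩

/-- For each `j` the vector `w (j, ·)` lies in the kernel of `A`. As `A` is the identity on `I`, the
coordinates at `I` are determined by those outside `I`, with coefficients `-A`. -/
lemma coords_complPair (I : Fin r ↪o Fin m) {A : Matrix (Fin r) (Fin m) S}
    (hA : A.submatrix id I = 1) {w : Fin n × Fin m → S}
    (hw : ∀ j t, ∑ u, A t u * w (j, u) = 0) : (complPair I A w).coords = w := by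
  ext ⟨j, u⟩
  change ∑ t, w (j, complEmbedding I t) * complMatrix I A t u = w (j, u)
  obtain ⟨x, rfl⟩ := (complEquiv I).surjective u
  rcases x with s | t'
  · have h := hw j s
    rw [← (complEquiv I).sum_comp, Fintype.sum_sum_type] at h
    have h1 : ∀ s', A s (I s') = (1 : Matrix (Fin r) (Fin r) S) s s' := fun s' => congr($hA s s')
    simp only [complEquiv_inl, complEquiv_inr, h1, Matrix.one_apply, ite_mul, one_mul, zero_mul,
      Finset.sum_ite_eq, Finset.mem_univ, if_true] at h
    simp only [complEquiv_inl, complMatrix_apply, mul_comm (w _), neg_mul, Finset.sum_neg_distrib]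
    exact (eq_neg_of_add_eq_zero_left h).symm
  · simp only [complEquiv_inr, complMatrix_apply_compl, Matrix.one_apply, mul_ite, mul_one, mul_zero,
      Finset.sum_ite_eq', Finset.mem_univ, if_true]

lemma complPair_isNormalized (I : Fin r ↪o Fin m) (A : Matrix (Fin r) (Fin m) S)
    (w : Fin n × Fin m → S) (j : Fin n) (t : Fin (m - r)) (h : w (j, complEmbedding I t) = 1) :
    (complPair I A w).IsNormalized ⟨complEmbedding I, j, t⟩ :=
  ⟨by ext a b; exact complMatrix_apply_compl I A a b, h⟩

/-- The summand `1` stands for the normalized entry of `B`. -/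
lemma card_chartVar_add_one (c : ChartIndex m n r) :
    Nat.card (ChartVar c) + 1 = r * (m - r) + n * r := by
  have h1 : Nat.card {p : Fin r × Fin m // p.2 ∉ Set.range c.I} = r * (m - r) := by
    let e : {p : Fin r × Fin m // p.2 ∉ Set.range c.I} ≃ Fin r × {u : Fin m // u ∉ Set.range c.I} :=
      { toFun := fun p => (p.1.1, ⟨p.1.2, p.2⟩)
        invFun := fun p => ⟨(p.1, p.2.1), p.2.2⟩
        left_inv := fun _ => rfl
        right_inv := fun _ => rfl }
    let e' : {u : Fin m // u ∉ Set.range c.I} ≃ Fin (m - r) :=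
      (Equiv.subtypeEquivRight fun u => (mem_range_complEmbedding c.I u).symm).trans
        (Equiv.ofInjective _ (complEmbedding c.I).injective).symm
    rw [Nat.card_congr e, Nat.card_prod, Nat.card_congr e', Nat.card_fin, Nat.card_fin]
  have h2 : Nat.card {q : Fin n × Fin r // q ≠ (c.j, c.s)} + 1 = n * r := by
    classical
    rw [Nat.card_eq_fintype_card, Fintype.card_subtype_compl]
    simp only [Fintype.card_subtype_eq, Fintype.card_prod, Fintype.card_fin]
    have : 0 < n * r := Nat.mul_pos c.j.pos c.s.pos
    omega
  change Nat.card (_ ⊕ _) + 1 = _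
  rw [Nat.card_sum, h1]
  omega

end Complement

/-! ### Points of the dual section obtained from row relations. -/

section Dual

/-- A left inverse of `χ` followed by the coordinates of the basis. The family `g` serves to recover
the coordinates of a vector of `V` linearly from the entries of its image. -/
lemma exists_dual_family {F ι κ V : Type*} [Field F] [Fintype ι] [DecidableEq κ] [AddCommGroup V]
    [Module F V] (χ : V →ₗ[F] ι → F) (hχ : Function.Injective χ) (bas : Module.Basis κ F V) :
    ∃ g : κ → ι → F, ∀ a b, ∑ q, g a q * χ (bas b) q = if a = b then 1 else 0 := by
  classical
  obtain ⟨ψ, hψ⟩ := χ.exists_leftInverse_of_injective (LinearMap.ker_eq_bot.mpr hχ)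
  refine ⟨fun a q => bas.repr (ψ (Pi.single q 1)) a, fun a b => ?_⟩
  have h1 : bas.repr (ψ (χ (bas b))) a = if a = b then 1 else 0 := by
    have : ψ (χ (bas b)) = bas b := congr($hψ (bas b))
    rw [this, Module.Basis.repr_self, Finsupp.single_apply]
    simp only [eq_comm]
  have h2 : χ (bas b) = ∑ q, χ (bas b) q • (Pi.single q 1 : ι → F) := by
    ext q; simp [Finset.sum_apply, Pi.single_apply]
  rw [← h1]
  conv_rhs => rw [h2]
  simp only [map_sum, map_smul, Finsupp.coe_finsetSum, Finset.sum_apply, Finsupp.smul_apply,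
    smul_eq_mul]
  exact Finset.sum_congr rfl fun _ _ => mul_comm _ _

/-- A parametrization of an affine hyperplane `w p = 1` in a space of functions. -/
lemma exists_coordinates {F ι V : Type*} [Field F] [Fintype ι] [AddCommGroup V] [Module F V]
    [FiniteDimensional F V] (φ : V →ₗ[F] ι → F) (hφ : Function.Injective φ) (p : ι) (v : V)
    (hp : φ v p ≠ 0) :
    ∃ e₁, φ e₁ p = 1 ∧ ∃ d, d = Module.finrank F V - 1 ∧ ∃ e : Fin d → V,
      (∀ a, φ (e a) p = 0) ∧ ∃ g : Fin d → ι → F,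
        ∀ a b, ∑ q, g a q * φ (e b) q = if a = b then 1 else 0 := by
  classical
  let ev : V →ₗ[F] F := (LinearMap.proj p).comp φ
  have hev : ev ((ev v)⁻¹ • v) = 1 := by
    rw [map_smul, smul_eq_mul]
    exact inv_mul_cancel₀ hp
  refine ⟨_, hev, _, rfl, ?_⟩
  have hsurj : LinearMap.range ev = ⊤ := LinearMap.range_eq_top.mpr fun a =>
    ⟨a • ((ev v)⁻¹ • v), by rw [map_smul, hev, smul_eq_mul, mul_one]⟩
  have hrank : Module.finrank F (LinearMap.ker ev) = Module.finrank F V - 1 := by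
    have := LinearMap.finrank_range_add_finrank_ker ev
    rw [hsurj, finrank_top, Module.finrank_self] at this
    omega
  let bas : Module.Basis (Fin (Module.finrank F V - 1)) F (LinearMap.ker ev) :=
    Module.finBasisOfFinrankEq F _ hrank
  exact ⟨fun a => bas a, fun a => (bas a).2, exists_dual_family
    (φ.comp (LinearMap.ker ev).subtype) (fun x y h => Subtype.ext (hφ h)) bas⟩

lemma sum_mul_add_sum {S ι κ : Type*} [CommRing S] [Fintype ι] [Fintype κ] (x y : ι → S)
    (X : κ → S) (e : κ → ι → S) :
    ∑ q, x q * (y q + ∑ a, X a * e a q) = ∑ q, x q * y q + ∑ a, X a * ∑ q, x q * e a q := by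
  simp only [mul_add, Finset.sum_add_distrib, Finset.mul_sum, mul_left_comm (x _)]
  rw [Finset.sum_comm]

variable {m n r : ℕ} {k : Type u} [Field k]

/-- The fields of rational functions on the projective bundles of linear forms on `V^∨ ⊗ K^∨` that
vanish on `L^⊥`. -/
lemma exists_prime_of_relations {F : Type u} [Field F] [Algebra k F]
    (N : Submodule k (Fin n × Fin m → k)) (I : Fin r ↪o Fin m) (A : Matrix (Fin r) (Fin m) F)
    (hA : A.submatrix id I = 1)
    (hgen : IntermediateField.adjoin k (Set.range fun q : Fin r × Fin m => A q.1 q.2) = ⊤)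
    {V : Type*} [AddCommGroup V] [Module F V] [FiniteDimensional F V] [Nontrivial V]
    (φ : V →ₗ[F] Fin n × Fin m → F) (hφ : Function.Injective φ)
    (hWA : ∀ v j t, ∑ u, A t u * φ v (j, u) = 0)
    (hWN : ∀ v, ∀ l ∈ N, ∑ p, algebraMap k F (l p) * φ v p = 0) :
    ∃ (c : ChartIndex m n (m - r)) (Q : Ideal (ChartRing k c)), Q.IsPrime ∧ chartIdeal c N ≤ Q ∧
      ((etrdeg k F + (Module.finrank F V - 1 : ℕ) : ℕ∞) : WithBot ℕ∞) ≤
        ringKrullDim (ChartRing k c ⧸ Q) := by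
  classical
  obtain ⟨v, hv⟩ := exists_ne (0 : V)
  -- By `coords_complPair`, a vector of `V` whose entries outside `I` all vanish is zero. The
  -- non-zero entry found here selects the chart.
  obtain ⟨j, t, hjt⟩ : ∃ j t, φ v (j, complEmbedding I t) ≠ 0 := by
    by_contra! h
    refine hv (hφ ?_)
    rw [map_zero, ← coords_complPair I hA (hWA v)]
    ext p
    simp [FactorPair.coords, FactorPair.product, complPair, Matrix.mul_apply, h]
  set p : Fin n × Fin m := (j, complEmbedding I t)
  obtain ⟨e1, he1p, d, hd, e, hep, g, hg⟩ := exists_coordinates φ hφ p v hjt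
  rw [← hd]
  -- the generic element of `W`
  let R := MvPolynomial (Fin d) F
  let G := FractionRing R
  let γ : F →+* G := algebraMap F G
  let X : Fin d → G := fun a => algebraMap R G (MvPolynomial.X a)
  let w : Fin n × Fin m → G := fun q => γ (φ e1 q) + ∑ a, X a * γ (φ (e a) q)
  have hwp : w p = 1 := by simp [w, he1p, hep]
  have hwA : ∀ j t, ∑ u, A.map γ t u * w (j, u) = 0 := fun j t => by
    have h1 := congrArg γ (hWA e1 j t)
    have h2 := fun a => congrArg γ (hWA (e a) j t)
    simp only [map_sum, map_mul, map_zero] at h1 h2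
    refine (sum_mul_add_sum (fun u => A.map γ t u) (fun u => γ (φ e1 (j, u))) X
      (fun a u => γ (φ (e a) (j, u)))).trans ?_
    simp only [Matrix.map_apply, h1, h2, mul_zero, Finset.sum_const_zero, add_zero]
  have hwN : ∀ l ∈ N, ∑ q, algebraMap k G (l q) * w q = 0 := fun l hl => by
    have h0 : ∀ a, algebraMap k G a = γ (algebraMap k F a) := IsScalarTower.algebraMap_apply k F G
    have h1 := congrArg γ (hWN e1 l hl)
    have h2 := fun a => congrArg γ (hWN (e a) l hl)
    simp only [map_sum, map_mul, map_zero, ← h0] at h1 h2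
    refine (sum_mul_add_sum (fun q => algebraMap k G (l q)) (fun q => γ (φ e1 q)) X
      (fun a q => γ (φ (e a) q))).trans ?_
    simp only [h1, h2, mul_zero, Finset.sum_const_zero, add_zero]
  have hAγ : (A.map γ).submatrix id I = 1 := by
    change (A.submatrix id I).map γ = 1
    rw [hA]; simp
  let P := complPair I (A.map γ) w
  have hPc : P.coords = w := coords_complPair I hAγ hwA
  let c : ChartIndex m n (m - r) := ⟨complEmbedding I, j, t⟩
  have hP : P.IsNormalized c := complPair_isNormalized I _ w j t hwp
  let f : ChartRing k c →ₐ[k] G :=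
    { evalPair c (algebraMap k G) P with
      commutes' := fun a => congr($(evalPair_comp_C c (algebraMap k G) P) a) }
  have hf : (generic k c).map (f : ChartRing k c →+* G) = P := map_evalPair _ hP
  refine ⟨c, RingHom.ker f, RingHom.ker_isPrime f, ?_, ?_⟩
  · refine (chartIdeal_le_ker_iff (c := c) (f : ChartRing k c →+* G)).mpr ?_
    have hC : (f : ChartRing k c →+* G).comp MvPolynomial.C = algebraMap k G := f.comp_algebraMap
    rw [hf, hC]
    intro l hl
    rw [FactorPair.pairing, hPc]
    exact hwN l hl
  have hfA : ∀ x y, P.A x y ∈ f.range := fun x y => ⟨(generic k c).A x y, congr(FactorPair.A $hf x y)⟩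
  have hfw : ∀ q, w q ∈ f.range := fun q => by
    refine ⟨(generic k c).coords q, ?_⟩
    have := congr($(FactorPair.map_coords (P := generic k c) (f : ChartRing k c →+* G)) q)
    rw [hf, hPc] at this
    exact this.symm
  -- Outside the identity block, the entries of `A` are up to sign entries of the complementary
  -- matrix, so the point determines all of `F`; then `g` recovers the parameters `X a` from `w`.
  -- Hence `G` is algebraic over the coordinates of the point, and its transcendence degree bounds
  -- the dimension.
  have hA' : ∀ s u, γ (A s u) ∈ algebraicElements f.range := fun s u => by
    obtain ⟨x, rfl⟩ := (complEquiv I).surjective u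
    rcases x with s' | t'
    · have h1 : A s (I s') = (1 : Matrix (Fin r) (Fin r) F) s s' := congr($hA s s')
      rw [complEquiv_inl, h1, Matrix.one_apply]
      split_ifs
      · rw [map_one]; exact one_mem _
      · rw [map_zero]; exact zero_mem _
    · have h1 : P.A t' (I s) = -γ (A s (complEmbedding I t')) := complMatrix_apply I _ s t'
      have h2 := neg_mem (le_algebraicElements (hfA t' (I s)))
      rw [h1, neg_neg] at h2
      exact h2
  have hF : ∀ x, γ x ∈ algebraicElements f.range := fun x => by
    have h1 : IntermediateField.adjoin k (Set.range fun q : Fin r × Fin m => A q.1 q.2) ≤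
        (algebraicElements f.range).comap (IsScalarTower.toAlgHom k F G) := by
      rw [IntermediateField.adjoin_le_iff]
      rintro _ ⟨q, rfl⟩
      exact hA' q.1 q.2
    rw [hgen] at h1
    exact h1 (IntermediateField.mem_top (x := x))
  have hX : ∀ a, X a ∈ algebraicElements f.range := fun a => by
    have h1 : X a = ∑ q, γ (g a q) * w q - γ (∑ q, g a q * φ e1 q) := by
      rw [sum_mul_add_sum, map_sum]
      simp only [map_mul, add_sub_cancel_left]
      simp only [← map_mul, ← map_sum, hg]
      simp
    rw [h1]
    exact sub_mem (sum_mem fun q _ => mul_mem (hF _) (le_algebraicElements (hfw q))) (hF _)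
  have halg : Algebra.IsAlgebraic f.range G := by
    refine isAlgebraic_of_isFractionRing R fun x => ?_
    induction x using MvPolynomial.induction_on with
    | C a => exact hF a
    | add x y hx hy => rw [map_add]; exact add_mem hx hy
    | mul_X x a hx => rw [map_mul]; exact mul_mem hx (hX a)
  have : Finite (ChartVar c) := inferInstanceAs (Finite (_ ⊕ _))
  refine le_trans ?_ (etrdeg_le_ringKrullDim_quotient_ker f halg)
  rw [← etrdeg_add k F G]
  norm_cast
  refine add_le_add le_rfl ?_
  have h1 : etrdeg F R ≤ etrdeg F G :=
    etrdeg_le_of_injective (IsScalarTower.toAlgHom F R G) (IsFractionRing.injective R G)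
  refine le_trans (le_of_eq ?_) h1
  simp [etrdeg, R, MvPolynomial.trdeg_of_isDomain]

end Dual

/-! ### The dimension count: every component has a non-zero minor. -/

section Minors

variable {m n r : ℕ} {k : Type u} [Field k] (L : Submodule k (Fin n × Fin m → k))

/-- Krull's height theorem needs the ideal generated by only `dim L` elements. -/
lemma chartIdeal_eq_span (c : ChartIndex m n r) : chartIdeal c L = Ideal.span (Set.range
    fun i => (generic k c).pairing MvPolynomial.C (Module.finBasis k L i).1) := by
  refine le_antisymm ?_ (Ideal.span_mono ?_)
  · set J := Ideal.span (Set.range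
      fun i => (generic k c).pairing MvPolynomial.C (Module.finBasis k L i).1)
    have h : chartIdeal c L ≤ RingHom.ker (Ideal.Quotient.mk J) := by
      rw [chartIdeal_le_ker_iff, satisfies_iff]
      ext i
      rw [formMatrix_mulVec, FactorPair.map_pairing]
      exact Ideal.Quotient.eq_zero_iff_mem.mpr (Ideal.subset_span ⟨i, rfl⟩)
    rwa [Ideal.mk_ker] at h
  · rintro _ ⟨i, rfl⟩
    exact ⟨_, rfl⟩

/-- The matrix of the inclusion of `L`. -/
def basisMatrix (F : Type*) [Field F] [Algebra k F] :
    Matrix (Fin (Module.finrank k L)) (Fin n × Fin m) F :=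
  .of fun i p => algebraMap k F ((Module.finBasis k L i).1 p)

/-- A basis of `L` stays independent over `F`: a right inverse of the matrix already exists over
`k`. -/
lemma vecMul_basisMatrix_injective (F : Type*) [Field F] [Algebra k F] :
    Function.Injective (basisMatrix L F).vecMulLinear := by
  classical
  obtain ⟨g, hg⟩ := exists_dual_family L.subtype Subtype.val_injective (Module.finBasis k L)
  let G : Matrix (Fin n × Fin m) (Fin (Module.finrank k L)) F :=
    .of fun q a => algebraMap k F (g a q)
  have h : basisMatrix L F * G = 1 := by
    ext b a
    have h1 := congrArg (algebraMap k F) (hg a b)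
    simp only [G, Matrix.mul_apply, basisMatrix, Matrix.of_apply, Matrix.one_apply,
      ← map_mul, ← map_sum]
    refine (congrArg _ (Finset.sum_congr rfl fun _ _ => mul_comm _ _)).trans (h1.trans ?_)
    by_cases hab : a = b
    · simp [hab]
    · simp [hab, Ne.symm hab]
  intro x y hxy
  have h2 := congrArg (fun z => Matrix.vecMul z G) hxy
  simpa [Matrix.vecMul_vecMul, h] using h2

/-- The image under `A` of the element of `L ⊗ F` with coordinates `y` is the combination of the
rows of the form matrix with coefficients `y`. So row relations are the elements of `L ⊗ F` that lie
in `V ⊗ ker A`. -/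
lemma sum_mul_vecMul_basisMatrix {F : Type*} [Field F] [Algebra k F]
    (A : Matrix (Fin r) (Fin m) F) (y : Fin (Module.finrank k L) → F) (j : Fin n) (t : Fin r) :
    ∑ u, A t u * Matrix.vecMul y (basisMatrix L F) (j, u) =
      Matrix.vecMul y (formMatrix L (algebraMap k F) A) (j, t) := by
  simp only [Matrix.vecMul, dotProduct, basisMatrix, formMatrix, Matrix.of_apply, Finset.mul_sum]
  rw [Finset.sum_comm]
  exact Finset.sum_congr rfl fun _ _ => Finset.sum_congr rfl fun _ _ => by ring

lemma sum_mul_vecMul_basisMatrix_of_mem {F : Type*} [Field F] [Algebra k F]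
    (y : Fin (Module.finrank k L) → F) {l : Fin n × Fin m → k} (hl : l ∈ orthogonal L) :
    ∑ p, algebraMap k F (l p) * Matrix.vecMul y (basisMatrix L F) p = 0 := by
  simp only [Matrix.vecMul, dotProduct, basisMatrix, Matrix.of_apply, Finset.mul_sum]
  rw [Finset.sum_comm]
  refine Finset.sum_eq_zero fun i _ => ?_
  have h := congrArg (algebraMap k F) (hl _ (Module.finBasis k L i).2)
  simp only [dotProduct, map_sum, map_mul, map_zero] at h
  simp only [mul_left_comm _ (y i), ← Finset.mul_sum, h, mul_zero]

lemma adjoin_eq_top_of_adjoin {K : Type*} [Field K] [Algebra k K] {σ : Type*} (f : σ → K)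
    (F : IntermediateField k K) (hF : F = IntermediateField.adjoin k (Set.range f)) (g : σ → F)
    (hg : ∀ i, (g i : K) = f i) : IntermediateField.adjoin k (Set.range g) = ⊤ := by
  apply IntermediateField.lift_injective F
  rw [IntermediateField.lift_adjoin, IntermediateField.lift_top, ← Set.range_comp]
  exact (congrArg (fun f => IntermediateField.adjoin k (Set.range f)) (funext hg)).trans hF.symm

variable {L} in
/-- A dimension count on the sections by `L` and by its orthogonal subspace. -/
lemma exists_formMinor_ne_zero {F K : Type u} [Field F] [Field K] [Algebra k F] [Algebra F K]
    [Algebra k K] [IsScalarTower k F K] (I : Fin r ↪o Fin m) (p : Fin n × Fin r)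
    (A : Matrix (Fin r) (Fin m) F) (b : Fin n × Fin r → K) (hA : A.submatrix id I = 1)
    (hgen : IntermediateField.adjoin k (Set.range fun q : Fin r × Fin m => A q.1 q.2) = ⊤)
    (hp : b p = 1) (hb : ((formMatrix L (algebraMap k F) A).map (algebraMap F K)).mulVec b = 0)
    (halg : Algebra.IsAlgebraic (Algebra.adjoin F (Set.range b)) K)
    (hcount : ((r * (m - r) + n * r : ℕ) : ℕ∞) ≤ Module.finrank k L + etrdeg k K + 1)
    (H : ∀ (c : ChartIndex m n (m - r)) (Q : Ideal (ChartRing k c)), Q.IsPrime →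
      chartIdeal c (orthogonal L) ≤ Q →
      ringKrullDim (ChartRing k c ⧸ Q) + 2 ≤ ((r * (m - r) : ℕ) : WithBot ℕ∞)) :
    ∃ τ : Fin (Module.finrank k L) ↪ Fin n × Fin r, (∀ i, τ i ≠ p) ∧
      formMinor L τ (algebraMap k F) A ≠ 0 := by
  set M := formMatrix L (algebraMap k F) A
  by_cases hM : ∀ y, Matrix.vecMul y M = 0 → y = 0
  · exact exists_minor_ne_zero_of_extension M b p hp hb hM
  · exfalso
    let V := LinearMap.ker M.vecMulLinear
    have hV : Nontrivial V := by
      push Not at hM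
      obtain ⟨y, hy, hy0⟩ := hM
      exact ⟨⟨y, hy⟩, 0, fun h => hy0 congr(Subtype.val $h)⟩
    -- The non-zero space `V` of row relations yields a subvariety of the dual section of dimension
    -- at least `trdeg F + dim V - 1`.
    obtain ⟨c', Q, hQ, hle, hdim⟩ := exists_prime_of_relations (orthogonal L) I A hA hgen
      ((basisMatrix L F).vecMulLinear.comp V.subtype)
      ((vecMul_basisMatrix_injective L F).comp Subtype.val_injective)
      (fun v j t => (sum_mul_vecMul_basisMatrix L A v.1 j t).trans congr($(v.2) (j, t)))
      (fun v l hl => sum_mul_vecMul_basisMatrix_of_mem L v.1 hl)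
    have hspan := finrank_span_add_le M b fun i => by
      simp only [Algebra.smul_def]
      exact congr($hb i)
    have hFK := etrdeg_add_one_le (k := F) b p hp halg
    have hVpos : 0 < Module.finrank F V := Module.finrank_pos
    rw [← etrdeg_add k F K] at hcount
    have hfin : etrdeg k F + ((Module.finrank F V - 1 : ℕ) : ℕ∞) + 2 ≤ ((r * (m - r) : ℕ) : ℕ∞) := by
      exact WithBot.coe_le_coe.mp <| (add_le_add hdim le_rfl).trans (H c' Q hQ hle)
    clear H hdim
    generalize r * (m - r) = N at *
    generalize etrdeg k F = a at *
    generalize etrdeg F K = e at *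
    -- The upper bounds make both transcendence degrees finite. The inequalities now combine to
    -- `r(m-r) ≤ trdeg F + dim V`, against `trdeg F + dim V + 1 ≤ r(m-r)` from `hfin`.
    lift a to ℕ using (by rintro rfl; simp at hfin)
    lift e to ℕ using (by rintro rfl; simp at hFK)
    norm_cast at hfin hFK hcount
    simp only [Nat.card_prod, Nat.card_fin] at hspan
    change _ ≤ n * r + Module.finrank F V at hspan
    omega

/-- The dimension count is applied to the function field `K` of each component of a chart of the
section. A minor is non-zero in `K` exactly when it does not belong to the minimal prime `P`. -/
theorem hasMinors_of_ringKrullDim_le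
    (H : ∀ (c : ChartIndex m n (m - r)) (Q : Ideal (ChartRing k c)), Q.IsPrime →
      chartIdeal c (orthogonal L) ≤ Q →
      ringKrullDim (ChartRing k c ⧸ Q) + 2 ≤ ((r * (m - r) : ℕ) : WithBot ℕ∞)) :
    HasMinors r L := by
  intro c P hP
  have hPp : P.IsPrime := hP.1.1
  have : Finite (ChartVar c) := inferInstanceAs (Finite (_ ⊕ _))
  let R := ChartRing k c ⧸ P
  let K := FractionRing R
  let θ : ChartRing k c →ₐ[k] K := (IsScalarTower.toAlgHom k R K).comp (Ideal.Quotient.mkₐ k P)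
  have hθ : ∀ x ∈ P, θ x = 0 := fun x hx => by
    have : Ideal.Quotient.mk P x = 0 := Ideal.Quotient.eq_zero_iff_mem.mpr hx
    change algebraMap R K (Ideal.Quotient.mk P x) = 0
    rw [this, map_zero]
  let p := (generic k c).map (θ : ChartRing k c →+* K)
  have hp : p.IsNormalized c := (generic_isNormalized k c).map _
  have hC : (θ : ChartRing k c →+* K).comp MvPolynomial.C = algebraMap k K := θ.comp_algebraMap
  have hpL : (formMatrix L (algebraMap k K) p.A).mulVec p.vec = 0 := by
    rw [← satisfies_iff, ← hC, ← chartIdeal_le_ker_iff]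
    exact fun x hx => hθ x (hP.1.2 hx)
  -- the field generated by the entries of `A`
  let F := IntermediateField.adjoin k (Set.range fun q : Fin r × Fin m => p.A q.1 q.2)
  let A : Matrix (Fin r) (Fin m) F :=
    .of fun s u => ⟨p.A s u, IntermediateField.subset_adjoin _ _ ⟨(s, u), rfl⟩⟩
  have hAp : A.map (algebraMap F K) = p.A := rfl
  have hA : A.submatrix id c.I = 1 := by
    ext s s'
    have h1 := congr($hp.block_eq s s')
    simp only [FactorPair.block, Matrix.submatrix_apply, id] at h1
    simp only [A, Matrix.submatrix_apply, Matrix.of_apply, id, h1, Matrix.one_apply]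
    split_ifs <;> rfl
  have hgen := adjoin_eq_top_of_adjoin (k := k) (fun q : Fin r × Fin m => p.A q.1 q.2) F rfl
    (fun q => A q.1 q.2) fun _ => rfl
  have hMK : (formMatrix L (algebraMap k F) A).map (algebraMap F K) =
      formMatrix L (algebraMap k K) p.A := by
    rw [formMatrix_map, hAp, ← IsScalarTower.algebraMap_eq]
  have halg : Algebra.IsAlgebraic (Algebra.adjoin F (Set.range p.vec)) K := by
    refine isAlgebraic_of_isFractionRing R fun x => ?_
    obtain ⟨x, rfl⟩ := Ideal.Quotient.mk_surjective x
    change θ x ∈ _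
    induction x using MvPolynomial.induction_on with
    | C a =>
      have : θ (MvPolynomial.C a) = algebraMap F K (algebraMap k F a) := congr($hC a)
      rw [this]
      exact (algebraicElements _).algebraMap_mem _
    | add x y hx hy => rw [map_add]; exact add_mem hx hy
    | mul_X x v hx =>
      rw [map_mul]
      refine mul_mem hx ?_
      obtain ⟨t, l, hl, rfl⟩ | ⟨q, hq, rfl⟩ := chartVar_cases c v
      · rw [← generic_A_of_notMem]
        exact (algebraicElements _).algebraMap_mem (A t l)
      · rw [← generic_B_of_ne]
        exact le_algebraicElements (Algebra.subset_adjoin ⟨q, rfl⟩)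
  have hcount : ((r * (m - r) + n * r : ℕ) : ℕ∞) ≤ Module.finrank k L + etrdeg k K + 1 := by
    rw [chartIdeal_eq_span] at hP
    have h1 := card_le_add_etrdeg_of_mem_minimalPrimes _ hP
    have h2 : etrdeg k R ≤ etrdeg k K :=
      etrdeg_le_of_injective (IsScalarTower.toAlgHom k R K) (IsFractionRing.injective R K)
    rw [Nat.card_fin] at h1
    rw [← card_chartVar_add_one c, Nat.cast_add, Nat.cast_one]
    exact add_le_add (h1.trans (add_le_add le_rfl h2)) le_rfl
  obtain ⟨τ, hτ, hdet⟩ := exists_formMinor_ne_zero c.I (c.j, c.s) A p.vec hA hgen hp.entry_eq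
    (by rw [hMK]; exact hpL) halg hcount H
  refine ⟨τ, hτ, fun hmem => hdet ?_⟩
  have h1 := hθ _ hmem
  have h2 : θ (chartMinor c L τ) = formMinor L τ (algebraMap k K) p.A := by
    rw [← hC]; exact map_formMinor L τ _ _ _
  have h3 := map_formMinor L τ (algebraMap k F) (algebraMap F K) A
  rw [← IsScalarTower.algebraMap_eq, hAp, ← h2, h1] at h3
  exact (map_eq_zero _).mp h3

end Minors

/-! ### From expected dimensions to rationality. -/

section Main

variable {m n r : ℕ} {k : Type u} [Field k]

lemma orthogonal_orthogonal {σ : Type} [Fintype σ] (L : Submodule k (σ → k)) :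
    orthogonal (orthogonal L) = L := by
  classical
  refine le_antisymm (fun x hx => ?_) fun x hx w hw => by
    rw [dotProduct_comm]; exact hw x hx
  by_contra hxL
  obtain ⟨f, hfx, hf⟩ := Submodule.exists_dual_map_eq_bot_of_notMem hxL inferInstance
  let y : σ → k := fun i => f (Pi.single i 1)
  have hfy : ∀ z, f z = z ⬝ᵥ y := fun z => by
    conv_lhs => rw [pi_eq_sum_univ' z]
    simp only [map_sum, map_smul, smul_eq_mul, dotProduct, y]
  refine hfx ((hfy x).trans (hx y fun l hl => ?_))
  rw [dotProduct_comm, ← hfy]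
  have : f l ∈ L.map f := Submodule.mem_map_of_mem hl
  rwa [hf, Submodule.mem_bot] at this

/-- The quotient defines a closed subset of a chart of the section, and the chart is open in the
section. -/
lemma ringKrullDim_quotient_le (L : Submodule k (Fin n × Fin m → k)) (c : ChartIndex m n r)
    (Q : Ideal (ChartRing k c)) (hQ : chartIdeal c L ≤ Q) :
    ringKrullDim (ChartRing k c ⧸ Q) ≤ topologicalKrullDim (sectionX r L) := by
  refine (ringKrullDim_le_of_surjective (Ideal.Quotient.factor hQ)
    (Ideal.Quotient.factor_surjective hQ)).trans ?_
  rw [← PrimeSpectrum.topologicalKrullDim_eq_ringKrullDim]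
  exact (sectionChart c L).isOpenEmbedding.isInducing.topologicalKrullDim_le

lemma nonempty_of_hasExpectedDim {X : Scheme.{u}} {e : ℤ} (h : HasExpectedDim X e) (he : 0 ≤ e) :
    Nonempty X := by
  by_contra hX
  rw [not_nonempty_iff] at hX
  have h1 := h.1 he
  have h2 : topologicalKrullDim X = ⊥ := Order.krullDim_eq_bot_iff.mpr ⟨fun Z => hX.false Z.2.1.nonempty.some⟩
  rw [h2] at h1
  exact WithBot.bot_ne_coe h1

/-- No sign condition on `e` is needed: the empty scheme has dimension `⊥`, which satisfies every
upper bound. -/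
lemma topologicalKrullDim_add_le {X : Scheme.{u}} {e : ℤ} (h : HasExpectedDim X e) {N d : ℕ}
    (he : e + d ≤ N) : topologicalKrullDim X + d ≤ N := by
  rcases lt_or_ge e 0 with h0 | h0
  · have hX := h.2 h0
    have h2 : topologicalKrullDim X = ⊥ := Order.krullDim_eq_bot_iff.mpr ⟨fun Z => hX.false Z.2.1.nonempty.some⟩
    rw [h2, WithBot.bot_add]
    exact bot_le
  · rw [h.1 h0]
    norm_cast
    omega

theorem isRational_sectionX (L : Submodule k (Fin n × Fin m → k)) (hne : Nonempty (sectionX r L))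
    (hdim : topologicalKrullDim (sectionX (m - r) (orthogonal L)) + (2 : ℕ) ≤ (r * (m - r) : ℕ)) :
    IsRational (sectionXStructure r L) :=
  isRational_of_hasMinors L (hasMinors_of_ringKrullDim_le L fun c Q _ hle =>
    (add_le_add (ringKrullDim_quotient_le _ c Q hle) le_rfl).trans hdim) hne

end Main

end Determinantal

end

theorem mainTheorem7 {k : Type*} [Field k] [IsAlgClosed k] [CharZero k]
    (m n r c : ℕ) (hmn : m ≤ n) (hr : 1 ≤ r) (hrm : r ≤ m - 1) (hc : 1 ≤ c) (hcmn : c ≤ m * n)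
    (L : Submodule k (Fin n × Fin m → k)) (hL : Module.finrank k L = c)
    (hadm : Determinantal.IsAdmissible r L) :
    (c < n * r → Determinantal.IsRational (Determinantal.sectionXStructure r L)) ∧
    (n * r < c → Determinantal.IsRational (Determinantal.sectionYStructure r L)) := by
  obtain ⟨hX, hY⟩ := hadm
  rw [hL] at hX hY
  -- With `m = r + s` the expected dimensions read `rs + (nr - c) - 1` for `X_L` and `rs - (nr - c)
  -- - 1` for `Y_L`. If `nr > c`, the first is non-negative and the second at most `rs - 2`; if `c >
  -- nr`, the roles are reversed.
  obtain ⟨s, rfl⟩ : ∃ s, m = r + s := ⟨m - r, by omega⟩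
  have hs : r + s - r = s := by omega
  push_cast at hX hY
  refine ⟨fun h => ?_, fun h => ?_⟩
  · refine Determinantal.isRational_sectionX L
      (Determinantal.nonempty_of_hasExpectedDim hX ?_)
      (Determinantal.topologicalKrullDim_add_le hY ?_)
    · zify at h
      nlinarith [mul_nonneg (Int.natCast_nonneg r) (Int.natCast_nonneg s)]
    · rw [hs]
      zify at h
      push_cast
      nlinarith
  · refine Determinantal.isRational_sectionX _
      (Determinantal.nonempty_of_hasExpectedDim hY ?_) ?_
    · zify at h
      nlinarith [mul_nonneg (Int.natCast_nonneg r) (Int.natCast_nonneg s)]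
    · have hs' : r + s - (r + s - r) = r := by omega
      -- The section dual to `Y_L` is `X_L` itself: the complementary rank is `r` again, and `L^⊥⊥ =
      -- L`.
      rw [Determinantal.orthogonal_orthogonal, hs']
      refine Determinantal.topologicalKrullDim_add_le hX ?_
      rw [hs]
      zify at h
      push_cast
      nlinarith
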